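/- Let $\mathbb K=\mathbb C$ or $\mathbb R$, and let $\lambda=(\lambda_1,\dots,\lambda_m)$, $m\ge 0$. A formal family of vector fields is $X(x;\lambda)\,\partial_x$ with $X\in\mathbb K[[x,\lambda]]$. A formal change of coordinate is a series $\phi\in\mathbb K[[x,\lambda]]$ with $\phi(0;0)=0$, $\partial_x\phi(0;0)\neq0$; it conjugates $X$ to $X'$, written $X=\phi^*X'$, if $X'(\phi(x;\lambda);\lambda)=X(x;\lambda)\,\partial_x\phi(x;\lambda)$. Two families are formally conjugate if such a $\phi$ exists. Analytic germs are the convergent power series, and $X,X'$ are analytically conjugate if $\phi$ can be chosen convergent. Two deformations of the same vector field $X(x;0)=X'(x;0)$ are equivalent if they are conjugate by some $\phi$ with $\phi(x;0)=x$. A deformation $X'(x;\lambda')$, $\lambda'\in\mathbb K^p$, is universal if for every $m$ and every deformation $X(x;\lambda)$, $\lambda\in\mathbb K^m$, of $X'(x;0)$ there is a formal map $\lambda'=\psi(\lambda)$ with $\psi(0)=0$ such that $X$ is equivalent to the induced deformation $X'(x;\psi(\lambda))$, and this $\psi$ is unique. **Theorem (formal theory).** **(1) Complex case** ($\mathbb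 K=\mathbb C$). (i) *Existence.* Every formal family $\tilde X(x;\lambda)$ with $\tilde X(x;0)=x^{k+1}/\omega(x)$, $\omega(0)\ne0$, $k\ge0$, is formally conjugate to a family of the form $$c(\lambda)\,x\,\partial_x\quad(k=0),\qquad \frac{x^{k+1}+y_{k-1}(\lambda)x^{k-1}+\dots+y_0(\lambda)}{1+\mu(\lambda)x^k}\,\partial_x\quad(k\ge1),\tag{$*$}$$ with $c,y_j,\mu\in\mathbb C[[\lambda]]$, $y_j(0)=0$. For $k\ge1$, $\mu(\lambda)$ is minus the residue at $x=\infty$ of the dual form of $(*)$, and is the sum of the residues of $\tilde X(x;\lambda)^{-1}dx$ over its polar locus near the origin, i.e. the coefficient of $x^{-1}$ in the inverse of $\tilde X$ in $\mathbb C((x))[[\lambda]]$. (ii) *Uniqueness.* For $k=0$: if $\phi$ conjugates $c(\lambda)x\,\partial_x$ to $c'(\lambda)x\,\partial_x$, with $c(0),c'(0)\neq0$, then $c'=c$ and $\phi=e^{t(\lambda)}x$ for some $t\in\mathbb C[[\lambda]]$. For $k\ge1$: two families $(*)$ with data $(y,\mu)$, $(y',\mu')$, $y(0)=y'(0)=0$,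 are formally conjugate if and only if $\mu'=\mu$ and there is $l\in\mathbb Z_k$ with $y'_j=e^{-2\pi i(j-1)l/k}y_j$ for $j=0,\dots,k-1$. Moreover, every $\phi$ conjugating the first family $X$ to the second is of the form $\phi=e^{2\pi i l/k}\exp(t(\lambda)X)(x;\lambda)$ for such an $l$ and some $t\in\mathbb C[[\lambda]]$, where $\exp(tX)(x;\lambda)=\sum_n\frac{t^n}{n!}(X\partial_x)^n x$ is the formal flow. (iii) *Universality.* For $k\ge1$ and $\mu\in\mathbb C$, the deformation $\dfrac{x^{k+1}+y_{k-1}x^{k-1}+\dots+y_0}{1+(\mu+y_{2k+1})x^k}\,\partial_x$ of $\dfrac{x^{k+1}}{1+\mu x^k}\,\partial_x$, with parameters $(y_0,\dots,y_{k-1},y_{2k+1})$, is universal among formal deformations. **Real case** ($\mathbb K=\mathbb R$). The same statements hold for series with real coefficients, where in $(*)$ with $k\ge1$, and in (iii), the constant term $1$ of the denominator is replaced by $\varepsilon^{k+1}$ with $\varepsilon\in\{1,-1\}$. In (ii) for $k=0$, $\phi=\pm e^{t(\lambda)}x$ with $t\in\mathbb R[[\lambda]]$; for $k\ge1$, $\varepsilon^{k+1}$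 is also uniquely determined, $t$ is real, and the rotations $e^{2\pi il/k}$ are the real ones: $\zeta=1$, and also $\zeta=-1$ if $k$ is even, acting by $y_j\mapsto\zeta^{1-j}y_j$. **(2)** Let $X,X'$ be convergent complex families (with the same parameter $\lambda\in\mathbb C^m$), with $X(x;0)\not\equiv0$. Then $X$ and $X'$ are formally conjugate if and only if they are analytically conjugate. Moreover, let $\hat{\mathcal I}_\lambda\subset\mathbb C[[x,\lambda]]$ be the ideal of the series that vanish for $\lambda=0$. If $\hat\phi$ is a formal change of coordinate with $X=\hat\phi^*X'$, then for every $n>0$ there is a convergent change of coordinate $\phi_n$ with $X=\phi_n^*X'$ and $\phi_n\equiv\hat\phi \bmod \hat{\mathcal I}_\lambda^n$. -/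

import Mathlib

namespace KostovFormal

noncomputable section

/-- Formal power series in the parameters `λ = (λ_1, …, λ_m)`. -/
abbrev ParamSeries (m : ℕ) (𝕜 : Type*) := MvPowerSeries (Fin m) 𝕜

/-- Formal power series in `(x, λ)`; the variable `none` is `x`, the variable `some i` is the
`i`-th parameter.  The series `X` stands for the formal family of vector fields
`X(x;λ) ∂/∂x`, and also for formal coordinates `x' = φ(x;λ)`. -/
abbrev FormalFamily (m : ℕ) (𝕜 : Type*) := MvPowerSeries (Option (Fin m)) 𝕜

section Field

variable {𝕜 : Type*} [Field 𝕜] {m : ℕ}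

/-- The coordinate `x`. -/
def coordX : FormalFamily m 𝕜 := MvPowerSeries.X none

/-- A series in `λ` seen as a series in `(x, λ)`. -/
def ofParam : ParamSeries m 𝕜 →ₐ[𝕜] FormalFamily m 𝕜 :=
  MvPowerSeries.rename (Function.Embedding.some : Fin m ↪ Option (Fin m))

/-- The restriction `f(x;λ) ↦ f(x;0)`. -/
def atZero : FormalFamily m 𝕜 →ₐ[𝕜] PowerSeries 𝕜 :=
  MvPowerSeries.killCompl
    (⟨fun _ => none, fun _ _ _ => rfl⟩ : Unit ↪ Option (Fin m))

/-- The ideal of the series in `(x, λ)` that vanish for `λ = 0`. -/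
def lambdaIdeal (m : ℕ) (𝕜 : Type*) [Field 𝕜] : Ideal (FormalFamily m 𝕜) :=
  RingHom.ker (atZero : FormalFamily m 𝕜 →ₐ[𝕜] PowerSeries 𝕜)

/-- `X(x;0) = x^(k+1) / ω(x)` with `ω(0) ≠ 0`. -/
def IsUnfoldingOfOrder (k : ℕ) (X : FormalFamily m 𝕜) : Prop :=
  ∃ ω : PowerSeries 𝕜, PowerSeries.constantCoeff ω ≠ 0 ∧
    atZero X = (PowerSeries.X : PowerSeries 𝕜) ^ (k + 1) * ω⁻¹

/-- `x' = φ(x;λ)` is an invertible formal change of coordinate near the origin, fixing `λ`. -/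
def IsCoordChange (φ : FormalFamily m 𝕜) : Prop :=
  MvPowerSeries.constantCoeff φ = 0 ∧
    MvPowerSeries.constantCoeff (MvPowerSeries.pderiv 𝕜 none φ) ≠ 0

/-- The series `X(φ(x;λ);λ)`. -/
def compCoord (X φ : FormalFamily m 𝕜) : FormalFamily m 𝕜 :=
  MvPowerSeries.subst
    (fun o : Option (Fin m) => o.elim φ (fun i => MvPowerSeries.X (some i))) X

/-- The change of coordinate `φ` conjugates `X` to `X'`, i.e. `X = φ^* X'`:
`X'(φ(x;λ);λ) = X(x;λ) ∂φ/∂x`. -/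
def Conjugates (φ X X' : FormalFamily m 𝕜) : Prop :=
  IsCoordChange φ ∧ compCoord X' φ = X * MvPowerSeries.pderiv 𝕜 none φ

/-- Formal conjugacy of two formal families with the same parameter. -/
def FormallyConjugate (X X' : FormalFamily m 𝕜) : Prop :=
  ∃ φ : FormalFamily m 𝕜, Conjugates φ X X'

/-- Equivalence of deformations: same vector field at `λ = 0`, and a conjugacy which is the
identity for `λ = 0`. -/
def EquivalentDeformations (X X' : FormalFamily m 𝕜) : Prop :=
  atZero X = atZero X' ∧
    ∃ φ : FormalFamily m 𝕜, Conjugates φ X X' ∧ atZero φ = PowerSeries.X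

/-- A formal germ of a map `λ' = ψ(λ)` from `m` to `p` parameters, with `ψ(0) = 0`. -/
def IsParamMap {p : ℕ} (ψ : Fin p → ParamSeries m 𝕜) : Prop :=
  ∀ i, MvPowerSeries.constantCoeff (ψ i) = 0

/-- The family `X'(x;ψ(λ))` induced from `X'` by `ψ`. -/
def induced {p : ℕ} (X' : FormalFamily p 𝕜) (ψ : Fin p → ParamSeries m 𝕜) :
    FormalFamily m 𝕜 :=
  MvPowerSeries.subst
    (fun o : Option (Fin p) => o.elim coordX (fun i => ofParam (ψ i))) X'

/-- Every formal deformation of `X'(x;0)`, with any number of parameters, is equivalent to one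
induced from `X'`. -/
def IsVersal {p : ℕ} (X' : FormalFamily p 𝕜) : Prop :=
  ∀ (m : ℕ) (X : FormalFamily m 𝕜), atZero X = atZero X' →
    ∃ ψ : Fin p → ParamSeries m 𝕜, IsParamMap ψ ∧ EquivalentDeformations X (induced X' ψ)

/-- A versal deformation is universal if the inducing map is unique. -/
def IsUniversal {p : ℕ} (X' : FormalFamily p 𝕜) : Prop :=
  IsVersal X' ∧
    ∀ (m : ℕ) (X : FormalFamily m 𝕜), atZero X = atZero X' →
      ∀ ψ₁ ψ₂ : Fin p → ParamSeries m 𝕜,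
        IsParamMap ψ₁ → EquivalentDeformations X (induced X' ψ₁) →
        IsParamMap ψ₂ → EquivalentDeformations X (induced X' ψ₂) → ψ₁ = ψ₂

/-- `c(λ) x`. -/
def linearForm (c : ParamSeries m 𝕜) : FormalFamily m 𝕜 := ofParam c * coordX

/-- The polynomial `x^(k+1) + y_(k-1)(λ) x^(k-1) + … + y_0(λ)` in `x`. -/
def numerator (k : ℕ) (y : Fin k → ParamSeries m 𝕜) : Polynomial (ParamSeries m 𝕜) :=
  Polynomial.X ^ (k + 1) + ∑ j : Fin k, Polynomial.C (y j) * Polynomial.X ^ (j : ℕ)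

/-- The polynomial `s + μ(λ) x^k` in `x`, for a constant `s`. -/
def denominator (k : ℕ) (s : 𝕜) (μ : ParamSeries m 𝕜) : Polynomial (ParamSeries m 𝕜) :=
  Polynomial.C (MvPowerSeries.C s) + Polynomial.C μ * Polynomial.X ^ k

/-- A polynomial in `x` over the series in `λ`, seen as a series in `(x, λ)`. -/
def polyToSeries (P : Polynomial (ParamSeries m 𝕜)) : FormalFamily m 𝕜 :=
  P.eval₂ (ofParam : ParamSeries m 𝕜 →ₐ[𝕜] FormalFamily m 𝕜).toRingHom coordX

/-- The family `(x^(k+1) + y_(k-1)(λ) x^(k-1) + … + y_0(λ)) / (s + μ(λ) x^k)`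
(used for `k ≥ 1` and `s ≠ 0`, where the denominator is invertible). -/
def normalForm (k : ℕ) (s : 𝕜) (y : Fin k → ParamSeries m 𝕜) (μ : ParamSeries m 𝕜) :
    FormalFamily m 𝕜 :=
  polyToSeries (numerator k y) * (polyToSeries (denominator k s μ))⁻¹

/-- The deformation
`(x^(k+1) + y_(k-1) x^(k-1) + … + y_0) / (s + (μ + y_(2k+1)) x^k)` of `x^(k+1) / (s + μ x^k)`;
its `k+1` parameters are `y_0, …, y_(k-1)`, in this order, and, as the last one, `y_(2k+1)`. -/
def standardDeformation (k : ℕ) (s μ : 𝕜) : FormalFamily (k + 1) 𝕜 :=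
  normalForm k s (fun j : Fin k => MvPowerSeries.X j.castSucc)
    (MvPowerSeries.C μ + MvPowerSeries.X (Fin.last k))

/-- The expansion of a polynomial in `x` as a Laurent series in `z = 1/x`. -/
def expandAtInfinity {R : Type*} [CommRing R] (P : Polynomial R) : LaurentSeries R :=
  P.eval₂ (HahnSeries.C : R →+* LaurentSeries R) (HahnSeries.single (-1 : ℤ) (1 : R))

/-- The residue at `x = ∞` of the form `(N(x) / D(x)) dx` for polynomials `N` and `D` with `D`
monic: minus the coefficient of `z = 1/x` in the expansion of `N / D` in powers of `z`. -/
def residueAtInfinity {R : Type*} [CommRing R] (N D : Polynomial R) : R :=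
  -(expandAtInfinity N * Ring.inverse (expandAtInfinity D)).coeff 1

/-- A series in `(x, λ)` seen as a series in `λ` whose coefficients are Laurent series in `x`. -/
def toLaurent (X : FormalFamily m 𝕜) : MvPowerSeries (Fin m) (LaurentSeries 𝕜) :=
  fun n => HahnSeries.ofPowerSeries ℤ 𝕜
    (PowerSeries.mk fun j => MvPowerSeries.coeff (n.optionElim j) X)

/-- The sum of the residues of the dual form `X(x;λ)⁻¹ dx` over its polar locus near the origin,
for `X(x;0) ≠ 0`, as a series in `λ`.  It is the integral of the form over a small circle
`|x| = ε` (divided by `2πi`), which encloses this polar locus when `λ` is small, expanded in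
powers of `λ`: the form is expanded in powers of `λ` with coefficients Laurent series in `x`, and
then the coefficient of `x⁻¹` is taken. -/
def residueSum (X : FormalFamily m 𝕜) : ParamSeries m 𝕜 :=
  fun n => (MvPowerSeries.coeff n (toLaurent X)⁻¹ : LaurentSeries 𝕜).coeff (-1)

end Field

section RCLike

variable {𝕜 : Type*} [RCLike 𝕜] {m : ℕ}

/-- The series `∑ u_n` of formal power series converges to `s`, coefficient by coefficient. -/
def HasFormalSum {σ : Type*} (u : ℕ → MvPowerSeries σ 𝕜) (s : MvPowerSeries σ 𝕜) : Prop :=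
  ∀ d : σ →₀ ℕ, HasSum (fun n => MvPowerSeries.coeff d (u n)) (MvPowerSeries.coeff d s)

/-- `e = exp(t(λ)) = ∑ t^n / n!`. -/
def IsFormalExp (t e : ParamSeries m 𝕜) : Prop :=
  HasFormalSum (fun n => ((n.factorial : 𝕜)⁻¹) • t ^ n) e

/-- `F(x;λ) = exp(t(λ) X)(x;λ) = ∑ (t^n / n!) X^n.x`, the formal flow of `X` at the time `t(λ)`;
here `X` acts as the derivation `X(x;λ) ∂/∂x`. -/
def IsFormalFlow (X : FormalFamily m 𝕜) (t : ParamSeries m 𝕜) (F : FormalFamily m 𝕜) : Prop :=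
  HasFormalSum (fun n => ((n.factorial : 𝕜)⁻¹) •
    (ofParam t ^ n * (fun g => X * MvPowerSeries.pderiv 𝕜 none g)^[n] coordX)) F

/-- Analytic germs at the origin are the formal power series that converge (absolutely) on some
polydisc. -/
def IsConvergent {σ : Type*} (f : MvPowerSeries σ 𝕜) : Prop :=
  ∃ r : ℝ, 0 < r ∧ Summable fun d : σ →₀ ℕ => ‖MvPowerSeries.coeff d f‖ * r ^ d.degree

/-- Analytic conjugacy of two families: conjugacy by an analytic change of coordinate. -/
def AnalyticallyConjugate (X X' : FormalFamily m 𝕜) : Prop :=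
  ∃ φ : FormalFamily m 𝕜, IsConvergent φ ∧ Conjugates φ X X'

end RCLike

end

end KostovFormal

open KostovFormal

/-! Give `x` the weight 1 and every parameter a large weight `M`. If `X(x;0)` has order `p` and `M ≥
p + 1`, every monomial that contains a parameter is heavier than `x^p`, so the family is `a x^p`
plus terms of higher weight. An unfolding thus becomes a higher order perturbation of a monomial
vector field, and every unknown series is the fixed point of a map that improves agreement by one
weight (`exists_fixedPoint`). The ideals `Filt M n K` carry a second index `n` that ignores
parameter degree `≥ n`, so the same estimates also give congruences modulo powers of the ideal of
the parameters.

Normal form. A conjugacy `φ = x + v` to a normal form is the identity `num(φ) = X φ' den(φ)`. Its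
linear part `v ↦ x^(k+1) v' - (k+1) x^k v` sends `x^i` to `(i-k-1) x^(i+k)`. It misses exactly the
degrees `0, …, k-1` and `2k+1`, which the unknowns `y_j` and `μ` fill, and its kernel is spanned
over the parameters by `x^(k+1)`. The equation therefore has one solution for each admissible
coefficient of `x^(k+1)` in `v`. The flow of `X` preserves the solutions of the equation, and its
time can be adjusted to give this coefficient any admissible value (`exists_flow_time`). So two
conjugacies tangent to the identity differ by a flow `exp(t(λ)X)` and lead to the same `y`, `μ`
(`conj_unique`). Homotheties `x ↦ αx` reduce the general case to this one and produce the roots of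
unity and the sign `ε^(k+1)`. For universality, the solution with zero coefficient of `x^(k+1)` is
compared with the identity modulo the parameters (`IsSol.stable` with `n = 1`).

Residue. The form `dx/X` is the pull-back by `φ` of the dual form of the normal form. With `Z = 1/φ`
it is `dφ/φ` times a series in `y` and `Z`; the positive powers of `Z` give exact forms, the residue
of `dφ/φ` is 1, and the constant term left over is `μ` (`residueSum_of_conj`).

Analytic conjugacy. For convergent `X`, `X'` of order `p` at `λ = 0`, a conjugacy `αx + v` is a
fixed point of `conjStep`, a map that depends on the coefficient `b` of `x^p` in `v`. Its divisors
are the integers `d - p`: there are no small divisors, and division by them compensates the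
derivative `x ∂/∂x`. So for convergent `b` the map preserves a ball of a weighted `ℓ¹` norm, and its
fixed point, which is unique, converges. Given a formal conjugacy, the flow of `X` replaces `b` by a
polynomial truncation; the new formal conjugacy is still a fixed point, hence equals the convergent
one, and it agrees with the old one up to the order of truncation (`exists_convergent_conj`). -/

namespace KostovFormal

noncomputable section

open MvPowerSeries (coeff)

/-! ### Weights of monomials. -/

section Weights

variable {m : ℕ}

/-- The degree of a monomial in the parameters. -/
def pdeg (d : Option (Fin m) →₀ ℕ) : ℕ := d.some.degree

/-- The weight of a monomial: `x` has weight `1` and the parameters have weight `M`. -/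
def wt (M : ℕ) (d : Option (Fin m) →₀ ℕ) : ℕ := d none + M * pdeg d

@[simp] lemma pdeg_add (d e : Option (Fin m) →₀ ℕ) : pdeg (d + e) = pdeg d + pdeg e := by
  simp [pdeg]

@[simp] lemma pdeg_single_none (j : ℕ) :
    pdeg (Finsupp.single none j : Option (Fin m) →₀ ℕ) = 0 := by
  simp [pdeg]

@[simp] lemma pdeg_optionElim (j : ℕ) (a : Fin m →₀ ℕ) : pdeg (a.optionElim j) = a.degree := by
  simp [pdeg]

lemma wt_add (M : ℕ) (d e : Option (Fin m) →₀ ℕ) : wt M (d + e) = wt M d + wt M e := by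
  simp only [wt, pdeg_add, Finsupp.add_apply]; ring

@[simp] lemma wt_single_none (M j : ℕ) :
    wt M (Finsupp.single none j : Option (Fin m) →₀ ℕ) = j := by
  simp [wt]

@[simp] lemma wt_optionElim (M j : ℕ) (a : Fin m →₀ ℕ) :
    wt M (a.optionElim j) = j + M * a.degree := by
  simp [wt]

lemma degree_eq (d : Option (Fin m) →₀ ℕ) : d.degree = d none + pdeg d := by
  simp [pdeg, Finsupp.degree_eq_sum, Fintype.sum_option]

lemma pdeg_eq_zero {d : Option (Fin m) →₀ ℕ} (h : pdeg d = 0) :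
    d = Finsupp.single none (d none) := by
  have h1 : d.some = 0 := by simpa [pdeg, Finsupp.degree_eq_zero_iff] using h
  conv_lhs => rw [← Finsupp.optionElim_some d, h1, Finsupp.optionElim_zero]

end Weights

/-! ### The weight filtration, truncated in the parameter degree. -/

section Filtration

variable {𝕜 : Type*} [Field 𝕜] {m : ℕ}

/-- The series whose coefficients of weight `< K` and of parameter degree `< n` vanish. -/
def Filt (M : ℕ) (n : ℕ∞) (K : ℕ) : Ideal (FormalFamily m 𝕜) where
  carrier := {f | ∀ d, wt M d < K → (pdeg d : ℕ∞) < n → coeff d f = 0}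
  add_mem' := fun hf hg d h1 h2 => by rw [map_add, hf d h1 h2, hg d h1 h2, add_zero]
  zero_mem' := fun d _ _ => by simp
  smul_mem' := fun c f hf d h1 h2 => by
    classical
    rw [smul_eq_mul, MvPowerSeries.coeff_mul]
    refine Finset.sum_eq_zero fun p hp => ?_
    obtain rfl := Finset.HasAntidiagonal.mem_antidiagonal.mp hp
    rw [hf p.2 (by rw [wt_add] at h1; omega) (lt_of_le_of_lt (by simp) h2), mul_zero]

variable {M : ℕ} {n : ℕ∞} {K : ℕ}

lemma mem_filt {f : FormalFamily m 𝕜} :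
    f ∈ Filt M n K ↔ ∀ d, wt M d < K → (pdeg d : ℕ∞) < n → coeff d f = 0 := Iff.rfl

lemma mem_filt_top {f : FormalFamily m 𝕜} :
    f ∈ Filt M ⊤ K ↔ ∀ d, wt M d < K → coeff d f = 0 := by
  simp [mem_filt]

lemma filt_mono {n n' : ℕ∞} {K K' : ℕ} (hn : n' ≤ n) (hK : K' ≤ K) :
    (Filt M n K : Ideal (FormalFamily m 𝕜)) ≤ Filt M n' K' :=
  fun _ hf d h1 h2 => hf d (h1.trans_le hK) (h2.trans_le hn)

lemma filt_of_top {f : FormalFamily m 𝕜} (hf : f ∈ Filt M ⊤ K) : f ∈ Filt M n K :=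
  filt_mono le_top le_rfl hf

lemma filt_le {f : FormalFamily m 𝕜} {K K' : ℕ} (hf : f ∈ Filt M n K) (h : K' ≤ K) :
    f ∈ Filt M n K' := filt_mono le_rfl h hf

@[simp] lemma mem_filt_zero (f : FormalFamily m 𝕜) : f ∈ Filt M n 0 := fun d h => by simp at h

lemma filt_mul {f g : FormalFamily m 𝕜} {a b : ℕ} (hf : f ∈ Filt M n a) (hg : g ∈ Filt M n b) :
    f * g ∈ Filt M n (a + b) := by
  classical
  intro d h1 h2
  rw [MvPowerSeries.coeff_mul]
  refine Finset.sum_eq_zero fun p hp => ?_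
  obtain rfl := Finset.HasAntidiagonal.mem_antidiagonal.mp hp
  rw [wt_add] at h1
  rcases lt_or_ge (wt M p.1) a with h | h
  · rw [hf p.1 h (lt_of_le_of_lt (by simp) h2), zero_mul]
  · rw [hg p.2 (by omega) (lt_of_le_of_lt (by simp) h2), mul_zero]

lemma filt_pow {f : FormalFamily m 𝕜} {a : ℕ} (hf : f ∈ Filt M n a) (j : ℕ) :
    f ^ j ∈ Filt M n (j * a) := by
  induction j with
  | zero => simp
  | succ j ih => rw [pow_succ, Nat.add_mul, one_mul]; exact filt_mul ih hf

lemma filt_smul {f : FormalFamily m 𝕜} (c : 𝕜) (hf : f ∈ Filt M n K) : c • f ∈ Filt M n K := by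
  intro d h1 h2; rw [MvPowerSeries.coeff_smul, hf d h1 h2, mul_zero]

lemma eq_of_sub_mem_filt {f g : FormalFamily m 𝕜} (h : ∀ K, f - g ∈ Filt M ⊤ K) : f = g := by
  ext d
  have := mem_filt_top.mp (h (wt M d + 1)) d (by omega)
  simpa [sub_eq_zero] using this

lemma pderiv_mem_filt {f : FormalFamily m 𝕜} (hf : f ∈ Filt M n (K + 1)) :
    MvPowerSeries.pderiv 𝕜 none f ∈ Filt M n K := by
  intro d h1 h2
  rw [MvPowerSeries.coeff_pderiv, hf _ (by rw [wt_add, wt_single_none]; omega) (by simpa), zero_mul]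

lemma coordX_pow (j : ℕ) :
    (coordX : FormalFamily m 𝕜) ^ j = MvPowerSeries.monomial (Finsupp.single none j) 1 := by
  rw [coordX, MvPowerSeries.X_pow_eq]

lemma coeff_ofParam (b : ParamSeries m 𝕜) (d : Option (Fin m) →₀ ℕ) :
    coeff d (ofParam b) = if d none = 0 then coeff d.some b else 0 := by
  split_ifs with h
  · have : d = Finsupp.embDomain Function.Embedding.some d.some := by
      ext (_ | i)
      · rw [h, Finsupp.embDomain_of_notMem_range]; simp
      · exact (Finsupp.embDomain_apply_self Function.Embedding.some d.some i).symm
    conv_lhs => rw [this]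
    exact MvPowerSeries.coeff_embDomain_rename _ _ _
  · refine MvPowerSeries.coeff_rename_eq_zero _ _ ?_
    rintro ⟨e, rfl⟩
    apply h
    rw [← Finsupp.embDomain_eq_mapDomain, Finsupp.embDomain_of_notMem_range]; simp

lemma coeff_mul_coordX_pow (f : FormalFamily m 𝕜) (j : ℕ) (d : Option (Fin m) →₀ ℕ) :
    coeff d (f * coordX ^ j) =
      if j ≤ d none then coeff (d - Finsupp.single none j) f else 0 := by
  classical
  rw [coordX_pow, mul_comm, MvPowerSeries.coeff_monomial_mul]
  simp [Finsupp.single_le_iff]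

lemma coeff_add_mul_coordX_pow (f : FormalFamily m 𝕜) (j : ℕ) (d : Option (Fin m) →₀ ℕ) :
    coeff (d + Finsupp.single none j) (f * coordX ^ j) = coeff d f := by
  rw [coeff_mul_coordX_pow, if_pos (by simp), add_tsub_cancel_right]

lemma coeff_ofParam_mul_pow (b : ParamSeries m 𝕜) (j : ℕ) (d : Option (Fin m) →₀ ℕ) :
    coeff d (ofParam b * coordX ^ j) = if d none = j then coeff d.some b else 0 := by
  rw [coeff_mul_coordX_pow, coeff_ofParam]
  have h1 : (d - Finsupp.single none j : Option (Fin m) →₀ ℕ) none = d none - j := by simp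
  have h2 : (d - Finsupp.single none j : Option (Fin m) →₀ ℕ).some = d.some := by ext i; simp
  rw [h1, h2]
  split_ifs <;> first | rfl | omega

lemma ofParam_injective : Function.Injective (ofParam : ParamSeries m 𝕜 → FormalFamily m 𝕜) :=
  MvPowerSeries.rename_injective _

/-- The coefficient of `x ^ j`, a series in the parameters. -/
def coeffX (j : ℕ) : FormalFamily m 𝕜 →ₗ[𝕜] ParamSeries m 𝕜 where
  toFun f := fun a => coeff (a.optionElim j) f
  map_add' _ _ := rfl
  map_smul' _ _ := rfl

lemma coeff_coeffX (j : ℕ) (f : FormalFamily m 𝕜) (a : Fin m →₀ ℕ) :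
    coeff a (coeffX j f) = coeff (a.optionElim j) f := rfl

@[simp] lemma coeffX_ofParam_mul_pow (b : ParamSeries m 𝕜) (i j : ℕ) :
    coeffX i (ofParam b * coordX ^ j) = if i = j then b else 0 := by
  ext a
  rw [coeff_coeffX, coeff_ofParam_mul_pow, Finsupp.optionElim_apply_none, Finsupp.some_optionElim]
  split_ifs <;> simp

lemma ofParam_mem_filt {b : ParamSeries m 𝕜} :
    ofParam b ∈ (Filt M n K : Ideal (FormalFamily m 𝕜)) ↔
      ∀ a : Fin m →₀ ℕ, M * a.degree < K → (a.degree : ℕ∞) < n → coeff a b = 0 := by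
  constructor
  · intro h a h1 h2
    have := h (a.optionElim 0) (by simpa) (by simpa)
    simpa [coeff_ofParam] using this
  · intro h d h1 h2
    rw [coeff_ofParam]
    split_ifs with h0
    · exact h _ (by rw [wt] at h1; rw [pdeg] at h1; omega) h2
    · rfl

lemma ofParam_mul_pow_mem_filt {b : ParamSeries m 𝕜} {j : ℕ} :
    ofParam b * coordX ^ j ∈ (Filt M n K : Ideal (FormalFamily m 𝕜)) ↔
      ∀ a : Fin m →₀ ℕ, j + M * a.degree < K → (a.degree : ℕ∞) < n → coeff a b = 0 := by
  constructor
  · intro h a h1 h2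
    have := h (a.optionElim j) (by simpa) (by simpa)
    simpa [coeff_ofParam_mul_pow] using this
  · intro h d h1 h2
    rw [coeff_ofParam_mul_pow]
    split_ifs with h0
    · exact h _ (by rw [wt] at h1; rw [pdeg] at h1; omega) h2
    · rfl

lemma coordX_mem_filt : (coordX : FormalFamily m 𝕜) ∈ Filt M n 1 := by
  have := (ofParam_mul_pow_mem_filt (𝕜 := 𝕜) (m := m) (M := M) (n := n) (K := 1) (b := 1)
    (j := 1)).2 (fun a h => by omega)
  simpa using this

lemma coordX_pow_mem_filt (j : ℕ) : (coordX : FormalFamily m 𝕜) ^ j ∈ Filt M n j := by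
  simpa using filt_pow (coordX_mem_filt (𝕜 := 𝕜) (m := m) (M := M) (n := n)) j

lemma coeffX_mul_pow_mem_filt {f : FormalFamily m 𝕜} (hf : f ∈ Filt M n K) (j : ℕ) :
    ofParam (coeffX j f) * coordX ^ j ∈ (Filt M n K : Ideal (FormalFamily m 𝕜)) :=
  ofParam_mul_pow_mem_filt.2 fun a h1 h2 => by
    rw [coeff_coeffX]; exact hf _ (by simpa) (by simpa)

lemma mem_filt_of_mul_pow {f : FormalFamily m 𝕜} {j : ℕ}
    (hf : f * coordX ^ j ∈ Filt M n (K + j)) : f ∈ Filt M n K := by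
  intro d h1 h2
  rw [← coeff_add_mul_coordX_pow f j d]
  exact hf _ (by rw [wt_add, wt_single_none]; omega) (by simpa)

@[simp] lemma pderiv_coordX : MvPowerSeries.pderiv 𝕜 none (coordX : FormalFamily m 𝕜) = 1 :=
  MvPowerSeries.pderiv_X_self

@[simp] lemma pderiv_ofParam (b : ParamSeries m 𝕜) :
    MvPowerSeries.pderiv 𝕜 none (ofParam b : FormalFamily m 𝕜) = 0 := by
  ext d
  rw [MvPowerSeries.coeff_pderiv, coeff_ofParam, if_neg (by simp)]; simp

/-- `a` and `a'` have order `p`, and agree modulo `Filt M n (p + K)`. -/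
structure Near (M : ℕ) (n : ℕ∞) (p K : ℕ) (a a' : FormalFamily m 𝕜) : Prop where
  left : a ∈ Filt M ⊤ p
  right : a' ∈ Filt M ⊤ p
  sub : a - a' ∈ Filt M n (p + K)

namespace Near

variable {p q : ℕ} {a a' b b' : FormalFamily m 𝕜}

lemma refl (K : ℕ) (h : a ∈ Filt M ⊤ p) : Near M n p K a a := ⟨h, h, by simp⟩

lemma add (h : Near M n p K a a') (h' : Near M n p K b b') :
    Near M n p K (a + b) (a' + b') :=
  ⟨add_mem h.1 h'.1, add_mem h.2 h'.2, by
    rw [add_sub_add_comm]; exact add_mem h.3 h'.3⟩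

lemma neg (h : Near M n p K a a') : Near M n p K (-a) (-a') :=
  ⟨neg_mem h.1, neg_mem h.2, by
    rw [← neg_sub', neg_mem_iff]; exact h.3⟩

lemma sub' (h : Near M n p K a a') (h' : Near M n p K b b') :
    Near M n p K (a - b) (a' - b') := by
  simpa [sub_eq_add_neg] using h.add h'.neg

/-- `K` is a relative precision: the error of one factor is multiplied by the order of the other, so
products keep the same `K`. -/
lemma mul (h : Near M n p K a a') (h' : Near M n q K b b') :
    Near M n (p + q) K (a * b) (a' * b') :=
  ⟨filt_mul h.1 h'.1, filt_mul h.2 h'.2, by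
    have e : a * b - a' * b' = a * (b - b') + (a - a') * b' := by ring
    rw [e]
    refine add_mem ?_ ?_
    · rw [add_assoc]; exact filt_mul (filt_of_top h.1) h'.3
    · have := filt_mul h.3 (filt_of_top (n := n) h'.2)
      rwa [show p + q + K = p + K + q by omega]⟩

lemma one : Near M n 0 K (1 : FormalFamily m 𝕜) 1 := refl K (by simp)

lemma pow (h : Near M n p K a a') (j : ℕ) : Near M n (j * p) K (a ^ j) (a' ^ j) := by
  induction j with
  | zero => simpa using one
  | succ j ih => rw [pow_succ, pow_succ, Nat.add_mul, one_mul]; exact ih.mul h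

lemma sum {ι : Type*} {s : Finset ι} {f g : ι → FormalFamily m 𝕜}
    (h : ∀ i ∈ s, Near M n p K (f i) (g i)) : Near M n p K (∑ i ∈ s, f i) (∑ i ∈ s, g i) :=
  ⟨sum_mem fun i hi => (h i hi).1, sum_mem fun i hi => (h i hi).2, by
    rw [← Finset.sum_sub_distrib]; exact sum_mem fun i hi => (h i hi).3⟩

lemma mono {p' K' : ℕ} (h : Near M n p K a a') (hp : p' ≤ p) (hK : p' + K' ≤ p + K) :
    Near M n p' K' a a' :=
  ⟨filt_le h.1 hp, filt_le h.2 hp, filt_le h.3 hK⟩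

lemma pderiv (h : Near M n (p + 1) K a a') :
    Near M n p K (MvPowerSeries.pderiv 𝕜 none a) (MvPowerSeries.pderiv 𝕜 none a') :=
  ⟨pderiv_mem_filt h.1, pderiv_mem_filt h.2, by
    rw [← map_sub]; apply pderiv_mem_filt
    have := h.3; rwa [show p + K + 1 = p + 1 + K by omega]⟩

end Near

end Filtration

/-! ### Fixed points of maps that improve agreement by one weight. -/

section FixedPoint

/-- A map which is contracting for the agreement of coefficients up to a given weight has a fixed
point, in every nonempty stable set of sequences which is closed for this agreement. -/
lemma exists_fixedPoint {ι A : Type*} (w : ι → ℕ) (S : Set (ι → A))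
    (T : (ι → A) → ι → A) (hS : Set.MapsTo T S S) (hne : S.Nonempty)
    (hcl : ∀ f, (∀ K, ∃ g ∈ S, ∀ i, w i < K → f i = g i) → f ∈ S)
    (hT : ∀ f ∈ S, ∀ g ∈ S, ∀ K, (∀ i, w i < K → f i = g i) →
      ∀ i, w i < K + 1 → T f i = T g i) :
    ∃ f ∈ S, T f = f := by
  obtain ⟨f0, hf0⟩ := hne
  set u : ℕ → ι → A := fun n => T^[n] f0 with hu
  have hus : ∀ n, u (n + 1) = T (u n) := fun n => Function.iterate_succ_apply' T n f0
  have huS : ∀ n, u n ∈ S := fun n => by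
    induction n with
    | zero => exact hf0
    | succ n ih => rw [hus]; exact hS ih
  have h1 : ∀ n i, w i < n → u (n + 1) i = u n i := by
    intro n
    induction n with
    | zero => intro i hi; omega
    | succ n ih =>
      rw [hus (n + 1), hus n]
      exact hT _ (hus n ▸ huS (n + 1)) _ (huS n) n (hus n ▸ ih)
  have h2 : ∀ n k i, w i < n → u (n + k) i = u n i := by
    intro n k
    induction k with
    | zero => intros; rfl
    | succ k ih => intro i hi; rw [← add_assoc, h1 (n + k) i (by omega), ih i hi]
  -- The diagonal limit: the entries of weight `< n` no longer change after the `n`-th iterate.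
  set f : ι → A := fun i => u (w i + 1) i
  have h3 : ∀ n i, w i < n → f i = u n i := fun n i hi => by
    have := h2 (w i + 1) (n - (w i + 1)) i (by omega)
    rw [show w i + 1 + (n - (w i + 1)) = n by omega] at this
    exact this.symm
  have hfS : f ∈ S := hcl f fun K => ⟨u K, huS K, h3 K⟩
  refine ⟨f, hfS, ?_⟩
  funext i
  rw [hT f hfS (u (w i)) (huS _) (w i) (h3 _) i (by omega), ← hus, h3 (w i + 1) i (by omega)]

/-- The fixed point theorem for power series. -/
lemma exists_fixedPoint_series {σ A : Type*} [Semiring A] (w : (σ →₀ ℕ) → ℕ)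
    (S : Set (MvPowerSeries σ A)) (T : MvPowerSeries σ A → MvPowerSeries σ A)
    (hS : Set.MapsTo T S S) (hne : S.Nonempty)
    (hcl : ∀ f, (∀ K, ∃ g ∈ S, ∀ d, w d < K → coeff d f = coeff d g) → f ∈ S)
    (hT : ∀ f ∈ S, ∀ g ∈ S, ∀ K, (∀ d, w d < K → coeff d f = coeff d g) →
      ∀ d, w d < K + 1 → coeff d (T f) = coeff d (T g)) :
    ∃ f ∈ S, T f = f :=
  exists_fixedPoint (A := A) w S T hS hne hcl hT

end FixedPoint

/-! ### Substitution of a coordinate, and conjugacy to a normal form as a polynomial identity. -/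

section Composition

variable {𝕜 : Type*} [Field 𝕜] {m : ℕ}

lemma hasSubst_coord {φ : FormalFamily m 𝕜} (hφ : MvPowerSeries.constantCoeff φ = 0) :
    MvPowerSeries.HasSubst
      (fun o : Option (Fin m) => o.elim φ (fun i => MvPowerSeries.X (some i))) := by
  apply MvPowerSeries.hasSubst_of_constantCoeff_zero
  rintro (_ | i)
  · exact hφ
  · simp

/-- Composition with a coordinate, as a homomorphism of algebras. -/
def compHom (φ : FormalFamily m 𝕜) (hφ : MvPowerSeries.constantCoeff φ = 0) :
    FormalFamily m 𝕜 →ₐ[𝕜] FormalFamily m 𝕜 :=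
  MvPowerSeries.substAlgHom (hasSubst_coord hφ)

lemma compHom_apply (φ : FormalFamily m 𝕜) (hφ : MvPowerSeries.constantCoeff φ = 0)
    (f : FormalFamily m 𝕜) : compHom φ hφ f = compCoord f φ :=
  MvPowerSeries.substAlgHom_apply _ _

lemma ofParam_eq_subst (b : ParamSeries m 𝕜) :
    (ofParam b : FormalFamily m 𝕜) =
      MvPowerSeries.subst (MvPowerSeries.X ∘ some : Fin m → FormalFamily m 𝕜) b := by
  rw [ofParam, MvPowerSeries.rename_eq_subst]; rfl

@[simp] lemma compHom_coordX (φ : FormalFamily m 𝕜) (hφ : MvPowerSeries.constantCoeff φ = 0) :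
    compHom φ hφ coordX = φ :=
  MvPowerSeries.substAlgHom_X (hasSubst_coord hφ) none

lemma hasSubst_some : MvPowerSeries.HasSubst
    (MvPowerSeries.X ∘ some : Fin m → FormalFamily m 𝕜) :=
  MvPowerSeries.hasSubst_of_constantCoeff_zero fun i => by simp

@[simp] lemma compHom_ofParam (φ : FormalFamily m 𝕜) (hφ : MvPowerSeries.constantCoeff φ = 0)
    (b : ParamSeries m 𝕜) : compHom φ hφ (ofParam b) = ofParam b := by
  rw [compHom_apply, ofParam_eq_subst, compCoord,
    MvPowerSeries.subst_comp_subst_apply hasSubst_some (hasSubst_coord hφ)]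
  congr 1
  funext i
  exact MvPowerSeries.subst_X (hasSubst_coord hφ) (some i)

/-- The numerator of the normal form, at `φ`. -/
def numAt (k : ℕ) (y : Fin k → ParamSeries m 𝕜) (φ : FormalFamily m 𝕜) : FormalFamily m 𝕜 :=
  φ ^ (k + 1) + ∑ j : Fin k, ofParam (y j) * φ ^ (j : ℕ)

/-- The denominator of the normal form, at `φ`. -/
def denAt (k : ℕ) (s : 𝕜) (μ : ParamSeries m 𝕜) (φ : FormalFamily m 𝕜) : FormalFamily m 𝕜 :=
  MvPowerSeries.C s + ofParam μ * φ ^ k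

lemma eval₂_numerator (k : ℕ) (y : Fin k → ParamSeries m 𝕜) (φ : FormalFamily m 𝕜) :
    (numerator k y).eval₂ (ofParam : ParamSeries m 𝕜 →ₐ[𝕜] FormalFamily m 𝕜).toRingHom φ =
      numAt k y φ := by
  simp [numerator, numAt, Polynomial.eval₂_finsetSum]

lemma eval₂_denominator (k : ℕ) (s : 𝕜) (μ : ParamSeries m 𝕜) (φ : FormalFamily m 𝕜) :
    (denominator k s μ).eval₂ (ofParam : ParamSeries m 𝕜 →ₐ[𝕜] FormalFamily m 𝕜).toRingHom φ =
      denAt k s μ φ := by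
  simp [denominator, denAt, ofParam]

lemma map_numAt (F : FormalFamily m 𝕜 →+* FormalFamily m 𝕜) (hF : ∀ b, F (ofParam b) = ofParam b)
    (k : ℕ) (y : Fin k → ParamSeries m 𝕜) (φ : FormalFamily m 𝕜) :
    F (numAt k y φ) = numAt k y (F φ) := by
  simp [numAt, hF]

lemma ofParam_C (s : 𝕜) :
    (ofParam (MvPowerSeries.C s) : FormalFamily m 𝕜) = MvPowerSeries.C s :=
  MvPowerSeries.rename_C _ _

lemma map_denAt (F : FormalFamily m 𝕜 →+* FormalFamily m 𝕜) (hF : ∀ b, F (ofParam b) = ofParam b)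
    (k : ℕ) (s : 𝕜) (μ : ParamSeries m 𝕜) (φ : FormalFamily m 𝕜) :
    F (denAt k s μ φ) = denAt k s μ (F φ) := by
  simp [denAt, hF, ← ofParam_C]

lemma constantCoeff_ofParam (b : ParamSeries m 𝕜) :
    MvPowerSeries.constantCoeff (ofParam b : FormalFamily m 𝕜) =
      MvPowerSeries.constantCoeff b :=
  MvPowerSeries.constantCoeff_rename (f := (Function.Embedding.some : Fin m ↪ Option (Fin m))) b

/-- For `k = 0` the denominator is `s + μ`, with value `s` at the origin only when `μ(0) = 0`. This
is the reason for the hypothesis on `k = 0`, which lets the linear case share the argument for `k ≥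
1`. -/
lemma constantCoeff_denAt {k : ℕ} (s : 𝕜) {μ : ParamSeries m 𝕜} {φ : FormalFamily m 𝕜}
    (hφ : MvPowerSeries.constantCoeff φ = 0)
    (hμ : k = 0 → MvPowerSeries.constantCoeff μ = 0) :
    MvPowerSeries.constantCoeff (denAt k s μ φ) = s := by
  rcases Nat.eq_zero_or_pos k with h | h
  · simp [denAt, h, constantCoeff_ofParam, hμ h]
  · simp [denAt, hφ, h.ne']

lemma normalForm_eq (k : ℕ) (s : 𝕜) (y : Fin k → ParamSeries m 𝕜) (μ : ParamSeries m 𝕜) :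
    normalForm k s y μ = numAt k y coordX * (denAt k s μ coordX)⁻¹ := by
  rw [normalForm, polyToSeries, polyToSeries, eval₂_numerator, eval₂_denominator]

@[simp] lemma constantCoeff_coordX :
    MvPowerSeries.constantCoeff (coordX : FormalFamily m 𝕜) = 0 :=
  MvPowerSeries.constantCoeff_X _

lemma normalForm_mul_denAt {k : ℕ} {s : 𝕜} (hs : s ≠ 0) (y : Fin k → ParamSeries m 𝕜)
    {μ : ParamSeries m 𝕜} (hμ : k = 0 → MvPowerSeries.constantCoeff μ = 0) :
    normalForm k s y μ * denAt k s μ coordX = numAt k y coordX := by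
  rw [normalForm_eq, mul_assoc, MvPowerSeries.inv_mul_cancel _, mul_one]
  rwa [constantCoeff_denAt s constantCoeff_coordX hμ]

lemma compCoord_normalForm_mul {k : ℕ} {s : 𝕜} (hs : s ≠ 0) (y : Fin k → ParamSeries m 𝕜)
    {μ : ParamSeries m 𝕜} (hμ : k = 0 → MvPowerSeries.constantCoeff μ = 0)
    {φ : FormalFamily m 𝕜} (hφ : MvPowerSeries.constantCoeff φ = 0) :
    compCoord (normalForm k s y μ) φ * denAt k s μ φ = numAt k y φ := by
  have := congrArg (compHom φ hφ) (normalForm_mul_denAt hs y hμ)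
  have h1 := map_numAt (compHom φ hφ).toRingHom (compHom_ofParam φ hφ) k y coordX
  have h2 := map_denAt (compHom φ hφ).toRingHom (compHom_ofParam φ hφ) k s μ coordX
  simp only [AlgHom.toRingHom_eq_coe, RingHom.coe_coe, compHom_coordX] at h1 h2
  rwa [map_mul, h1, h2, compHom_apply] at this

/-- Conjugacy to a normal form as a polynomial identity. -/
lemma conjugates_normalForm_iff {k : ℕ} {s : 𝕜} (hs : s ≠ 0) {y : Fin k → ParamSeries m 𝕜}
    {μ : ParamSeries m 𝕜} (hμ : k = 0 → MvPowerSeries.constantCoeff μ = 0)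
    {φ X : FormalFamily m 𝕜} :
    Conjugates φ X (normalForm k s y μ) ↔ IsCoordChange φ ∧
      numAt k y φ = X * MvPowerSeries.pderiv 𝕜 none φ * denAt k s μ φ := by
  refine and_congr_right fun hφ => ?_
  rw [← compCoord_normalForm_mul hs y hμ hφ.1]
  have h0 : denAt k s μ φ ≠ 0 := fun h => hs (by
    rw [← constantCoeff_denAt (k := k) s hφ.1 hμ, h, map_zero])
  exact (mul_left_inj' h0).symm

end Composition

/-! ### The linearized equation and its inverse. -/

section Linear

variable {𝕜 : Type*} [Field 𝕜] {m : ℕ}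

/-- The linearization at the identity of the equation of conjugacy to the normal form. -/
def linOp (k : ℕ) (v : FormalFamily m 𝕜) (y : Fin k → ParamSeries m 𝕜) (μ : ParamSeries m 𝕜) :
    FormalFamily m 𝕜 :=
  MvPowerSeries.pderiv 𝕜 none v * coordX ^ (k + 1) - ((k : 𝕜) + 1) • (v * coordX ^ k)
    + ofParam μ * coordX ^ (2 * k + 1) - ∑ j : Fin k, ofParam (y j) * coordX ^ (j : ℕ)

/-- The part in `v` sends `x^i` to `(i - k - 1) x^(i+k)`. Degrees below `k` are left to the `y_j`,
and degree `2k+1`, where the factor vanishes, to `μ`. -/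
lemma coeff_linOp (k : ℕ) (v : FormalFamily m 𝕜) (y : Fin k → ParamSeries m 𝕜)
    (μ : ParamSeries m 𝕜) (d : Option (Fin m) →₀ ℕ) :
    coeff d (linOp k v y μ) =
      (if k ≤ d none then ((d none : 𝕜) - k - (k + 1)) * coeff (d - Finsupp.single none k) v else 0)
      + (if d none = 2 * k + 1 then coeff d.some μ else 0)
      - (if h : d none < k then coeff d.some (y ⟨d none, h⟩) else 0) := by
  classical
  rw [linOp, map_sub, map_add, map_sub, MvPowerSeries.coeff_smul, coeff_mul_coordX_pow,
    coeff_mul_coordX_pow, coeff_ofParam_mul_pow, map_sum]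
  congr 1
  · congr 1
    rcases lt_trichotomy (d none) k with h | h | h
    · rw [if_neg (by omega), if_neg (by omega), if_neg (by omega)]; simp
    · rw [if_neg (by omega), if_pos (by omega), if_pos (by omega), h]; ring
    · rw [if_pos (by omega), if_pos h.le, if_pos h.le, MvPowerSeries.coeff_pderiv]
      have h2 : d - Finsupp.single none (k + 1) + Finsupp.single none 1 =
          d - Finsupp.single none k := by
        ext (_ | i)
        · simp; omega
        · simp
      rw [h2]
      have h3 : (((d - Finsupp.single none (k + 1) : Option (Fin m) →₀ ℕ) none : ℕ) : 𝕜) =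
          d none - k - 1 := by
        have : (d - Finsupp.single none (k + 1) : Option (Fin m) →₀ ℕ) none = d none - (k + 1) := by
          simp
        rw [this, Nat.cast_sub (by omega)]; push_cast; ring
      rw [h3]; ring
  · simp_rw [coeff_ofParam_mul_pow]
    split_ifs with h
    · rw [Finset.sum_eq_single ⟨d none, h⟩]
      · simp
      · intro j _ hj
        rw [if_neg]
        intro h'; exact hj (Fin.ext h'.symm)
      · simp
    · refine Finset.sum_eq_zero fun j _ => if_neg ?_
      have := j.2; omega

/-- The solution of the linearized equation without coefficient of `x ^ (k + 1)`. -/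
def linInv (k : ℕ) (g : FormalFamily m 𝕜) : FormalFamily m 𝕜 := fun d =>
  if d none = k + 1 then 0 else coeff (d + Finsupp.single none k) g / ((d none : 𝕜) - (k + 1))

lemma coeff_linInv (k : ℕ) (g : FormalFamily m 𝕜) (d : Option (Fin m) →₀ ℕ) :
    coeff d (linInv k g) = if d none = k + 1 then 0 else
      coeff (d + Finsupp.single none k) g / ((d none : 𝕜) - (k + 1)) := rfl

lemma linInv_sub (k : ℕ) (g g' : FormalFamily m 𝕜) :
    linInv k (g - g') = linInv k g - linInv k g' := by
  ext d
  simp only [map_sub, coeff_linInv]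
  split_ifs <;> ring

lemma linInv_mem_filt {M : ℕ} {n : ℕ∞} {K k : ℕ} {g : FormalFamily m 𝕜}
    (hg : g ∈ Filt M n (K + k)) : linInv k g ∈ Filt M n K := by
  intro d h1 h2
  rw [coeff_linInv, hg _ (by rw [wt_add, wt_single_none]; omega) (by simpa)]
  simp

/-- The coordinate correction attached to a right-hand side `g`. -/
def vOf (k : ℕ) (b : ParamSeries m 𝕜) (g : FormalFamily m 𝕜) : FormalFamily m 𝕜 :=
  linInv k g + ofParam b * coordX ^ (k + 1)

/-- The coefficients `y_j` attached to a right-hand side `g`. -/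
def yOf (k : ℕ) (g : FormalFamily m 𝕜) : Fin k → ParamSeries m 𝕜 := fun j => -coeffX j g

/-- The coefficient `μ` attached to a right-hand side `g`. -/
def muOf (k : ℕ) (g : FormalFamily m 𝕜) : ParamSeries m 𝕜 := coeffX (2 * k + 1) g

lemma cast_sub_ne_zero [CharZero 𝕜] {a b : ℕ} (h : a ≠ b + 1) : (a : 𝕜) - (b + 1) ≠ 0 := by
  rw [sub_ne_zero]; exact_mod_cast h

/-- Together with `eq_of_linOp`, this says that the solutions of the linearized equation form a
single family, indexed by the free coefficient `b` of `x^(k+1)`. -/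
lemma linOp_of [CharZero 𝕜] (k : ℕ) (b : ParamSeries m 𝕜) (g : FormalFamily m 𝕜) :
    linOp k (vOf k b g) (yOf k g) (muOf k g) = g := by
  ext d
  have hd : d.some.optionElim (d none) = d := Finsupp.optionElim_some d
  rw [coeff_linOp, vOf, map_add, coeff_linInv, coeff_ofParam_mul_pow]
  have h1 : (d - Finsupp.single none k : Option (Fin m) →₀ ℕ) none = d none - k := by simp
  rw [h1]
  rcases lt_or_ge (d none) k with h | h
  · rw [if_neg (by omega), if_neg (by omega), dif_pos h, yOf, map_neg, coeff_coeffX]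
    simp only [hd]; ring
  · rw [if_pos h, dif_neg (by omega)]
    by_cases h2 : d none = 2 * k + 1
    · rw [if_pos (by omega), if_pos h2, h2, muOf, coeff_coeffX, ← h2, hd]
      push_cast [h2]; ring
    · rw [if_neg (by omega), if_neg (by omega), if_neg h2]
      have h3 : d - Finsupp.single none k + Finsupp.single none k = d :=
        tsub_add_cancel_of_le (by simpa [Finsupp.single_le_iff])
      rw [h3, Nat.cast_sub h]
      have h4 : (d none : 𝕜) - k - (k + 1) ≠ 0 := by
        rw [← Nat.cast_sub h]; exact cast_sub_ne_zero (by omega)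
      field_simp; ring

lemma eq_of_linOp [CharZero 𝕜] {k : ℕ} {v g : FormalFamily m 𝕜} {y : Fin k → ParamSeries m 𝕜}
    {μ : ParamSeries m 𝕜} (h : linOp k v y μ = g) :
    v = vOf k (coeffX (k + 1) v) g ∧ y = yOf k g ∧ μ = muOf k g := by
  subst h
  refine ⟨?_, ?_, ?_⟩
  · ext d
    rw [vOf, map_add, coeff_linInv, coeff_ofParam_mul_pow, coeff_linOp]
    by_cases h : d none = k + 1
    · rw [if_pos h, if_pos h, zero_add, coeff_coeffX, ← h, Finsupp.optionElim_some]
    · have h1 : (d + Finsupp.single none k : Option (Fin m) →₀ ℕ) none = d none + k := by simp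
      have h2 : d + Finsupp.single none k - Finsupp.single none k = d :=
        add_tsub_cancel_right _ _
      rw [if_neg h, if_neg h, h1, if_pos (by omega), if_neg (by omega), dif_neg (by omega), h2]
      have := cast_sub_ne_zero (𝕜 := 𝕜) h
      push_cast; field_simp; ring
  · funext j
    ext a
    rw [yOf, map_neg, coeff_coeffX, coeff_linOp, Finsupp.optionElim_apply_none,
      if_neg (by omega), if_neg (by omega), dif_pos j.2, Finsupp.some_optionElim]
    simp
  · ext a
    rw [muOf, coeff_coeffX, coeff_linOp, Finsupp.optionElim_apply_none, if_pos (by omega),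
      if_pos rfl, dif_neg (by omega), Finsupp.some_optionElim]
    push_cast; ring

end Linear

/-! ### The nonlinear equation: existence, uniqueness and stability of its solutions. -/

section Nonlinear

variable {𝕜 : Type*} [Field 𝕜] {m : ℕ}

/-- The nonlinear remainder of the equation of conjugacy of `x ^ (k + 1) + Z` to the normal form. -/
def nonlin (k : ℕ) (Z v : FormalFamily m 𝕜) (y : Fin k → ParamSeries m 𝕜) (μ : ParamSeries m 𝕜) :
    FormalFamily m 𝕜 :=
  linOp k v y μ + numAt k y (coordX + v) -
    (coordX ^ (k + 1) + Z) * (1 + MvPowerSeries.pderiv 𝕜 none v) * denAt k 1 μ (coordX + v)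

/-- The linear terms cancel. What remains is of second order in the small quantities `v`, `y_j x^j`
and `μ x^(2k+1)`, or contains `Z`, which is what gains a weight. -/
lemma nonlin_eq (k : ℕ) (Z v : FormalFamily m 𝕜) (y : Fin k → ParamSeries m 𝕜)
    (μ : ParamSeries m 𝕜) :
    nonlin k Z v y μ =
      ((coordX + v) ^ (k + 1) - coordX ^ (k + 1) - ((k : FormalFamily m 𝕜) + 1) * coordX ^ k * v)
      + ∑ j : Fin k, ofParam (y j) * ((coordX + v) ^ (j : ℕ) - coordX ^ (j : ℕ))
      - coordX ^ (k + 1) * (ofParam μ * ((coordX + v) ^ k - coordX ^ k))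
      - coordX ^ (k + 1) * (MvPowerSeries.pderiv 𝕜 none v * (ofParam μ * (coordX + v) ^ k))
      - Z * ((1 + MvPowerSeries.pderiv 𝕜 none v) * (1 + ofParam μ * (coordX + v) ^ k)) := by
  rw [nonlin, linOp, numAt, denAt, map_one]
  simp_rw [mul_sub (ofParam _), Finset.sum_sub_distrib]
  have h : ((k : 𝕜) + 1) • (v * coordX ^ k) =
      ((k : FormalFamily m 𝕜) + 1) * (v * coordX ^ k) := by
    rw [add_smul, one_smul, add_mul, one_mul]
    congr 1
    rw [Nat.cast_smul_eq_nsmul, nsmul_eq_mul]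
  rw [h]
  ring

/-- The map whose fixed points are the right-hand sides of the solutions. -/
def stepMap (k : ℕ) (Z : FormalFamily m 𝕜) (b : ParamSeries m 𝕜) (g : FormalFamily m 𝕜) :
    FormalFamily m 𝕜 :=
  nonlin k Z (vOf k b g) (yOf k g) (muOf k g)

variable {M : ℕ} {n : ℕ∞} {K k : ℕ}

lemma near_pow_sub {v v' : FormalFamily m 𝕜} (hv : Near M n 2 K v v') (i : ℕ) :
    Near M n (i + 1) K ((coordX + v) ^ i - coordX ^ i) ((coordX + v') ^ i - coordX ^ i) := by
  have hx : Near M n 1 K (coordX + v) (coordX + v') :=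
    (Near.refl K coordX_mem_filt).add (hv.mono (by omega) (by omega))
  induction i with
  | zero => simpa using Near.refl K (zero_mem _)
  | succ i ih =>
    have e : ∀ w : FormalFamily m 𝕜, (coordX + w) ^ (i + 1) - coordX ^ (i + 1) =
        ((coordX + w) ^ i - coordX ^ i) * (coordX + w) + coordX ^ i * w := fun w => by ring
    rw [e, e]
    exact (ih.mul hx).add ((Near.refl K (coordX_pow_mem_filt i)).mul hv)

lemma near_pow_sub_sub {v v' : FormalFamily m 𝕜} (hv : Near M n 2 K v v') (i : ℕ) :
    Near M n (i + 3) K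
      ((coordX + v) ^ (i + 1) - coordX ^ (i + 1) - ((i : FormalFamily m 𝕜) + 1) * coordX ^ i * v)
      ((coordX + v') ^ (i + 1) - coordX ^ (i + 1) -
        ((i : FormalFamily m 𝕜) + 1) * coordX ^ i * v') := by
  induction i with
  | zero => simpa using Near.refl K (zero_mem _)
  | succ i ih =>
    have e : ∀ w : FormalFamily m 𝕜, (coordX + w) ^ (i + 1 + 1) - coordX ^ (i + 1 + 1) -
        (((i + 1 : ℕ) : FormalFamily m 𝕜) + 1) * coordX ^ (i + 1) * w =
        coordX * ((coordX + w) ^ (i + 1) - coordX ^ (i + 1) -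
          ((i : FormalFamily m 𝕜) + 1) * coordX ^ i * w) +
        w * ((coordX + w) ^ (i + 1) - coordX ^ (i + 1)) := fun w => by push_cast; ring
    rw [e, e]
    have h1 := (Near.refl (n := n) K (coordX_mem_filt (𝕜 := 𝕜) (m := m) (M := M))).mul ih
    have h2 := hv.mul (near_pow_sub hv (i + 1))
    exact (h1.mono (by omega) (by omega)).add (h2.mono (by omega) (by omega))

lemma near_ofParam {b b' : ParamSeries m 𝕜} {j p q : ℕ} (hq : q + j ≤ p)
    (h : Near M n p K (ofParam b * coordX ^ j) (ofParam b' * coordX ^ j)) :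
    Near M n q K (ofParam b : FormalFamily m 𝕜) (ofParam b') :=
  ⟨mem_filt_of_mul_pow (filt_le h.1 hq), mem_filt_of_mul_pow (filt_le h.2 hq),
    mem_filt_of_mul_pow (j := j) (by rw [sub_mul]; exact filt_le h.3 (by omega))⟩

/-- For `k ≥ 1` the series `μ` itself need not be small, only `μ x^(2k+1)` is; the gain comes from
the `k` extra weights of `h`. For `k = 0` it comes from `μ(0) = 0`. -/
lemma near_mu_mul {μ μ' : ParamSeries m 𝕜} {h h' : FormalFamily m 𝕜} {p : ℕ}
    (hμ : Near M n (k + 2) K (ofParam μ * coordX ^ (2 * k + 1))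
      (ofParam μ' * coordX ^ (2 * k + 1)))
    (hp : Near M n (p + k) K h h') : Near M n (p + 1) K (ofParam μ * h) (ofParam μ' * h') := by
  rcases Nat.eq_zero_or_pos k with rfl | hk
  · have h1 : Near M n 1 K (ofParam μ : FormalFamily m 𝕜) (ofParam μ') :=
      near_ofParam (by omega) hμ
    exact (h1.mul hp).mono (by omega) (by omega)
  · refine ⟨?_, ?_, ?_⟩
    · exact Ideal.mul_mem_left _ _ (filt_le hp.1 (by omega))
    · exact Ideal.mul_mem_left _ _ (filt_le hp.2 (by omega))
    · have e : ofParam μ * h - ofParam μ' * h' =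
          (ofParam μ - ofParam μ') * h + ofParam μ' * (h - h') := by ring
      rw [e]
      refine add_mem ?_ (Ideal.mul_mem_left _ _ (filt_le hp.3 (by omega)))
      have h1 := hμ.3
      rw [← sub_mul] at h1
      -- Dividing by `x^(2k+1)` leaves precision `K + 1 - k` on `μ`. When this is not a positive
      -- statement, the weight `p + k` of `h` alone exceeds the precision sought.
      rcases le_or_gt k (K + 1) with h2 | h2
      · have h3 : (ofParam μ - ofParam μ' : FormalFamily m 𝕜) ∈ Filt M n (K + 1 - k) :=
          mem_filt_of_mul_pow (j := 2 * k + 1) (filt_le h1 (by omega))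
        exact filt_le (filt_mul h3 (filt_of_top hp.1)) (by omega)
      · exact Ideal.mul_mem_left _ _ (filt_of_top (filt_le hp.1 (by omega)))

/-- The contraction estimate: relative precision `K` on the unknowns becomes `K + 1` on the
remainder. The perturbation `Z` must already be known to precision `K + 1`, since it enters to first
order. -/
lemma near_nonlin {Z Z' v v' : FormalFamily m 𝕜} {y y' : Fin k → ParamSeries m 𝕜}
    {μ μ' : ParamSeries m 𝕜} (hZ : Near M n (k + 2) (K + 1) Z Z') (hv : Near M n 2 K v v')
    (hy : ∀ j : Fin k, Near M n (k + 2) K (ofParam (y j) * coordX ^ (j : ℕ))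
      (ofParam (y' j) * coordX ^ (j : ℕ)))
    (hμ : Near M n (k + 2) K (ofParam μ * coordX ^ (2 * k + 1))
      (ofParam μ' * coordX ^ (2 * k + 1))) :
    Near M n (k + 2) (K + 1) (nonlin k Z v y μ) (nonlin k Z' v' y' μ') := by
  rw [nonlin_eq, nonlin_eq]
  have hx : Near M n 1 K (coordX + v) (coordX + v') :=
    (Near.refl K coordX_mem_filt).add (hv.mono (by omega) (by omega))
  have hw : Near M n 1 K (ofParam μ * (coordX + v) ^ k) (ofParam μ' * (coordX + v') ^ k) := by
    have := near_mu_mul (p := 0) hμ ((hx.pow k).mono (by omega) (by omega))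
    simpa using this
  have hd := Near.pderiv (p := 1) hv
  have hX : Near M n (k + 1) K ((coordX : FormalFamily m 𝕜) ^ (k + 1)) (coordX ^ (k + 1)) :=
    Near.refl K (coordX_pow_mem_filt _)
  refine Near.sub' (Near.sub' (Near.sub' (Near.add ?_ (Near.sum fun j _ => ?_)) ?_) ?_) ?_
  · exact (near_pow_sub_sub hv k).mono (by omega) (by omega)
  · have h1 : Near M n (k + 2 - j) K (ofParam (y j) : FormalFamily m 𝕜) (ofParam (y' j)) :=
      near_ofParam (by omega) (hy j)
    exact (h1.mul (near_pow_sub hv j)).mono (by omega) (by omega)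
  · have h1 := near_mu_mul (p := 1) hμ ((near_pow_sub hv k).mono (by omega) (by omega))
    exact (hX.mul h1).mono (by omega) (by omega)
  · exact (hX.mul (hd.mul hw)).mono (by omega) (by omega)
  · have h1 : Near M n 0 (K + 1) (1 + MvPowerSeries.pderiv 𝕜 none v)
        (1 + MvPowerSeries.pderiv 𝕜 none v') := Near.one.add (hd.mono (by omega) (by omega))
    have h2 : Near M n 0 (K + 1) (1 + ofParam μ * (coordX + v) ^ k)
        (1 + ofParam μ' * (coordX + v') ^ k) := Near.one.add (hw.mono (by omega) (by omega))
    exact (hZ.mul (h1.mul h2)).mono (by omega) (by omega)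

lemma near_vOf {b b' : ParamSeries m 𝕜} {g g' : FormalFamily m 𝕜}
    (hb : Near M n 2 K (ofParam b * coordX ^ (k + 1)) (ofParam b' * coordX ^ (k + 1)))
    (hg : Near M n (k + 2) K g g') : Near M n 2 K (vOf k b g) (vOf k b' g') := by
  refine Near.add ⟨linInv_mem_filt (filt_le hg.1 (by omega)),
    linInv_mem_filt (filt_le hg.2 (by omega)), ?_⟩ hb
  rw [← linInv_sub]
  exact linInv_mem_filt (filt_le hg.3 (by omega))

lemma near_coeffX {p : ℕ} {g g' : FormalFamily m 𝕜} (hg : Near M n p K g g') (j : ℕ) :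
    Near M n p K (ofParam (coeffX j g) * coordX ^ j) (ofParam (coeffX j g') * coordX ^ j) :=
  ⟨coeffX_mul_pow_mem_filt hg.1 j, coeffX_mul_pow_mem_filt hg.2 j, by
    rw [← sub_mul, ← map_sub, ← map_sub]; exact coeffX_mul_pow_mem_filt hg.3 j⟩

lemma near_yOf {g g' : FormalFamily m 𝕜} {p : ℕ} (hg : Near M n p K g g') (j : Fin k) :
    Near M n p K (ofParam (yOf k g j) * coordX ^ (j : ℕ))
      (ofParam (yOf k g' j) * coordX ^ (j : ℕ)) := by
  simp only [yOf, map_neg, neg_mul]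
  exact (near_coeffX hg j).neg

lemma near_stepMap {Z Z' : FormalFamily m 𝕜} {b b' : ParamSeries m 𝕜} {g g' : FormalFamily m 𝕜}
    (hZ : Near M n (k + 2) (K + 1) Z Z')
    (hb : Near M n 2 K (ofParam b * coordX ^ (k + 1)) (ofParam b' * coordX ^ (k + 1)))
    (hg : Near M n (k + 2) K g g') :
    Near M n (k + 2) (K + 1) (stepMap k Z b g) (stepMap k Z' b' g') :=
  near_nonlin hZ (near_vOf hb hg) (near_yOf hg) (near_coeffX hg _)

/-- A solution of the equation of conjugacy of `X` to the normal form, close to the identity. -/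
structure IsSol (M k : ℕ) (X v : FormalFamily m 𝕜) (y : Fin k → ParamSeries m 𝕜)
    (μ : ParamSeries m 𝕜) : Prop where
  hv : v ∈ Filt M ⊤ 2
  hy : ∀ j : Fin k, ofParam (y j) * coordX ^ (j : ℕ) ∈ (Filt M ⊤ (k + 2) : Ideal (FormalFamily m 𝕜))
  hμ : ofParam μ * coordX ^ (2 * k + 1) ∈ (Filt M ⊤ (k + 2) : Ideal (FormalFamily m 𝕜))
  eq : numAt k y (coordX + v) =
    X * (1 + MvPowerSeries.pderiv 𝕜 none v) * denAt k 1 μ (coordX + v)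

/-- Existence of solutions with a prescribed coefficient of `x ^ (k + 1)`; the right-hand side can
be taken in any closed set which is stable under `stepMap`. -/
lemma exists_isSol [CharZero 𝕜] {Z : FormalFamily m 𝕜} {b : ParamSeries m 𝕜} (hZ : Z ∈ Filt M ⊤ (k + 2))
    (hb : ofParam b * coordX ^ (k + 1) ∈ (Filt M ⊤ 2 : Ideal (FormalFamily m 𝕜)))
    (S : Set (FormalFamily m 𝕜)) (h0 : (0 : FormalFamily m 𝕜) ∈ S)
    (hcl : ∀ f : FormalFamily m 𝕜,
      (∀ K, ∃ g ∈ S, ∀ d, wt M d < K → coeff d f = coeff d g) → f ∈ S)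
    (hmaps : ∀ g ∈ S, g ∈ Filt M ⊤ (k + 2) → stepMap k Z b g ∈ S) :
    ∃ g ∈ S, g ∈ Filt M ⊤ (k + 2) ∧
      IsSol M k (coordX ^ (k + 1) + Z) (vOf k b g) (yOf k g) (muOf k g) := by
  obtain ⟨g, ⟨hgS, hgF⟩, hg⟩ := exists_fixedPoint_series (wt M)
    {g : FormalFamily m 𝕜 | g ∈ S ∧ g ∈ Filt M ⊤ (k + 2)} (stepMap k Z b)
    (fun g hg => ⟨hmaps g hg.1 hg.2, (near_stepMap (K := 0) (n := ⊤) (Near.refl _ hZ)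
      (Near.refl _ hb) (Near.refl _ hg.2)).1⟩) ⟨0, h0, zero_mem _⟩
    (fun f hf => ⟨hcl f fun K => by
        obtain ⟨g, hg, h⟩ := hf K; exact ⟨g, hg.1, h⟩, fun d hd _ => by
        obtain ⟨g, hg, h⟩ := hf (k + 2)
        exact (h d hd).trans (mem_filt_top.1 hg.2 d hd)⟩)
    (fun f hf g hg K hfg d hd => by
      rcases le_or_gt (k + 2) K with hK | hK
      · obtain ⟨L, rfl⟩ := Nat.exists_eq_add_of_le hK
        have h1 : Near M ⊤ (k + 2) L f g := ⟨hf.2, hg.2, mem_filt_top.2 fun d hd => by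
          rw [map_sub, hfg d hd, sub_self]⟩
        have h2 := mem_filt_top.1 (near_stepMap (Z := Z) (b := b) (Near.refl _ hZ)
          (Near.refl _ hb) h1).3 d (by omega)
        rw [map_sub] at h2
        exact sub_eq_zero.1 h2
      -- Below weight `k + 2` nothing needs comparing, because all values of the map vanish there.
      · have h2 : ∀ f : FormalFamily m 𝕜, f ∈ Filt M ⊤ (k + 2) → coeff d (stepMap k Z b f) = 0 :=
          fun f hf => mem_filt_top.1 (near_stepMap (K := 0) (n := ⊤) (Near.refl _ hZ)
            (Near.refl _ hb) (Near.refl _ hf)).1 d (by omega)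
        rw [h2 f hf.2, h2 g hg.2])
  have h1 := Near.refl (n := ⊤) 0 hgF
  refine ⟨g, hgS, hgF, (near_vOf (Near.refl 0 hb) h1).1, fun j => (near_yOf h1 j).1,
    (near_coeffX h1 _).1, ?_⟩
  rw [stepMap, nonlin, linOp_of] at hg
  linear_combination hg

/-- Every solution arises from a fixed point, namely its own linear part `g`; so statements on
solutions reduce to statements on fixed points. -/
lemma IsSol.exists_fixed [CharZero 𝕜] {X v : FormalFamily m 𝕜} {y : Fin k → ParamSeries m 𝕜}
    {μ : ParamSeries m 𝕜} (h : IsSol M k X v y μ) :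
    ∃ g, g ∈ Filt M ⊤ (k + 2) ∧ v = vOf k (coeffX (k + 1) v) g ∧ y = yOf k g ∧ μ = muOf k g ∧
      stepMap k (X - coordX ^ (k + 1)) (coeffX (k + 1) v) g = g := by
  obtain ⟨g, hgdef⟩ : ∃ g, linOp k v y μ = g := ⟨_, rfl⟩
  obtain ⟨e1, e2, e3⟩ := eq_of_linOp hgdef
  refine ⟨g, ?_, e1, e2, e3, ?_⟩
  · rw [← hgdef, linOp]
    refine sub_mem (add_mem (sub_mem ?_ (filt_smul _ ?_)) h.hμ) (sum_mem fun j _ => h.hy j)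
    · have := filt_mul (pderiv_mem_filt h.hv) (coordX_pow_mem_filt (𝕜 := 𝕜) (m := m) (M := M)
        (n := ⊤) (k + 1))
      exact filt_le this (by omega)
    · have := filt_mul h.hv (coordX_pow_mem_filt (𝕜 := 𝕜) (m := m) (M := M)
        (n := ⊤) k)
      exact filt_le this (by omega)
  · rw [stepMap, ← e1, ← e2, ← e3, nonlin, h.eq, hgdef]; ring

/-- Solutions for nearby data are close to each other. -/
lemma IsSol.stable [CharZero 𝕜] {X X' v v' : FormalFamily m 𝕜} {y y' : Fin k → ParamSeries m 𝕜}
    {μ μ' : ParamSeries m 𝕜} (h : IsSol M k X v y μ) (h' : IsSol M k X' v' y' μ')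
    (hX : X - coordX ^ (k + 1) ∈ Filt M ⊤ (k + 2))
    (hX' : X' - coordX ^ (k + 1) ∈ Filt M ⊤ (k + 2)) (hXX' : ∀ K, X - X' ∈ Filt M n K)
    (hb : ∀ K, ofParam (coeffX (k + 1) v - coeffX (k + 1) v') ∈
      (Filt M n K : Ideal (FormalFamily m 𝕜))) (K : ℕ) :
    v - v' ∈ Filt M n K ∧ (∀ j, ofParam (y j - y' j) ∈ (Filt M n K : Ideal (FormalFamily m 𝕜))) ∧
      ofParam (μ - μ') ∈ (Filt M n K : Ideal (FormalFamily m 𝕜)) := by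
  obtain ⟨g, hg, ev, ey, em, eg⟩ := h.exists_fixed
  obtain ⟨g', hg', ev', ey', em', eg'⟩ := h'.exists_fixed
  set b := coeffX (k + 1) v
  set b' := coeffX (k + 1) v'
  have hbv : ofParam b * coordX ^ (k + 1) ∈ (Filt M ⊤ 2 : Ideal (FormalFamily m 𝕜)) :=
    coeffX_mul_pow_mem_filt h.hv _
  have hbv' : ofParam b' * coordX ^ (k + 1) ∈ (Filt M ⊤ 2 : Ideal (FormalFamily m 𝕜)) :=
    coeffX_mul_pow_mem_filt h'.hv _
  have nb : ∀ K, Near M n 2 K (ofParam b * coordX ^ (k + 1))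
      (ofParam b' * coordX ^ (k + 1) : FormalFamily m 𝕜) := fun K => ⟨hbv, hbv', by
    rw [← sub_mul, ← map_sub]; exact Ideal.mul_mem_right _ _ (hb _)⟩
  have nZ : ∀ K, Near M n (k + 2) K (X - coordX ^ (k + 1)) (X' - coordX ^ (k + 1)) :=
    fun K => ⟨hX, hX', by rw [sub_sub_sub_cancel_right]; exact hXX' _⟩
  -- Each application of `stepMap` gains one weight, so two fixed points agree to every weight in
  -- parameter degree `< n`. The value `n = ⊤` gives uniqueness, and `n = 1` compares the solutions
  -- at `λ = 0`.
  have ng : ∀ K, Near M n (k + 2) K g g' := by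
    intro K
    induction K with
    | zero => exact ⟨hg, hg', filt_of_top (sub_mem hg hg')⟩
    | succ K ih =>
      have := near_stepMap (nZ (K + 1)) (nb K) ih
      rwa [eg, eg'] at this
  refine ⟨?_, fun j => ?_, ?_⟩
  · rw [ev, ev']; exact filt_le (near_vOf (nb K) (ng K)).3 (by omega)
  · have h1 := (near_yOf (ng K) j).3
    rw [← ey, ← ey', ← sub_mul, ← map_sub] at h1
    exact mem_filt_of_mul_pow (filt_le h1 (by omega))
  · have h1 := (near_coeffX (ng (K + 2 * k + 1)) (2 * k + 1)).3
    rw [← muOf, ← muOf, ← em, ← em', ← sub_mul, ← map_sub] at h1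
    exact mem_filt_of_mul_pow (filt_le h1 (by omega))

end Nonlinear

/-! ### Exponentials of derivations that raise weights. -/

section ExpDerivation

variable {𝕜 : Type*} [Field 𝕜] {m : ℕ}

/-- The exponential of a derivation which raises weights, applied to a series. -/
def expDer (M : ℕ) (D : Derivation 𝕜 (FormalFamily m 𝕜) (FormalFamily m 𝕜))
    (f : FormalFamily m 𝕜) : FormalFamily m 𝕜 := fun d =>
  ∑ i ∈ Finset.range (wt M d + 1), coeff d (((i.factorial : 𝕜)⁻¹) • D^[i] f)

/-- The derivation raises weights. -/
def Raises (M : ℕ) (D : Derivation 𝕜 (FormalFamily m 𝕜) (FormalFamily m 𝕜)) : Prop :=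
  ∀ K f, f ∈ Filt M ⊤ K → D f ∈ Filt M ⊤ (K + 1)

variable {M : ℕ} {D : Derivation 𝕜 (FormalFamily m 𝕜) (FormalFamily m 𝕜)}

lemma Raises.iterate (hD : Raises M D) {K : ℕ} {f : FormalFamily m 𝕜} (hf : f ∈ Filt M ⊤ K)
    (i : ℕ) : D^[i] f ∈ Filt M ⊤ (K + i) := by
  induction i with
  | zero => exact hf
  | succ i ih => rw [Function.iterate_succ_apply']; exact hD _ _ ih

lemma coeff_expDer_eq (f : FormalFamily m 𝕜) (d : Option (Fin m) →₀ ℕ) :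
    coeff d (expDer M D f) =
      ∑ i ∈ Finset.range (wt M d + 1), coeff d (((i.factorial : 𝕜)⁻¹) • D^[i] f) := rfl

/-- `D^[i] f` has weight at least `i`, so the point of truncation in `expDer` is immaterial once it
exceeds the weight of the monomial. -/
lemma coeff_expDer (hD : Raises M D) (f : FormalFamily m 𝕜) (d : Option (Fin m) →₀ ℕ) {K : ℕ}
    (h : wt M d < K) : coeff d (expDer M D f) =
      ∑ i ∈ Finset.range K, coeff d (((i.factorial : 𝕜)⁻¹) • D^[i] f) := by
  refine Finset.sum_subset (Finset.range_mono (by omega)) fun i _ hi => ?_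
  have := mem_filt_top.1 (hD.iterate (K := 0) (mem_filt_zero f) i) d (by
    simp at hi; omega)
  rw [MvPowerSeries.coeff_smul, this, mul_zero]

lemma expDer_sub_sum (hD : Raises M D) (f : FormalFamily m 𝕜) (K : ℕ) :
    expDer M D f - ∑ i ∈ Finset.range K, ((i.factorial : 𝕜)⁻¹) • D^[i] f ∈ Filt M ⊤ K :=
  mem_filt_top.2 fun d hd => by
    rw [map_sub, map_sum, coeff_expDer hD f d hd, sub_self]

lemma expDer_sub_self (hD : Raises M D) {K : ℕ} {f : FormalFamily m 𝕜} (hf : f ∈ Filt M ⊤ K) :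
    expDer M D f - f ∈ Filt M ⊤ (K + 1) := by
  have h := expDer_sub_sum hD f (K + 1)
  rw [Finset.sum_range_succ'] at h
  simp only [Nat.factorial_zero, Nat.cast_one, inv_one, one_smul, Function.iterate_zero, id_eq] at h
  have h2 : ∑ i ∈ Finset.range K, (((i + 1).factorial : 𝕜)⁻¹) • D^[i + 1] f ∈ Filt M ⊤ (K + 1) :=
    sum_mem fun i _ => filt_smul _ (filt_le (hD.iterate hf (i + 1)) (by omega))
  have := add_mem h h2
  convert this using 1
  ring

lemma expDer_of_eq_zero {f : FormalFamily m 𝕜} (hf : D f = 0) : expDer M D f = f := by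
  ext d
  have h : ∀ i, D^[i + 1] f = 0 := fun i => by
    rw [Function.iterate_succ_apply, hf]
    induction i with
    | zero => rfl
    | succ i ih => rw [Function.iterate_succ_apply', ih, map_zero]
  rw [coeff_expDer_eq, Finset.sum_range_succ']
  simp [h]

lemma iterate_map_add (f g : FormalFamily m 𝕜) (i : ℕ) : D^[i] (f + g) = D^[i] f + D^[i] g := by
  induction i with
  | zero => rfl
  | succ i ih => simp only [Function.iterate_succ_apply', ih, map_add]

lemma expDer_add (f g : FormalFamily m 𝕜) :
    expDer M D (f + g) = expDer M D f + expDer M D g := by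
  ext d
  simp only [map_add, coeff_expDer_eq, iterate_map_add, smul_add, Finset.sum_add_distrib]

lemma iterate_leibniz [CharZero 𝕜] (f g : FormalFamily m 𝕜) (n : ℕ) :
    ((n.factorial : 𝕜)⁻¹) • D^[n] (f * g) = ∑ p ∈ Finset.HasAntidiagonal.antidiagonal n,
      (((p.1.factorial : 𝕜)⁻¹) • D^[p.1] f) * (((p.2.factorial : 𝕜)⁻¹) • D^[p.2] g) := by
  have step : ∀ (h : FormalFamily m 𝕜) (i : ℕ),
      D (((i.factorial : 𝕜)⁻¹) • D^[i] h) =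
        ((i : 𝕜) + 1) • ((((i + 1).factorial : 𝕜)⁻¹) • D^[i + 1] h) := fun h i => by
    rw [D.map_smul, Function.iterate_succ_apply', smul_smul, Nat.factorial_succ]
    congr 1
    have h1 : (i.factorial : 𝕜) ≠ 0 := by exact_mod_cast i.factorial_ne_zero
    have h2 : (i : 𝕜) + 1 ≠ 0 := by exact_mod_cast i.succ_ne_zero
    push_cast; field_simp
  induction n with
  | zero => simp
  | succ n ih =>
    have h2 : (n : 𝕜) + 1 ≠ 0 := by exact_mod_cast n.succ_ne_zero
    -- After multiplication by `n + 1`, the derivative of the `n`-th divided power is the next one,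
    -- and the induction is the usual Leibniz recurrence. The factor is split as `p.1 + p.2` over
    -- the antidiagonal.
    apply smul_right_injective _ h2
    dsimp only
    rw [← step, ih, map_sum]
    simp only [Derivation.leibniz, smul_eq_mul, step]
    rw [Finset.sum_add_distrib]
    set a : ℕ → FormalFamily m 𝕜 := fun i => ((i.factorial : 𝕜)⁻¹) • D^[i] f with ha
    set c : ℕ → FormalFamily m 𝕜 := fun i => ((i.factorial : 𝕜)⁻¹) • D^[i] g with hc
    have e1 : ((n : 𝕜) + 1) • ∑ p ∈ Finset.HasAntidiagonal.antidiagonal (n + 1), a p.1 * c p.2 =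
        ∑ p ∈ Finset.HasAntidiagonal.antidiagonal (n + 1), (p.2 : 𝕜) • (a p.1 * c p.2) +
        ∑ p ∈ Finset.HasAntidiagonal.antidiagonal (n + 1), (p.1 : 𝕜) • (a p.1 * c p.2) := by
      rw [Finset.smul_sum, ← Finset.sum_add_distrib]
      refine Finset.sum_congr rfl fun p hp => ?_
      rw [← add_smul]; congr 1
      have := Finset.HasAntidiagonal.mem_antidiagonal.1 hp
      have h3 : ((p.1 + p.2 : ℕ) : 𝕜) = (n + 1 : ℕ) := by rw [this]
      push_cast at h3; linear_combination -h3
    rw [e1, Finset.Nat.sum_antidiagonal_succ', Finset.Nat.sum_antidiagonal_succ]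
    simp only [Nat.cast_zero, zero_smul, zero_add, Nat.cast_succ]
    congr 1
    · exact Finset.sum_congr rfl fun p _ => by rw [mul_smul_comm]
    · exact Finset.sum_congr rfl fun p _ => by rw [mul_smul_comm, mul_comm]

/-- The product of the sums truncated at `K` differs from the truncation of the product only by
terms `i + j ≥ K`, which have weight at least `K`. -/
lemma expDer_mul [CharZero 𝕜] (hD : Raises M D) (f g : FormalFamily m 𝕜) :
    expDer M D (f * g) = expDer M D f * expDer M D g := by
  refine eq_of_sub_mem_filt (M := M) fun K => ?_
  have h1 := expDer_sub_sum hD (f * g) K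
  have h2 := expDer_sub_sum hD f K
  have h3 := expDer_sub_sum hD g K
  set a : ℕ → FormalFamily m 𝕜 := fun i => ((i.factorial : 𝕜)⁻¹) • D^[i] f with ha
  set c : ℕ → FormalFamily m 𝕜 := fun i => ((i.factorial : 𝕜)⁻¹) • D^[i] g with hc
  have h4 : (∑ i ∈ Finset.range K, a i) * (∑ i ∈ Finset.range K, c i) -
      ∑ n ∈ Finset.range K, ((n.factorial : 𝕜)⁻¹) • D^[n] (f * g) ∈ Filt M ⊤ K := by
    simp_rw [iterate_leibniz]
    rw [Finset.sum_mul_sum, ← Finset.sum_product', Finset.sum_sigma']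
    have e : ∑ x ∈ (Finset.range K).sigma fun n => Finset.HasAntidiagonal.antidiagonal n, a x.2.1 * c x.2.2 =
        ∑ p ∈ (Finset.range K ×ˢ Finset.range K).filter (fun p => p.1 + p.2 < K),
          a p.1 * c p.2 := by
      refine Finset.sum_bij' (fun x _ => x.2) (fun p _ => ⟨p.1 + p.2, p⟩) ?_ ?_ ?_ ?_ ?_
      · rintro ⟨n, p⟩ h
        simp only [Finset.mem_sigma, Finset.mem_range, Finset.HasAntidiagonal.mem_antidiagonal] at h
        obtain ⟨h1, h2⟩ := h
        simp only [Finset.mem_filter, Finset.mem_product, Finset.mem_range]; omega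
      · intro p h
        simp only [Finset.mem_filter, Finset.mem_product, Finset.mem_range] at h
        simp only [Finset.mem_sigma, Finset.mem_range, Finset.HasAntidiagonal.mem_antidiagonal]
        exact ⟨h.2, trivial⟩
      · rintro ⟨n, p⟩ h
        simp only [Finset.mem_sigma, Finset.mem_range, Finset.HasAntidiagonal.mem_antidiagonal] at h
        obtain ⟨_, rfl⟩ := h; rfl
      · intros; rfl
      · intros; rfl
    rw [e, ← Finset.sum_filter_add_sum_filter_not (Finset.range K ×ˢ Finset.range K)
      (fun p => p.1 + p.2 < K), add_sub_cancel_left]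
    refine sum_mem fun p hp => ?_
    simp only [Finset.mem_filter, not_lt] at hp
    have := filt_mul (filt_smul ((p.1.factorial : 𝕜)⁻¹) (hD.iterate (mem_filt_zero f) p.1))
      (filt_smul ((p.2.factorial : 𝕜)⁻¹) (hD.iterate (mem_filt_zero g) p.2))
    have h5 := hp.2
    exact filt_le this (by omega)
  have e : expDer M D (f * g) - expDer M D f * expDer M D g =
      (expDer M D (f * g) - ∑ n ∈ Finset.range K, ((n.factorial : 𝕜)⁻¹) • D^[n] (f * g)) -
      ((∑ i ∈ Finset.range K, a i) * (∑ i ∈ Finset.range K, c i) -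
        ∑ n ∈ Finset.range K, ((n.factorial : 𝕜)⁻¹) • D^[n] (f * g)) -
      (expDer M D f - ∑ i ∈ Finset.range K, a i) * expDer M D g -
      (∑ i ∈ Finset.range K, a i) * (expDer M D g - ∑ i ∈ Finset.range K, c i) := by ring
  rw [e]
  exact sub_mem (sub_mem (sub_mem h1 h4) (Ideal.mul_mem_right _ _ h2)) (Ideal.mul_mem_left _ _ h3)

/-- `A` may lower the weight by one, which covers `X ∂/∂x` for any `X`, even without zero at the
origin. -/
lemma expDer_commute (hD : Raises M D) (A : FormalFamily m 𝕜 →ₗ[𝕜] FormalFamily m 𝕜)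
    (hA : ∀ K f, f ∈ Filt M ⊤ (K + 1) → A f ∈ Filt M ⊤ K) (hAD : ∀ f, A (D f) = D (A f))
    (f : FormalFamily m 𝕜) : A (expDer M D f) = expDer M D (A f) := by
  refine eq_of_sub_mem_filt (M := M) fun K => ?_
  have h1 := hA _ _ (expDer_sub_sum hD f (K + 1))
  have h2 := filt_le (expDer_sub_sum hD (A f) (K + 1)) (Nat.le_succ K)
  have h3 : ∀ i, A (D^[i] f) = D^[i] (A f) := fun i => by
    induction i with
    | zero => rfl
    | succ i ih => rw [Function.iterate_succ_apply', Function.iterate_succ_apply', hAD, ih]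
  rw [map_sub, map_sum] at h1
  simp only [map_smul, h3] at h1
  simpa using sub_mem h1 h2

/-- The exponential of a derivation which raises weights, as a ring homomorphism. -/
def expDerHom [CharZero 𝕜] (hD : Raises M D) : FormalFamily m 𝕜 →+* FormalFamily m 𝕜 where
  toFun := expDer M D
  map_one' := expDer_of_eq_zero D.map_one_eq_zero
  map_mul' := expDer_mul hD
  map_zero' := expDer_of_eq_zero (map_zero D)
  map_add' := expDer_add

end ExpDerivation

/-! ### Flows `exp(t(λ) X)` and their dependence on the time. -/

section Flow

variable {𝕜 : Type*} [Field 𝕜] {m : ℕ} {M k : ℕ}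

/-- The derivation `t(λ) X(x;λ) ∂/∂x`. -/
def flowDer (X : FormalFamily m 𝕜) (t : ParamSeries m 𝕜) :
    Derivation 𝕜 (FormalFamily m 𝕜) (FormalFamily m 𝕜) :=
  (ofParam t * X) • MvPowerSeries.pderiv 𝕜 none

lemma flowDer_apply (X : FormalFamily m 𝕜) (t : ParamSeries m 𝕜) (f : FormalFamily m 𝕜) :
    flowDer X t f = ofParam t * X * MvPowerSeries.pderiv 𝕜 none f := rfl

lemma raises_flowDer {X : FormalFamily m 𝕜} {t : ParamSeries m 𝕜}
    (h : ofParam t * X ∈ Filt M ⊤ 2) : Raises M (flowDer X t) := by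
  intro K f hf
  rw [flowDer_apply]
  rcases K with _ | K
  · exact Ideal.mul_mem_right _ _ (filt_le h (by omega))
  · exact filt_le (filt_mul h (pderiv_mem_filt hf)) (by omega)

lemma iterate_flowDer (X : FormalFamily m 𝕜) (t : ParamSeries m 𝕜) (f : FormalFamily m 𝕜) (i : ℕ) :
    (flowDer X t)^[i] f =
      ofParam t ^ i * (fun g => X * MvPowerSeries.pderiv 𝕜 none g)^[i] f := by
  induction i with
  | zero => simp
  | succ i ih =>
    rw [Function.iterate_succ_apply', Function.iterate_succ_apply', ih, flowDer_apply,
      Derivation.leibniz, ← map_pow, pderiv_ofParam, smul_zero, add_zero, smul_eq_mul, map_pow]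
    ring

/-- `t` does not depend on `x`, so the derivation `t X ∂/∂x` commutes with `X ∂/∂x`. -/
lemma X_mul_pderiv_expDer {X : FormalFamily m 𝕜} {t : ParamSeries m 𝕜}
    (h : ofParam t * X ∈ Filt M ⊤ 2) (φ : FormalFamily m 𝕜) :
    X * MvPowerSeries.pderiv 𝕜 none (expDer M (flowDer X t) φ) =
      expDer M (flowDer X t) (X * MvPowerSeries.pderiv 𝕜 none φ) := by
  have h2 := expDer_commute (raises_flowDer h)
    ((LinearMap.mulLeft 𝕜 X).comp (MvPowerSeries.pderiv 𝕜 none).toLinearMap)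
    (fun K f hf => Ideal.mul_mem_left _ _ (pderiv_mem_filt hf))
    (fun f => by
      simp only [LinearMap.comp_apply, LinearMap.mulLeft_apply, Derivation.coeFn_coe,
        flowDer_apply, Derivation.leibniz, pderiv_ofParam, add_zero, smul_eq_mul, mul_zero]
      ring) φ
  simpa only [LinearMap.comp_apply, LinearMap.mulLeft_apply, Derivation.coeFn_coe] using h2

lemma expDerHom_ofParam [CharZero 𝕜] {X : FormalFamily m 𝕜} {t : ParamSeries m 𝕜}
    (h : Raises M (flowDer X t)) (b : ParamSeries m 𝕜) :
    expDerHom h (ofParam b) = ofParam b :=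
  expDer_of_eq_zero (by rw [flowDer_apply, pderiv_ofParam, mul_zero])

/-- The flow of `X` at the time `t` preserves the solutions of the conjugacy equation. -/
lemma conj_expDer [CharZero 𝕜] {X φ : FormalFamily m 𝕜} {t : ParamSeries m 𝕜}
    (h : ofParam t * X ∈ Filt M ⊤ 2) {s : 𝕜} {y : Fin k → ParamSeries m 𝕜}
    {μ : ParamSeries m 𝕜}
    (hφ : numAt k y φ = X * MvPowerSeries.pderiv 𝕜 none φ * denAt k s μ φ) :
    numAt k y (expDer M (flowDer X t) φ) =
      X * MvPowerSeries.pderiv 𝕜 none (expDer M (flowDer X t) φ) *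
        denAt k s μ (expDer M (flowDer X t) φ) := by
  have hD := raises_flowDer h
  have hfix : ∀ b, expDerHom hD (ofParam b) = ofParam b := expDerHom_ofParam hD
  -- The exponential is a ring endomorphism that fixes the parameters, so it acts on `num` and `den`
  -- through `φ` alone; it also commutes with `X ∂/∂x`.
  have h1 := congrArg (expDerHom hD) hφ
  rw [map_mul, map_numAt _ hfix, map_denAt _ hfix] at h1
  rw [X_mul_pderiv_expDer h]
  exact h1

/-- With truncated subtraction the bound is `i (p - 1) + 1` for `p ≥ 1`, each step adding `p - 1`,
and `1 - i` for `p = 0`, where it is empty after the first step. -/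
lemma iterate_mem_filt {p : ℕ} {X φ : FormalFamily m 𝕜} (hX : X ∈ Filt M ⊤ p)
    (hφ : φ ∈ Filt M ⊤ 1) (i : ℕ) :
    (fun g => X * MvPowerSeries.pderiv 𝕜 none g)^[i] φ ∈ Filt M ⊤ (i * (p - 1) + (1 - (1 - p) * i)) := by
  induction i with
  | zero => simpa using hφ
  | succ i ih =>
    rw [Function.iterate_succ_apply']
    rcases p with _ | p
    · simp
    · exact filt_le (filt_mul hX (pderiv_mem_filt (K := i * p) (by simpa using ih)))
        (by simp; ring_nf; omega)

lemma pow_sub_pow_mem_filt {a b : FormalFamily m 𝕜} {K q : ℕ} (ha : a ∈ Filt M ⊤ q)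
    (hb : b ∈ Filt M ⊤ q) (hab : a - b ∈ Filt M ⊤ K) (i : ℕ) :
    a ^ (i + 1) - b ^ (i + 1) ∈ Filt M ⊤ (K + i * q) := by
  induction i with
  | zero => simpa using hab
  | succ i ih =>
    have e : a ^ (i + 1 + 1) - b ^ (i + 1 + 1) =
        (a - b) * a ^ (i + 1) + b * (a ^ (i + 1) - b ^ (i + 1)) := by ring
    rw [e]
    exact add_mem (filt_mul hab (filt_pow ha _)) (filt_le (filt_mul hb ih) (by ring_nf; omega))

lemma filt_of_sub_coordX_pow {p : ℕ} {X : FormalFamily m 𝕜} {a : 𝕜}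
    (hX : X - a • coordX ^ p ∈ Filt M ⊤ (p + 1)) : X ∈ Filt M ⊤ p := by
  have := add_mem (filt_le hX (Nat.le_succ _))
    (filt_smul a (coordX_pow_mem_filt (𝕜 := 𝕜) (m := m) (M := M) (n := ⊤) p))
  simpa using this

/-- For `p ≥ 2` any time is allowed, since `X` has weight at least 2. For `p ≤ 1` the condition
`t(0) = 0` supplies the missing weight, a parameter weighing at least 2. -/
lemma ofParam_filt_of_zero {p : ℕ} {t : ParamSeries m 𝕜} (hM : 2 ≤ M)
    (ht : p ≤ 1 → MvPowerSeries.constantCoeff t = 0) :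
    (ofParam t : FormalFamily m 𝕜) ∈ Filt M ⊤ (2 - p) := by
  rcases Nat.lt_or_ge 1 p with hp | hp
  · rw [show 2 - p = 0 by omega]; simp
  · refine ofParam_mem_filt.2 fun a ha _ => ?_
    have : a = 0 := by
      rw [← Finsupp.degree_eq_zero_iff]
      rcases Nat.eq_zero_or_pos a.degree with h | h
      · exact h
      · nlinarith [Nat.sub_le 2 p]
    rw [this]; exact ht hp

lemma ofParam_mul_filt_two {p : ℕ} {X : FormalFamily m 𝕜} {t : ParamSeries m 𝕜} (hM : 2 ≤ M)
    (hX : X ∈ Filt M ⊤ p) (ht : p ≤ 1 → MvPowerSeries.constantCoeff t = 0) :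
    ofParam t * X ∈ Filt M ⊤ 2 :=
  filt_le (filt_mul (ofParam_filt_of_zero hM ht) hX) (by omega)

/-- The dependence of the flow on the time, at first order. -/
lemma expDer_sub_expDer {p : ℕ} {X φ : FormalFamily m 𝕜} {a α : 𝕜} {t t' : ParamSeries m 𝕜} {K : ℕ}
    (hM : 2 ≤ M) (hX : X - a • coordX ^ p ∈ Filt M ⊤ (p + 1))
    (hφ : φ - α • coordX ∈ Filt M ⊤ 2) (ht : p ≤ 1 → MvPowerSeries.constantCoeff t = 0)
    (ht' : p ≤ 1 → MvPowerSeries.constantCoeff t' = 0)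
    (htt' : (ofParam (t - t') : FormalFamily m 𝕜) ∈ Filt M ⊤ K) :
    expDer M (flowDer X t) φ - expDer M (flowDer X t') φ -
      ofParam ((a * α) • (t - t')) * coordX ^ p ∈ Filt M ⊤ (K + p + 1) := by
  have hX1 := filt_of_sub_coordX_pow hX
  have hφ1 : φ ∈ Filt M ⊤ 1 := by
    have := add_mem (filt_le hφ (by omega : 1 ≤ 2)) (filt_smul α coordX_mem_filt)
    simpa using this
  have h1 := filt_le (expDer_sub_sum (raises_flowDer (ofParam_mul_filt_two hM hX1 ht)) φ
    (K + p + 2)) (Nat.le_succ (K + p + 1))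
  have h2 := filt_le (expDer_sub_sum (raises_flowDer (ofParam_mul_filt_two hM hX1 ht')) φ
    (K + p + 2)) (Nat.le_succ (K + p + 1))
  rw [map_sub] at htt'
  -- The terms of degree at least 2 in the time are negligible: `t^(i+2) - t'^(i+2)` has weight at
  -- least `K + (i+1)(2-p)`, and the iterates of `X ∂/∂x` supply the rest.
  have h3 : ∀ i, (((i + 2).factorial : 𝕜)⁻¹) • (flowDer X t)^[i + 2] φ -
      (((i + 2).factorial : 𝕜)⁻¹) • (flowDer X t')^[i + 2] φ ∈ Filt M ⊤ (K + p + 1) := by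
    intro i
    rw [← smul_sub, iterate_flowDer, iterate_flowDer, ← sub_mul]
    refine filt_smul _ (filt_le (filt_mul (pow_sub_pow_mem_filt (ofParam_filt_of_zero hM ht)
      (ofParam_filt_of_zero hM ht') htt' (i + 1)) (iterate_mem_filt hX1 hφ1 (i + 2))) ?_)
    rcases p with _ | _ | p
    · omega
    · simp
    · simp; nlinarith
  have h4 : (flowDer X t) φ - (flowDer X t') φ - ofParam ((a * α) • (t - t')) * coordX ^ p
      ∈ Filt M ⊤ (K + p + 1) := by
    have e : (flowDer X t) φ - (flowDer X t') φ - ofParam ((a * α) • (t - t')) * coordX ^ p =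
        (ofParam t - ofParam t') * ((X - a • coordX ^ p) * MvPowerSeries.pderiv 𝕜 none φ +
          a • (coordX ^ p * MvPowerSeries.pderiv 𝕜 none (φ - α • coordX))) := by
      rw [flowDer_apply, flowDer_apply, map_sub, Derivation.map_smul, pderiv_coordX, map_smul,
        map_sub]
      simp only [MvPowerSeries.smul_eq_C_mul, map_mul]
      ring
    rw [e]
    refine filt_le (filt_mul htt' (add_mem (Ideal.mul_mem_right _ _ hX) (filt_smul _ ?_)))
      (by omega)
    exact filt_le (filt_mul (coordX_pow_mem_filt p) (pderiv_mem_filt (K := 1) hφ)) le_rfl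
  have e1 : ∀ t : ParamSeries m 𝕜,
      ∑ i ∈ Finset.range (K + p + 2), ((i.factorial : 𝕜)⁻¹) • (flowDer X t)^[i] φ =
      ∑ i ∈ Finset.range (K + p), (((i + 2).factorial : 𝕜)⁻¹) • (flowDer X t)^[i + 2] φ +
        flowDer X t φ + φ := fun t => by
    rw [Finset.sum_range_succ', Finset.sum_range_succ']
    simp
  rw [e1] at h1 h2
  have h5 := sum_mem (t := Finset.range (K + p)) fun i _ => h3 i
  rw [Finset.sum_sub_distrib] at h5
  have := add_mem (add_mem (sub_mem h1 h2) h5) h4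
  convert this using 1
  ring

/-- The time of the flow can be adjusted to obtain any coefficient of `x ^ p`. -/
lemma exists_flow_time {p : ℕ} {X φ φ' : FormalFamily m 𝕜} {a α : 𝕜} (ha : a ≠ 0) (hα : α ≠ 0)
    (hM : 2 ≤ M) (hX : X - a • coordX ^ p ∈ Filt M ⊤ (p + 1))
    (hφ : φ - α • coordX ∈ Filt M ⊤ 2) (hφ' : φ - φ' ∈ Filt M ⊤ 2) :
    ∃ t : ParamSeries m 𝕜, (p ≤ 1 → MvPowerSeries.constantCoeff t = 0) ∧
      coeffX p (expDer M (flowDer X t) φ) = coeffX p φ' := by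
  have hX1 := filt_of_sub_coordX_pow hX
  have hφ1 : φ ∈ Filt M ⊤ 1 := by
    have := add_mem (filt_le hφ (by omega : 1 ≤ 2)) (filt_smul α coordX_mem_filt)
    simpa using this
  have haα := mul_ne_zero ha hα
  -- A Newton map with frozen derivative `a α`, the leading coefficient of the variation of the flow
  -- with its time; by `expDer_sub_expDer` its error gains one weight.
  set T : ParamSeries m 𝕜 → ParamSeries m 𝕜 := fun t =>
    t - (a * α)⁻¹ • (coeffX p (expDer M (flowDer X t) φ) - coeffX p φ') with hT
  obtain ⟨t, ht, hTt⟩ := exists_fixedPoint_series (fun a : Fin m →₀ ℕ => M * a.degree)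
    {t : ParamSeries m 𝕜 | p ≤ 1 → MvPowerSeries.constantCoeff t = 0} T
    (fun t ht hp => by
      have h1 := expDer_sub_self (raises_flowDer (ofParam_mul_filt_two hM hX1 ht)) hφ1
      -- Both series agree with `φ` below weight 2, so for `p ≤ 1` the correction vanishes at `λ =
      -- 0` and the condition `t(0) = 0` is preserved.
      have h2 : expDer M (flowDer X t) φ - φ' ∈ Filt M ⊤ 2 := by
        have := add_mem h1 hφ'; convert this using 1; ring
      have h3 := mem_filt_top.1 h2 ((0 : Fin m →₀ ℕ).optionElim p) (by simp; omega)
      have h4 : MvPowerSeries.constantCoeff (coeffX p (expDer M (flowDer X t) φ - φ')) = 0 :=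
        h3
      simp only [hT, ← map_sub]
      rw [map_sub, ht hp, MvPowerSeries.constantCoeff_smul, h4, smul_zero, sub_zero])
    ⟨0, fun _ => map_zero _⟩
    (fun f hf hp => by
      obtain ⟨g, hg, h⟩ := hf 1
      have := h 0 (by simp)
      exact this.trans (hg hp))
    (fun t ht t' ht' K htt' d hd => by
      have h1 : (ofParam (t - t') : FormalFamily m 𝕜) ∈ Filt M ⊤ K :=
        ofParam_mem_filt.2 fun a ha _ => by
          rw [map_sub, htt' a ha, sub_self]
      have h2 := mem_filt_top.1 (expDer_sub_expDer hM hX hφ ht ht' h1) (d.optionElim p)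
        (by rw [wt_optionElim]; omega)
      rw [map_sub, map_sub, coeff_ofParam_mul_pow, Finsupp.optionElim_apply_none, if_pos rfl,
        Finsupp.some_optionElim, MvPowerSeries.coeff_smul, map_sub, ← coeff_coeffX,
        ← coeff_coeffX] at h2
      simp only [hT, map_sub, MvPowerSeries.coeff_smul]
      field_simp
      linear_combination -h2)
  refine ⟨t, ht, ?_⟩
  have h1 : (a * α)⁻¹ • (coeffX p (expDer M (flowDer X t) φ) - coeffX p φ') = 0 := by
    have : t - (a * α)⁻¹ • (coeffX p (expDer M (flowDer X t) φ) - coeffX p φ') = t := hTt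
    simpa using this
  rw [smul_eq_zero] at h1
  exact sub_eq_zero.1 (h1.resolve_left (inv_ne_zero haα))

end Flow

/-! ### Leading terms, and restriction to `λ = 0`. -/

section Leading

variable {𝕜 : Type*} [Field 𝕜] {m : ℕ} {M k : ℕ}

lemma eq_zero_of_degree {a : Fin m →₀ ℕ} (h : a.degree = 0) : a = 0 :=
  (Finsupp.degree_eq_zero_iff a).1 h

lemma adm_y {y : ParamSeries m 𝕜} (hM : k + 2 ≤ M) (hy : MvPowerSeries.constantCoeff y = 0)
    (j : ℕ) : ofParam y * coordX ^ j ∈ (Filt M ⊤ (k + 2) : Ideal (FormalFamily m 𝕜)) := by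
  refine ofParam_mul_pow_mem_filt.2 fun a ha _ => ?_
  rcases Nat.eq_zero_or_pos a.degree with h | h
  · rw [eq_zero_of_degree h]; exact hy
  · nlinarith

/-- For `k ≥ 1` already `x^(2k+1)` has weight at least `k + 2`, so `μ(0)` is free. For `k = 0` it
must vanish. -/
lemma adm_mu {μ : ParamSeries m 𝕜} (hM : k + 2 ≤ M)
    (hμ : k = 0 → MvPowerSeries.constantCoeff μ = 0) :
    ofParam μ * coordX ^ (2 * k + 1) ∈ (Filt M ⊤ (k + 2) : Ideal (FormalFamily m 𝕜)) := by
  refine ofParam_mul_pow_mem_filt.2 fun a ha _ => ?_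
  rcases Nat.eq_zero_or_pos a.degree with h | h
  · rw [eq_zero_of_degree h]; rw [h] at ha; exact hμ (by omega)
  · nlinarith

lemma constantCoeff_eq_zero_of_filt {b : ParamSeries m 𝕜} {j K : ℕ} (hj : j < K)
    (h : ofParam b * coordX ^ j ∈ (Filt M ⊤ K : Ideal (FormalFamily m 𝕜))) :
    MvPowerSeries.constantCoeff b = 0 :=
  ofParam_mul_pow_mem_filt.1 h 0 (by simpa) (by simp)

/-- The coefficient of the monomial `x ^ j`. -/
abbrev coeffXZero (j : ℕ) (f : FormalFamily m 𝕜) : 𝕜 := coeff (Finsupp.single none j) f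

lemma coeff_atZero (f : FormalFamily m 𝕜) (j : ℕ) :
    PowerSeries.coeff j (atZero f) = coeffXZero j f := by
  rw [PowerSeries.coeff, atZero, MvPowerSeries.coeff_killCompl, Finsupp.embDomain_single]
  rfl

lemma atZero_eq_iff {f g : FormalFamily m 𝕜} :
    atZero f = atZero g ↔ ∀ d : Option (Fin m) →₀ ℕ, pdeg d = 0 → coeff d f = coeff d g := by
  constructor
  · intro h d hd
    rw [pdeg_eq_zero hd]
    have := congrArg (PowerSeries.coeff (d none)) h
    rwa [coeff_atZero, coeff_atZero] at this
  · intro h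
    ext j
    rw [coeff_atZero, coeff_atZero]
    exact h _ (by simp)

/-- Equality at `λ = 0` is the case `n = 1` of the filtration, so the general estimates apply to it.
-/
lemma atZero_eq_iff_filt {f g : FormalFamily m 𝕜} :
    atZero f = atZero g ↔ ∀ K, f - g ∈ Filt M 1 K := by
  rw [atZero_eq_iff]
  constructor
  · intro h K d _ hd
    rw [map_sub, h d (by simpa [Order.lt_one_iff] using hd), sub_self]
  · intro h d hd
    have := h (wt M d + 1) d (by omega) (by simp [hd])
    rwa [map_sub, sub_eq_zero] at this

/-- As `M ≥ p + 1`, any monomial with a parameter has weight above `p`; only the pure powers of `x`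
up to `x^p` matter. -/
lemma sub_lead_mem_filt {X : FormalFamily m 𝕜} {p : ℕ} (hM : p + 1 ≤ M)
    (h : ∀ j < p, coeffXZero j X = 0) :
    X - coeffXZero p X • coordX ^ p ∈ Filt M ⊤ (p + 1) := by
  classical
  refine mem_filt_top.2 fun d hd => ?_
  have h0 : pdeg d = 0 := by
    rcases Nat.eq_zero_or_pos (pdeg d) with h | h
    · exact h
    · rw [wt] at hd; nlinarith
  have h1 : d none < p + 1 := by rw [wt, h0] at hd; omega
  rw [pdeg_eq_zero h0, map_sub, MvPowerSeries.coeff_smul, coordX_pow, MvPowerSeries.coeff_monomial]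
  rcases Nat.lt_succ_iff_lt_or_eq.1 h1 with h2 | h2
  · rw [show coeff (Finsupp.single none (d none)) X = 0 from h _ h2,
      if_neg (fun h3 => h2.ne (Finsupp.single_injective _ h3))]; simp
  · rw [if_pos (by rw [h2]), h2]; simp

lemma coeffXZero_one_eq (φ : FormalFamily m 𝕜) : coeffXZero 1 φ =
    MvPowerSeries.constantCoeff (MvPowerSeries.pderiv 𝕜 none φ) := by
  rw [← MvPowerSeries.coeff_zero_eq_constantCoeff_apply, MvPowerSeries.coeff_pderiv]
  simp

lemma IsCoordChange.sub_mem_filt {φ : FormalFamily m 𝕜} (h : IsCoordChange φ) (hM : 2 ≤ M) :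
    φ - coeffXZero 1 φ • coordX ∈ Filt M ⊤ 2 := by
  have := sub_lead_mem_filt (M := M) (X := φ) (p := 1) hM (fun j hj => by
    obtain rfl : j = 0 := by omega
    simpa [coeffXZero] using h.1)
  rwa [pow_one] at this

lemma IsCoordChange.lead_ne_zero {φ : FormalFamily m 𝕜} (h : IsCoordChange φ) :
    coeffXZero 1 φ ≠ 0 := by
  rw [coeffXZero_one_eq]; exact h.2

lemma constantCoeff_of_filt {f : FormalFamily m 𝕜} (hf : f ∈ Filt M ⊤ 1) :
    MvPowerSeries.constantCoeff f = 0 :=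
  mem_filt_top.1 hf 0 (by simp [wt, pdeg])

lemma mem_filt_one_of_sub {φ : FormalFamily m 𝕜} {α : 𝕜}
    (h : φ - α • coordX ∈ Filt M ⊤ 2) : φ ∈ Filt M ⊤ 1 := by
  have := add_mem (filt_le h (by omega : 1 ≤ 2)) (filt_smul α coordX_mem_filt)
  simpa using this

lemma isCoordChange_of_sub {φ : FormalFamily m 𝕜} {α : 𝕜} (hα : α ≠ 0)
    (h : φ - α • coordX ∈ Filt M ⊤ 2) : IsCoordChange φ := by
  refine ⟨constantCoeff_of_filt (mem_filt_one_of_sub h), ?_⟩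
  have := constantCoeff_of_filt (pderiv_mem_filt (K := 1) h)
  rw [map_sub, Derivation.map_smul, pderiv_coordX, map_sub, MvPowerSeries.constantCoeff_smul,
    sub_eq_zero] at this
  rw [this]; simpa

lemma near_of_sub {X Y : FormalFamily m 𝕜} {p : ℕ} (hY : Y ∈ Filt M ⊤ p)
    (h : X - Y ∈ Filt M ⊤ (p + 1)) : Near M ⊤ p 1 X Y :=
  ⟨by simpa using add_mem (filt_le h (Nat.le_succ p)) hY, hY, h⟩

lemma near_denAt {s : 𝕜} {μ : ParamSeries m 𝕜} {φ : FormalFamily m 𝕜}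
    (hμ : ofParam μ * coordX ^ (2 * k + 1) ∈ (Filt M ⊤ (k + 2) : Ideal (FormalFamily m 𝕜)))
    (hφ : φ ∈ Filt M ⊤ 1) : Near M ⊤ 0 1 (denAt k s μ φ) (MvPowerSeries.C s) := by
  refine near_of_sub (by simp) ?_
  rw [denAt, add_sub_cancel_left]
  have := near_mu_mul (n := ⊤) (K := 0) (p := 0) (Near.refl 0 hμ)
    ((Near.refl 0 (filt_pow hφ k)).mono (by omega) (by omega))
  exact this.1

lemma near_numAt {y : Fin k → ParamSeries m 𝕜} {φ : FormalFamily m 𝕜} {α : 𝕜}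
    (hM : k + 2 ≤ M) (hy : ∀ j, MvPowerSeries.constantCoeff (y j) = 0)
    (hφ : φ - α • coordX ∈ Filt M ⊤ 2) :
    Near M ⊤ (k + 1) 1 (numAt k y φ) ((α • coordX) ^ (k + 1)) := by
  have h1 : Near M ⊤ 1 1 φ (α • coordX) := near_of_sub (filt_smul α coordX_mem_filt) hφ
  have h2 := (h1.pow (k + 1)).mono (p' := k + 1) (K' := 1) (by omega) (by omega)
  have h3 : Near M ⊤ (k + 1) 1 (∑ j : Fin k, ofParam (y j) * φ ^ (j : ℕ)) 0 := by
    refine near_of_sub (by simp) ?_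
    rw [sub_zero]
    refine sum_mem fun j _ => Ideal.mul_mem_right _ _ ?_
    have := adm_y (k := k) hM (hy j) 0
    simpa using this
  simpa [numAt] using h2.add h3

lemma coeffXZero_eq_of_near {X Y : FormalFamily m 𝕜} {p : ℕ} (h : Near M ⊤ p 1 X Y) :
    coeffXZero p X = coeffXZero p Y := by
  have := mem_filt_top.1 h.3 (Finsupp.single none p) (by simp)
  rwa [map_sub, sub_eq_zero] at this

lemma coeffXZero_smul_pow (a : 𝕜) (p : ℕ) :
    coeffXZero p (a • coordX ^ p : FormalFamily m 𝕜) = a := by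
  classical
  rw [coeffXZero, MvPowerSeries.coeff_smul, coordX_pow, MvPowerSeries.coeff_monomial]; simp

/-- The leading coefficients in a conjugacy to a normal form. -/
lemma lead_eq {X φ : FormalFamily m 𝕜} {a α s : 𝕜} {y : Fin k → ParamSeries m 𝕜}
    {μ : ParamSeries m 𝕜} (hM : k + 2 ≤ M) (hα : α ≠ 0)
    (hX : X - a • coordX ^ (k + 1) ∈ Filt M ⊤ (k + 2)) (hφ : φ - α • coordX ∈ Filt M ⊤ 2)
    (hy : ∀ j, MvPowerSeries.constantCoeff (y j) = 0)
    (hμ : k = 0 → MvPowerSeries.constantCoeff μ = 0)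
    (h : numAt k y φ = X * MvPowerSeries.pderiv 𝕜 none φ * denAt k s μ φ) : α ^ k = a * s := by
  have h1 := coeffXZero_eq_of_near (near_numAt hM hy hφ)
  have h2 : Near M ⊤ (k + 1) 1 X (a • coordX ^ (k + 1)) :=
    near_of_sub (filt_smul a (coordX_pow_mem_filt _)) hX
  have h3 : Near M ⊤ 0 1 (MvPowerSeries.pderiv 𝕜 none φ) (MvPowerSeries.C α) := by
    refine near_of_sub (by simp) ?_
    have := pderiv_mem_filt (K := 1) hφ
    rw [map_sub, Derivation.map_smul, pderiv_coordX] at this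
    rwa [← mul_one (MvPowerSeries.C α), ← MvPowerSeries.smul_eq_C_mul]
  have h4 := near_denAt (s := s) (adm_mu hM hμ) (mem_filt_one_of_sub hφ)
  have h5 := coeffXZero_eq_of_near (((h2.mul h3).mul h4).mono (p' := k + 1) (K' := 1) (by omega)
    (by omega))
  have e1 : (α • coordX : FormalFamily m 𝕜) ^ (k + 1) = α ^ (k + 1) • coordX ^ (k + 1) := by
    rw [smul_pow]
  have e2 : a • coordX ^ (k + 1) * MvPowerSeries.C α * MvPowerSeries.C s =
      (a * α * s) • (coordX ^ (k + 1) : FormalFamily m 𝕜) := by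
    simp only [MvPowerSeries.smul_eq_C_mul, map_mul]; ring
  rw [e1, coeffXZero_smul_pow] at h1
  rw [e2, coeffXZero_smul_pow, ← h, h1] at h5
  apply mul_right_cancel₀ hα
  rw [← pow_succ, h5]; ring

lemma IsUnfoldingOfOrder.lead {X : FormalFamily m 𝕜} (h : IsUnfoldingOfOrder k X) :
    ∃ a : 𝕜, a ≠ 0 ∧ ∀ M, k + 2 ≤ M → X - a • coordX ^ (k + 1) ∈ Filt M ⊤ (k + 2) := by
  obtain ⟨ω, hω, hX⟩ := h
  have h1 : ∀ j, coeffXZero j X = if k + 1 ≤ j then PowerSeries.coeff (j - (k + 1)) ω⁻¹ else 0 := by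
    intro j; rw [← coeff_atZero, hX, PowerSeries.coeff_X_pow_mul']
  refine ⟨coeffXZero (k + 1) X, ?_, fun M hM => sub_lead_mem_filt hM fun j hj => ?_⟩
  · rw [h1, if_pos le_rfl, Nat.sub_self, PowerSeries.coeff_zero_eq_constantCoeff_apply,
      PowerSeries.constantCoeff_inv]
    exact inv_ne_zero hω
  · rw [h1, if_neg (by omega)]

end Leading

/-! ### Conjugacies to normal forms as solutions of the equation. -/

section ConjSol

variable {𝕜 : Type*} [Field 𝕜] {m : ℕ} {M k : ℕ}

/-- The constant `s` of the denominator moves to the vector field, so the equation need only be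
solved for `s = 1`. -/
lemma mul_denAt_one {s : 𝕜} (hs : s ≠ 0) (X φ : FormalFamily m 𝕜) (μ : ParamSeries m 𝕜) :
    (s • X) * denAt k 1 (s⁻¹ • μ) φ = X * denAt k s μ φ := by
  have h : MvPowerSeries.C s * (ofParam (s⁻¹ • μ) : FormalFamily m 𝕜) = ofParam μ := by
    rw [map_smul, ← MvPowerSeries.smul_eq_C_mul, smul_smul, mul_inv_cancel₀ hs, one_smul]
  rw [denAt, denAt, MvPowerSeries.smul_eq_C_mul, map_one, ← h]; ring

lemma isSol_of_conj {X φ : FormalFamily m 𝕜} {s : 𝕜} {y : Fin k → ParamSeries m 𝕜}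
    {μ : ParamSeries m 𝕜} (hM : k + 2 ≤ M) (hs : s ≠ 0) (hφ : φ - coordX ∈ Filt M ⊤ 2)
    (hy : ∀ j, MvPowerSeries.constantCoeff (y j) = 0)
    (hμ : k = 0 → MvPowerSeries.constantCoeff μ = 0)
    (h : numAt k y φ = X * MvPowerSeries.pderiv 𝕜 none φ * denAt k s μ φ) :
    IsSol M k (s • X) (φ - coordX) y (s⁻¹ • μ) := by
  refine ⟨hφ, fun j => adm_y hM (hy j) j, adm_mu hM fun hk => ?_, ?_⟩
  · rw [MvPowerSeries.constantCoeff_smul, hμ hk, smul_zero]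
  · rw [map_sub, pderiv_coordX, add_sub_cancel, add_sub_cancel, h, mul_right_comm,
      ← mul_denAt_one hs]
    ring

lemma IsSol.conj {X v : FormalFamily m 𝕜} {s : 𝕜} {y : Fin k → ParamSeries m 𝕜}
    {μ : ParamSeries m 𝕜} (hs : s ≠ 0) (h : IsSol M k (s • X) v y (s⁻¹ • μ)) :
    (∀ j, MvPowerSeries.constantCoeff (y j) = 0) ∧
      (k = 0 → MvPowerSeries.constantCoeff μ = 0) ∧
      Conjugates (coordX + v) X (normalForm k s y μ) := by
  have hμ : k = 0 → MvPowerSeries.constantCoeff μ = 0 := fun hk => by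
    have := constantCoeff_eq_zero_of_filt (by omega) h.hμ
    rw [MvPowerSeries.constantCoeff_smul, smul_eq_zero] at this
    exact this.resolve_left (inv_ne_zero hs)
  refine ⟨fun j => constantCoeff_eq_zero_of_filt (by omega) (h.hy j), hμ, ?_⟩
  rw [conjugates_normalForm_iff hs hμ]
  refine ⟨isCoordChange_of_sub (M := M) one_ne_zero (by simpa using h.hv), ?_⟩
  rw [h.eq, map_add, pderiv_coordX, mul_right_comm, mul_denAt_one hs]
  ring

lemma smul_sub_lead {X : FormalFamily m 𝕜} {a s : 𝕜} (has : a * s = 1)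
    (hX : X - a • coordX ^ (k + 1) ∈ Filt M ⊤ (k + 2)) :
    s • X - coordX ^ (k + 1) ∈ Filt M ⊤ (k + 2) := by
  have := filt_smul s hX
  rwa [smul_sub, smul_smul, mul_comm, has, one_smul] at this

/-- Uniqueness of the normal form among the conjugacies tangent to the identity. -/
lemma conj_unique [CharZero 𝕜] {X φ φ' : FormalFamily m 𝕜} {a s s' : 𝕜}
    {y y' : Fin k → ParamSeries m 𝕜} {μ μ' : ParamSeries m 𝕜} (hM : k + 2 ≤ M) (hs : s ≠ 0)
    (ha : a ≠ 0) (hX : X - a • coordX ^ (k + 1) ∈ Filt M ⊤ (k + 2))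
    (hφ : φ - coordX ∈ Filt M ⊤ 2) (hφ' : φ' - coordX ∈ Filt M ⊤ 2)
    (hy : ∀ j, MvPowerSeries.constantCoeff (y j) = 0)
    (hμ : k = 0 → MvPowerSeries.constantCoeff μ = 0)
    (hy' : ∀ j, MvPowerSeries.constantCoeff (y' j) = 0)
    (hμ' : k = 0 → MvPowerSeries.constantCoeff μ' = 0)
    (h : numAt k y φ = X * MvPowerSeries.pderiv 𝕜 none φ * denAt k s μ φ)
    (h' : numAt k y' φ' = X * MvPowerSeries.pderiv 𝕜 none φ' * denAt k s' μ' φ') :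
    s' = s ∧ y' = y ∧ μ' = μ ∧ ∃ t : ParamSeries m 𝕜,
      (k = 0 → MvPowerSeries.constantCoeff t = 0) ∧ φ' = expDer M (flowDer X t) φ := by
  have e1 : (1 : 𝕜) ^ k = a * s := lead_eq hM one_ne_zero hX (by simpa using hφ) hy hμ h
  have e2 : (1 : 𝕜) ^ k = a * s' := lead_eq hM one_ne_zero hX (by simpa using hφ') hy' hμ' h'
  have hss : s' = s := mul_left_cancel₀ ha (by rw [← e1, ← e2])
  subst hss
  rw [one_pow] at e1
  -- The flow gives `φ` the same coefficient of `x^(k+1)` as `φ'`; this coefficient is the only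
  -- freedom in the equation, so the two solutions then coincide.
  obtain ⟨t, ht, htφ⟩ := exists_flow_time (α := 1) ha one_ne_zero (by omega : 2 ≤ M) hX
    (by simpa using hφ) (φ' := φ') (by
      have := sub_mem hφ hφ'
      rwa [sub_sub_sub_cancel_right] at this)
  have hX1 := filt_of_sub_coordX_pow hX
  have h2 := ofParam_mul_filt_two (by omega : 2 ≤ M) hX1 ht
  have h3 := conj_expDer h2 h
  have hφ1 : φ ∈ Filt M ⊤ 1 := mem_filt_one_of_sub (α := 1) (by simpa using hφ)
  have h4 : expDer M (flowDer X t) φ - coordX ∈ Filt M ⊤ 2 := by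
    have := add_mem (expDer_sub_self (raises_flowDer h2) hφ1) hφ
    convert this using 1; ring
  have s1 := isSol_of_conj hM hs h4 hy hμ h3
  have s2 := isSol_of_conj hM hs hφ' hy' hμ' h'
  have hXs := smul_sub_lead e1.symm hX
  have h5 := s2.stable (n := ⊤) s1 hXs hXs (fun K => by simp) (fun K => by
    rw [← map_sub, sub_sub_sub_cancel_right, map_sub, htφ, sub_self, map_zero]; exact zero_mem _)
  refine ⟨rfl, ?_, ?_, t, fun hk => ht (by omega), ?_⟩
  · funext j
    exact ofParam_injective (eq_of_sub_mem_filt (M := M) fun K => by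
      rw [← map_sub]; exact (h5 K).2.1 j)
  · have : s'⁻¹ • μ' = s'⁻¹ • μ := ofParam_injective (eq_of_sub_mem_filt (M := M) fun K => by
      rw [← map_sub]; exact (h5 K).2.2)
    exact smul_right_injective _ (inv_ne_zero hs) this
  · exact eq_of_sub_mem_filt (M := M) fun K => by
      have := (h5 K).1
      rwa [sub_sub_sub_cancel_right] at this

/-- Conjugacies to normal forms, and rescalings of the coordinate. -/
lemma conj_smul_iff {X φ : FormalFamily m 𝕜} {α s : 𝕜} (hα : α ≠ 0)
    (y : Fin k → ParamSeries m 𝕜) (μ : ParamSeries m 𝕜) :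
    numAt k y (α • φ) = X * MvPowerSeries.pderiv 𝕜 none (α • φ) * denAt k s μ (α • φ) ↔
      numAt k (fun j => (α ^ (j : ℕ) * (α ^ (k + 1))⁻¹) • y j) φ =
        X * MvPowerSeries.pderiv 𝕜 none φ * denAt k (s * (α ^ k)⁻¹) μ φ := by
  have e1 : numAt k y (α • φ) =
      α ^ (k + 1) • numAt k (fun j => (α ^ (j : ℕ) * (α ^ (k + 1))⁻¹) • y j) φ := by
    rw [numAt, numAt, smul_add, smul_pow, Finset.smul_sum]
    congr 1
    refine Finset.sum_congr rfl fun j _ => ?_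
    rw [map_smul, smul_mul_assoc, smul_smul, smul_pow, mul_smul_comm]
    congr 1
    field_simp
  have e2 : X * MvPowerSeries.pderiv 𝕜 none (α • φ) * denAt k s μ (α • φ) =
      α ^ (k + 1) • (X * MvPowerSeries.pderiv 𝕜 none φ * denAt k (s * (α ^ k)⁻¹) μ φ) := by
    have h : denAt k s μ (α • φ) = α ^ k • denAt k (s * (α ^ k)⁻¹) μ φ := by
      rw [denAt, denAt, smul_add, smul_pow, mul_smul_comm]
      congr 1
      rw [MvPowerSeries.smul_eq_C_mul, ← map_mul]
      congr 1
      field_simp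
    rw [h, Derivation.map_smul]
    simp only [MvPowerSeries.smul_eq_C_mul, map_pow]
    ring
  rw [e1, e2]
  exact (smul_right_injective _ (pow_ne_zero (k + 1) hα)).eq_iff

lemma conjugates_id {k : ℕ} {s : 𝕜} (hs : s ≠ 0) (y : Fin k → ParamSeries m 𝕜)
    {μ : ParamSeries m 𝕜} (hμ : k = 0 → MvPowerSeries.constantCoeff μ = 0) :
    numAt k y coordX = normalForm k s y μ * MvPowerSeries.pderiv 𝕜 none coordX *
      denAt k s μ coordX := by
  rw [pderiv_coordX, mul_one, normalForm_mul_denAt hs y hμ]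

lemma normalForm_sub_lead {s : 𝕜} (hs : s ≠ 0) {y : Fin k → ParamSeries m 𝕜}
    {μ : ParamSeries m 𝕜} (hM : k + 2 ≤ M) (hy : ∀ j, MvPowerSeries.constantCoeff (y j) = 0)
    (hμ : k = 0 → MvPowerSeries.constantCoeff μ = 0) :
    normalForm k s y μ - s⁻¹ • coordX ^ (k + 1) ∈ Filt M ⊤ (k + 2) := by
  have h0 : MvPowerSeries.constantCoeff (denAt k s μ (coordX : FormalFamily m 𝕜)) ≠ 0 := by
    rwa [constantCoeff_denAt s constantCoeff_coordX hμ]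
  have h1 := near_numAt (φ := coordX) (α := 1) hM hy (by simp)
  have h2 := (near_denAt (s := s) (adm_mu hM hμ) coordX_mem_filt).3
  have e : normalForm k s y μ - s⁻¹ • coordX ^ (k + 1) = (denAt k s μ coordX)⁻¹ *
      ((numAt k y coordX - (1 • coordX) ^ (k + 1)) -
        s⁻¹ • (coordX ^ (k + 1) * (denAt k s μ coordX - MvPowerSeries.C s))) := by
    have h3 : (denAt k s μ coordX)⁻¹ * denAt k s μ (coordX : FormalFamily m 𝕜) = 1 :=
      MvPowerSeries.inv_mul_cancel _ h0
    have h4 : MvPowerSeries.C s⁻¹ * MvPowerSeries.C s = (1 : FormalFamily m 𝕜) := by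
      rw [← map_mul, inv_mul_cancel₀ hs, map_one]
    rw [normalForm_eq]
    simp only [MvPowerSeries.smul_eq_C_mul, one_smul]
    linear_combination (MvPowerSeries.C s⁻¹ * coordX ^ (k + 1)) * h3 -
      coordX ^ (k + 1) * (denAt k s μ coordX)⁻¹ * h4
  rw [e]
  refine Ideal.mul_mem_left _ _ (sub_mem ?_ (filt_smul _ ?_))
  · have := h1.3; rwa [one_smul] at this ⊢
  · exact filt_le (filt_mul (coordX_pow_mem_filt (k + 1)) h2) (by omega)

/-- Existence of the normal form, with a prescribed coefficient of `x ^ (k + 1)`. -/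
lemma exists_conj_normalForm [CharZero 𝕜] {X : FormalFamily m 𝕜} {a s : 𝕜} (has : a * s = 1)
    (hX : X - a • coordX ^ (k + 1) ∈ Filt M ⊤ (k + 2)) :
    ∃ (φ : FormalFamily m 𝕜) (y : Fin k → ParamSeries m 𝕜) (μ : ParamSeries m 𝕜),
      φ - coordX ∈ Filt M ⊤ 2 ∧ coeffX (k + 1) (φ - coordX) = 0 ∧
      (∀ j, MvPowerSeries.constantCoeff (y j) = 0) ∧
      (k = 0 → MvPowerSeries.constantCoeff μ = 0) ∧ Conjugates φ X (normalForm k s y μ) := by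
  have hs : s ≠ 0 := right_ne_zero_of_mul_eq_one has
  obtain ⟨g, -, -, hg⟩ := exists_isSol (M := M) (b := (0 : ParamSeries m 𝕜))
    (smul_sub_lead has hX) (by simp) Set.univ trivial (fun _ _ => trivial) (fun _ _ _ => trivial)
  rw [add_sub_cancel] at hg
  have e : s⁻¹ • s • muOf k g = muOf k g := inv_smul_smul₀ hs _
  have h2 := IsSol.conj (M := M) (X := X) (v := vOf k 0 g) (y := yOf k g) (μ := s • muOf k g) hs
    (by rw [e]; exact hg)
  refine ⟨coordX + vOf k 0 g, yOf k g, s • muOf k g, by rw [add_sub_cancel_left]; exact hg.hv, ?_, h2.1, h2.2.1, h2.2.2⟩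
  rw [add_sub_cancel_left, vOf, map_add, coeffX_ofParam_mul_pow, if_pos rfl, add_zero]
  ext d
  rw [coeff_coeffX, coeff_linInv, Finsupp.optionElim_apply_none, if_pos rfl, map_zero]

end ConjSol

/-! ### Universality of the standard deformation. -/

section Universal

variable {𝕜 : Type*} [Field 𝕜] {m : ℕ} {k : ℕ}

lemma atZero_ofParam (b : ParamSeries m 𝕜) :
    atZero (ofParam b) = PowerSeries.C (MvPowerSeries.constantCoeff b) := by
  ext j
  rw [coeff_atZero, coeffXZero, coeff_ofParam, PowerSeries.coeff_C]
  by_cases h : j = 0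
  · subst h; simp
  · simp [h]

lemma atZero_coordX : atZero (coordX : FormalFamily m 𝕜) = PowerSeries.X := by
  ext j
  rw [coeff_atZero, coeffXZero, coordX, PowerSeries.coeff_X]
  classical
  rw [MvPowerSeries.coeff_X]
  exact if_congr (Finsupp.single_injective _).eq_iff rfl rfl

lemma atZero_normalForm (hk : 1 ≤ k) {s : 𝕜} (hs : s ≠ 0) {y : Fin k → ParamSeries m 𝕜}
    {μ : ParamSeries m 𝕜} (hy : ∀ j, MvPowerSeries.constantCoeff (y j) = 0) :
    atZero (normalForm k s y μ) = PowerSeries.X ^ (k + 1) * (PowerSeries.C s +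
      PowerSeries.C (MvPowerSeries.constantCoeff μ) * PowerSeries.X ^ k)⁻¹ := by
  have h := congrArg atZero (normalForm_mul_denAt hs y (μ := μ) (by omega))
  rw [PowerSeries.eq_mul_inv_iff_mul_eq]
  · simpa [numAt, denAt, ← ofParam_C, atZero_ofParam, atZero_coordX, hy] using h
  · simpa [show k ≠ 0 by omega] using hs

lemma hasSubst_induced {p : ℕ} {ψ : Fin p → ParamSeries m 𝕜} (hψ : IsParamMap ψ) :
    MvPowerSeries.HasSubst
      (fun o : Option (Fin p) => o.elim coordX (fun i => ofParam (ψ i))) := by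
  apply MvPowerSeries.hasSubst_of_constantCoeff_zero
  rintro (_ | i)
  · exact constantCoeff_coordX
  · simpa [constantCoeff_ofParam] using hψ i

/-- Substitution is a homomorphism, so it is enough to apply it to the identity (normal form) ×
(denominator) = (numerator). -/
lemma induced_standardDeformation (hk : 1 ≤ k) {s : 𝕜} (hs : s ≠ 0) (μ₀ : 𝕜)
    {ψ : Fin (k + 1) → ParamSeries m 𝕜} (hψ : IsParamMap ψ) :
    induced (standardDeformation k s μ₀) ψ =
      normalForm k s (fun j => ψ j.castSucc) (MvPowerSeries.C μ₀ + ψ (Fin.last k)) := by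
  set F := MvPowerSeries.substAlgHom (R := 𝕜) (hasSubst_induced hψ) with hF
  have hX : ∀ i, F (MvPowerSeries.X i) =
      (fun o : Option (Fin (k + 1)) => o.elim coordX (fun i => ofParam (ψ i))) i :=
    fun i => MvPowerSeries.substAlgHom_X _ i
  have hC : ∀ c : 𝕜, F (MvPowerSeries.C c) = MvPowerSeries.C c := fun c => F.commutes c
  have ho : ∀ i, F (ofParam (MvPowerSeries.X i)) = ofParam (ψ i) := fun i => by
    have : (ofParam (MvPowerSeries.X i) : FormalFamily (k + 1) 𝕜) = MvPowerSeries.X (some i) :=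
      MvPowerSeries.rename_X _ _
    rw [this, hX]; rfl
  have hx : F coordX = coordX := hX none
  have h0 : MvPowerSeries.constantCoeff (denAt k s (MvPowerSeries.C μ₀ + ψ (Fin.last k))
      (coordX : FormalFamily m 𝕜)) ≠ 0 := by
    rwa [constantCoeff_denAt s constantCoeff_coordX (by omega)]
  have h1 := congrArg F (normalForm_mul_denAt hs
    (fun j : Fin k => (MvPowerSeries.X j.castSucc : ParamSeries (k + 1) 𝕜))
    (μ := MvPowerSeries.C μ₀ + MvPowerSeries.X (Fin.last k)) (by omega))
  rw [normalForm_eq, MvPowerSeries.eq_mul_inv_iff_mul_eq h0, induced,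
    ← MvPowerSeries.substAlgHom_apply (hasSubst_induced hψ)]
  change F (normalForm k s _ _) * _ = _
  simpa [numAt, denAt, ho, hx, hC, ofParam_C] using h1

/-- Universality of the standard deformation. -/
theorem isUniversal_standardDeformation [CharZero 𝕜] (hk : 1 ≤ k) {s : 𝕜} (hs : s ≠ 0) (μ₀ : 𝕜) :
    IsUniversal (standardDeformation k s μ₀) := by
  have hstd : atZero (standardDeformation k s μ₀) = PowerSeries.X ^ (k + 1) * (PowerSeries.C s +
      PowerSeries.C μ₀ * PowerSeries.X ^ k)⁻¹ := by
    rw [standardDeformation, atZero_normalForm hk hs (by simp)]; simp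
  have hlead : ∀ {m : ℕ} (X : FormalFamily m 𝕜), atZero X = atZero (standardDeformation k s μ₀) →
      X - s⁻¹ • coordX ^ (k + 1) ∈ Filt (k + 2) ⊤ (k + 2) := by
    intro m X hX
    have h1 : atZero X = atZero (normalForm k s (fun _ => 0) (MvPowerSeries.C μ₀) :
        FormalFamily m 𝕜) := by
      rw [hX, hstd, atZero_normalForm hk hs (by simp)]; simp
    have h2 := normalForm_sub_lead (m := m) (M := k + 2) hs (y := fun _ : Fin k => 0)
      (μ := MvPowerSeries.C μ₀) le_rfl (by simp) (by omega)
    have h3 : X - normalForm k s (fun _ => 0) (MvPowerSeries.C μ₀) ∈ Filt (k + 2) ⊤ (k + 2) :=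
      mem_filt_top.2 fun d hd => by
        refine (atZero_eq_iff_filt (M := k + 2)).1 h1 (k + 2) d hd ?_
        rcases Nat.eq_zero_or_pos (pdeg d) with h | h
        · simp [h]
        · rw [wt] at hd; nlinarith
    simpa using add_mem h3 h2
  constructor
  · intro m X hX
    obtain ⟨φ, y, μ, hφ, hb, hy, hμ, hconj⟩ :=
      exists_conj_normalForm (inv_mul_cancel₀ hs) (hlead X hX)
    have hconj' := (conjugates_normalForm_iff hs hμ).1 hconj
    have h1 : atZero X = atZero (normalForm k s (fun _ => 0) (MvPowerSeries.C μ₀) :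
        FormalFamily m 𝕜) := by
      rw [hX, hstd, atZero_normalForm hk hs (by simp)]; simp
    have s1 := isSol_of_conj le_rfl hs hφ hy hμ hconj'.2
    -- The trivial solution: the identity conjugates the constant family to itself. It agrees with
    -- `φ` at `λ = 0`, as both have zero coefficient of `x^(k+1)`; this yields `φ(x;0) = x` and
    -- `μ(0) = μ₀`.
    have s2 := isSol_of_conj (M := k + 2) le_rfl hs (by simp) (by simp) (by omega)
      (conjugates_id (m := m) hs (fun _ : Fin k => 0) (μ := MvPowerSeries.C μ₀) (by omega))
    have h2 := s1.stable (n := 1) s2 (smul_sub_lead (inv_mul_cancel₀ hs) (hlead X hX))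
      (smul_sub_lead (inv_mul_cancel₀ hs) (normalForm_sub_lead hs le_rfl (by simp) (by omega)))
      (fun K => by rw [← smul_sub]; exact filt_smul _ (atZero_eq_iff_filt.1 h1 K))
      (fun K => by rw [hb]; simp)
    have hμ0 : MvPowerSeries.constantCoeff μ = μ₀ := by
      have := ofParam_mem_filt.1 (h2 1).2.2 0 (by simp) (by simp)
      rw [← smul_sub, MvPowerSeries.coeff_smul, mul_eq_zero] at this
      have := this.resolve_left (inv_ne_zero hs)
      simpa [sub_eq_zero] using this
    set ψ : Fin (k + 1) → ParamSeries m 𝕜 :=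
      Fin.snoc (α := fun _ => ParamSeries m 𝕜) y (μ - MvPowerSeries.C μ₀) with hψdef
    have hψ : IsParamMap ψ := fun i => by
      induction i using Fin.lastCases with
      | last => simp [hψdef, hμ0]
      | cast j => simp [hψdef, hy]
    have hind : induced (standardDeformation k s μ₀) ψ = normalForm k s y μ := by
      rw [induced_standardDeformation hk hs μ₀ hψ]; simp [hψdef]
    refine ⟨ψ, hψ, ?_, φ, ?_, ?_⟩
    · rw [hind, hX, hstd, atZero_normalForm hk hs hy, hμ0]
    · rwa [hind]
    · rw [← atZero_coordX (m := m)]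
      refine (atZero_eq_iff_filt (M := k + 2)).2 fun K => ?_
      simpa using (h2 K).1
  · intro m X hX ψ₁ ψ₂ hψ₁ h₁ hψ₂ h₂
    rw [induced_standardDeformation hk hs μ₀ hψ₁] at h₁
    rw [induced_standardDeformation hk hs μ₀ hψ₂] at h₂
    obtain ⟨-, φ₁, hc₁, hz₁⟩ := h₁
    obtain ⟨-, φ₂, hc₂, hz₂⟩ := h₂
    -- A coordinate that is the identity at `λ = 0` is tangent to the identity for the weights,
    -- parameters weighing at least 2; so `conj_unique` applies without homothety.
    have hz : ∀ φ : FormalFamily m 𝕜, atZero φ = PowerSeries.X →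
        φ - coordX ∈ Filt (k + 2) ⊤ 2 := fun φ hφ => mem_filt_top.2 fun d hd => by
      rw [← atZero_coordX (m := m)] at hφ
      refine (atZero_eq_iff_filt (M := k + 2)).1 hφ 2 d hd ?_
      rcases Nat.eq_zero_or_pos (pdeg d) with h | h
      · simp [h]
      · rw [wt] at hd; nlinarith
    rw [conjugates_normalForm_iff hs (by omega)] at hc₁ hc₂
    obtain ⟨-, ey, em, -⟩ := conj_unique le_rfl hs (inv_ne_zero hs) (hlead X hX) (hz _ hz₁)
      (hz _ hz₂) (fun j => hψ₁ _) (by omega) (fun j => hψ₂ _) (by omega) hc₁.2 hc₂.2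
    funext i
    induction i using Fin.lastCases with
    | last => exact (add_left_cancel em).symm
    | cast j => exact (congrFun ey j).symm

end Universal

/-! ### Formal exponentials of series in the parameters. -/

section FormalExp

variable {𝕜 : Type*} [RCLike 𝕜] {m : ℕ} {M k : ℕ}

lemma isFormalFlow_expDer {X : FormalFamily m 𝕜} {t : ParamSeries m 𝕜}
    (h : ofParam t * X ∈ Filt M ⊤ 2) : IsFormalFlow X t (expDer M (flowDer X t) coordX) := by
  intro d
  simp_rw [← iterate_flowDer]
  rw [coeff_expDer_eq]
  refine hasSum_sum_of_ne_finset_zero fun i hi => ?_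
  have := mem_filt_top.1 ((raises_flowDer h).iterate (K := 0) (mem_filt_zero coordX) i) d (by
    simp at hi; omega)
  rw [MvPowerSeries.coeff_smul, this, mul_zero]

lemma iterate_coordX_derivation (n : ℕ) :
    (fun g : FormalFamily m 𝕜 => coordX * MvPowerSeries.pderiv 𝕜 none g)^[n] coordX = coordX := by
  induction n with
  | zero => rfl
  | succ n ih => rw [Function.iterate_succ_apply', ih, pderiv_coordX, mul_one]

/-- Every series in the parameters with nonzero constant term is a formal exponential, as soon as
its constant term is an exponential. -/
lemma exists_isFormalExp {u : ParamSeries m 𝕜} {t₀ : 𝕜} (hu : MvPowerSeries.constantCoeff u ≠ 0)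
    (h0 : HasSum (fun n => t₀ ^ n / (n.factorial : 𝕜)) (MvPowerSeries.constantCoeff u)) :
    ∃ t, IsFormalExp t u := by
  set c := MvPowerSeries.constantCoeff u with hc
  -- The flow of `x ∂/∂x` at the time `τ` sends `x` to `e^τ x`. Prescribing its coefficient of `x`
  -- solves `e^τ = u / u(0)` with `τ(0) = 0`.
  obtain ⟨τ, hτ, hτu⟩ := exists_flow_time (m := m) (p := 1) (M := 2) (X := coordX) (φ := coordX)
    (φ' := ofParam (c⁻¹ • u) * coordX) (a := 1) (α := 1) one_ne_zero one_ne_zero (by omega)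
    (by simp) (by simp) (by
      rw [← neg_mem_iff, neg_sub]
      have e : ofParam (c⁻¹ • u) * coordX - coordX =
          (ofParam (c⁻¹ • u - 1) * coordX ^ 1 : FormalFamily m 𝕜) := by
        rw [map_sub, map_one]; ring
      rw [e]
      exact adm_y (k := 0) le_rfl (by
        rw [map_sub, MvPowerSeries.constantCoeff_smul, ← hc, smul_eq_mul, inv_mul_cancel₀ hu]; simp) 1)
  have hτ0 := hτ le_rfl
  have hr := raises_flowDer (ofParam_mul_filt_two (M := 2) (p := 1) (X := coordX) (by omega)
    (by simpa using coordX_mem_filt) hτ)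
  have hiter : ∀ n, (flowDer (coordX : FormalFamily m 𝕜) τ)^[n] coordX =
      ofParam (τ ^ n) * coordX ^ 1 := fun n => by
    rw [iterate_flowDer, iterate_coordX_derivation, map_pow, pow_one]
  refine ⟨MvPowerSeries.C t₀ + τ, fun d => ?_⟩
  have hB0 : ∀ n, wt 2 (d.optionElim 1) + 1 ≤ n → coeff d (τ ^ n) = 0 := fun n hn => by
    have := mem_filt_top.1 (hr.iterate (K := 0) (mem_filt_zero coordX) n) (d.optionElim 1)
      (by omega)
    rw [hiter, coeff_ofParam_mul_pow] at this
    simpa using this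
  set A : ℕ → 𝕜 := fun n => t₀ ^ n / (n.factorial : 𝕜)
  set B : ℕ → 𝕜 := fun n => coeff d (τ ^ n) / (n.factorial : 𝕜) with hB
  have hBsum : HasSum B (coeff d (c⁻¹ • u)) := by
    have h1 : coeff d (c⁻¹ • u) =
        ∑ n ∈ Finset.range (wt 2 (d.optionElim 1) + 1), B n := by
      have h2 := congrArg (coeff d) hτu
      rw [coeff_coeffX, coeff_expDer_eq] at h2
      simp_rw [hiter] at h2
      have h3 : coeffX 1 (ofParam (c⁻¹ • u) * coordX : FormalFamily m 𝕜) = c⁻¹ • u := by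
        have := coeffX_ofParam_mul_pow (𝕜 := 𝕜) (m := m) (c⁻¹ • u) 1 1
        simpa using this
      rw [h3] at h2
      rw [← h2]
      refine Finset.sum_congr rfl fun n _ => ?_
      rw [MvPowerSeries.coeff_smul, coeff_ofParam_mul_pow, Finsupp.optionElim_apply_none,
        if_pos rfl, Finsupp.some_optionElim, hB]
      ring
    rw [h1]
    refine hasSum_sum_of_ne_finset_zero fun n hn => ?_
    rw [hB]; dsimp only
    rw [hB0 n (by simpa using hn), zero_div]
  -- The series of `exp(t₀ + τ)` is the Cauchy product of the scalar series `exp t₀` with the series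
  -- of `exp τ`, which is a finite sum in each coefficient.
  have hAn : Summable fun n => ‖A n‖ := NormedSpace.norm_expSeries_div_summable t₀
  have hBn : Summable fun n => ‖B n‖ := hBsum.summable.norm
  have h1 := (summable_norm_sum_mul_antidiagonal_of_summable_norm hAn hBn).of_norm.hasSum
  rw [← tsum_mul_tsum_eq_tsum_sum_antidiagonal_of_summable_norm hAn hBn, h0.tsum_eq,
    hBsum.tsum_eq, MvPowerSeries.coeff_smul, mul_inv_cancel_left₀ hu] at h1
  have h2 : (fun n => coeff d (((n.factorial : 𝕜)⁻¹) • (MvPowerSeries.C t₀ + τ) ^ n)) =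
      fun n => ∑ kl ∈ Finset.HasAntidiagonal.antidiagonal n, A kl.1 * B kl.2 := by
    funext n
    rw [MvPowerSeries.coeff_smul, (Commute.all (MvPowerSeries.C t₀) τ).add_pow', map_sum,
      Finset.mul_sum]
    refine Finset.sum_congr rfl fun p hp => ?_
    have hp' := Finset.HasAntidiagonal.mem_antidiagonal.1 hp
    rw [map_nsmul, ← map_pow, MvPowerSeries.coeff_C_mul, nsmul_eq_mul]
    have hn : (n.factorial : 𝕜) ≠ 0 := by exact_mod_cast n.factorial_ne_zero
    have hp1 : (p.1.factorial : 𝕜) ≠ 0 := by exact_mod_cast p.1.factorial_ne_zero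
    have hp2 : (p.2.factorial : 𝕜) ≠ 0 := by exact_mod_cast p.2.factorial_ne_zero
    have hch : (n.choose p.1 : 𝕜) * p.1.factorial * p.2.factorial = n.factorial := by
      have := Nat.choose_mul_factorial_mul_factorial (n := n) (k := p.1) (by omega)
      rw [show n - p.1 = p.2 by omega] at this
      exact_mod_cast this
    simp only [A, B]
    field_simp
    linear_combination (t₀ ^ p.1 * coeff d (τ ^ p.2)) * hch
  rw [h2]
  exact h1

end FormalExp

/-! ### Taylor expansion in `x`, and the case `k = 0`. -/

section LinearCase

variable {𝕜 : Type*} [Field 𝕜] {m : ℕ}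

/-- A finite expansion with a remainder divisible by `x^J` replaces infinite sums: at a given weight
the remainder is invisible. -/
lemma exists_expansion (f : FormalFamily m 𝕜) (J : ℕ) :
    ∃ h, f = ∑ i ∈ Finset.range J, ofParam (coeffX i f) * coordX ^ i + h * coordX ^ J := by
  obtain ⟨h, hh⟩ : ∃ h : FormalFamily m 𝕜, ∀ d, coeff d h = coeff (d + Finsupp.single none J) f :=
    ⟨fun d => coeff (d + Finsupp.single none J) f, fun d => rfl⟩
  refine ⟨h, ?_⟩
  ext d
  rw [map_add, map_sum, coeff_mul_coordX_pow]
  simp_rw [coeff_ofParam_mul_pow]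
  by_cases hd : d none < J
  · rw [Finset.sum_eq_single (d none), if_pos rfl, if_neg (by omega), add_zero, coeff_coeffX,
      Finsupp.optionElim_some]
    · intro i _ hi; exact if_neg (Ne.symm hi)
    · intro h; exact absurd (Finset.mem_range.2 hd) h
  · rw [Finset.sum_eq_zero, zero_add, if_pos (by omega)]
    · have : d - Finsupp.single none J + Finsupp.single none J = d :=
        tsub_add_cancel_of_le (by simpa [Finsupp.single_le_iff] using hd)
      rw [hh, this]
    · intro i hi; rw [if_neg]; have := Finset.mem_range.1 hi; omega

lemma coeffX_mul_pow_of_lt (h : FormalFamily m 𝕜) {j J : ℕ} (hj : j < J) :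
    coeffX j (h * coordX ^ J) = 0 := by
  ext a
  rw [coeff_coeffX, coeff_mul_coordX_pow, Finsupp.optionElim_apply_none, if_neg (by omega),
    map_zero]

lemma coeffX_ofParam_mul (b : ParamSeries m 𝕜) (f : FormalFamily m 𝕜) (j : ℕ) :
    coeffX j (ofParam b * f) = b * coeffX j f := by
  obtain ⟨h, hf⟩ := exists_expansion f (j + 1)
  have e : ofParam b * f = ∑ i ∈ Finset.range (j + 1), ofParam (b * coeffX i f) * coordX ^ i +
      (ofParam b * h) * coordX ^ (j + 1) := by
    conv_lhs => rw [hf]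
    rw [mul_add, Finset.mul_sum, mul_assoc]
    congr 1
    exact Finset.sum_congr rfl fun i _ => by rw [map_mul, mul_assoc]
  rw [e, map_add, map_sum, coeffX_mul_pow_of_lt _ (Nat.lt_succ_self j), add_zero]
  simp only [coeffX_ofParam_mul_pow]
  simp

lemma coeffX_coordX_mul_pderiv (f : FormalFamily m 𝕜) (j : ℕ) :
    coeffX j (coordX * MvPowerSeries.pderiv 𝕜 none f) = (j : 𝕜) • coeffX j f := by
  ext a
  rw [coeff_coeffX, mul_comm, ← pow_one coordX, coeff_mul_coordX_pow, MvPowerSeries.coeff_smul,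
    coeff_coeffX, Finsupp.optionElim_apply_none]
  rcases Nat.eq_zero_or_pos j with rfl | hj
  · simp
  · have e : a.optionElim j - Finsupp.single none 1 + Finsupp.single none 1 = a.optionElim j :=
      tsub_add_cancel_of_le (by
        rw [Finsupp.single_le_iff, Finsupp.optionElim_apply_none]; exact hj)
    rw [if_pos (by omega), MvPowerSeries.coeff_pderiv, e]
    have : ((a.optionElim j - Finsupp.single none 1 : Option (Fin m) →₀ ℕ) none) = j - 1 := by simp
    rw [this, Nat.cast_sub hj]
    push_cast; ring

lemma ext_coeffX {f g : FormalFamily m 𝕜} (h : ∀ j, coeffX j f = coeffX j g) : f = g := by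
  ext d
  have := congrArg (coeff d.some) (h (d none))
  rwa [coeff_coeffX, coeff_coeffX, Finsupp.optionElim_some] at this

/-- Conjugacies between linear families are linear. -/
lemma conjugates_linearForm [CharZero 𝕜] {c c' : ParamSeries m 𝕜}
    (hc : MvPowerSeries.constantCoeff c ≠ 0) {φ : FormalFamily m 𝕜}
    (h : Conjugates φ (linearForm c) (linearForm c')) :
    c' = c ∧ φ = ofParam (coeffX 1 φ) * coordX ∧
      MvPowerSeries.constantCoeff (coeffX 1 φ) ≠ 0 := by
  obtain ⟨hφ, h⟩ := h
  rw [linearForm, linearForm, ← compHom_apply φ hφ.1, map_mul, compHom_ofParam, compHom_coordX,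
    mul_assoc] at h
  -- Coefficients of `x^j` in `c' φ = c x φ'`. The case `j = 1` gives `c' = c`, and then `(j - 1)
  -- φ_j = 0` kills all the others.
  have h1 : ∀ j, c' * coeffX j φ = c * ((j : 𝕜) • coeffX j φ) := fun j => by
    rw [← coeffX_ofParam_mul, h, coeffX_ofParam_mul, coeffX_coordX_mul_pderiv]
  have h2 : MvPowerSeries.constantCoeff (coeffX 1 φ) ≠ 0 := by
    have := hφ.lead_ne_zero
    rwa [coeffXZero, ← Finsupp.optionElim_zero, ← coeff_coeffX] at this
  have h3 : c' = c := by
    have := h1 1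
    rw [Nat.cast_one, one_smul] at this
    exact mul_right_cancel₀ (fun h0 => h2 (by rw [h0, map_zero])) this
  refine ⟨h3, ext_coeffX fun j => ?_, h2⟩
  have h4 := coeffX_ofParam_mul_pow (𝕜 := 𝕜) (coeffX 1 φ) j 1
  rw [pow_one] at h4
  rw [h4]
  split_ifs with hj
  · rw [hj]
  · have h5 := h1 j
    rw [h3] at h5
    have h6 := mul_left_cancel₀ (fun h0 => hc (by rw [h0, map_zero])) h5
    have h7 : ((j : 𝕜) - 1) • coeffX j φ = 0 := by rw [sub_smul, one_smul, ← h6, sub_self]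
    refine (smul_eq_zero.1 h7).resolve_left ?_
    exact sub_ne_zero.2 (by exact_mod_cast hj)

lemma normalForm_zero (s : 𝕜) (y : Fin 0 → ParamSeries m 𝕜) (μ : ParamSeries m 𝕜)
    (hs : s ≠ 0) (hμ : MvPowerSeries.constantCoeff μ = 0) :
    normalForm 0 s y μ = linearForm (MvPowerSeries.C s + μ)⁻¹ := by
  have h1 : (MvPowerSeries.C s + μ)⁻¹ * (MvPowerSeries.C s + μ) = 1 :=
    MvPowerSeries.inv_mul_cancel _ (by simpa [hμ])
  have h0 : MvPowerSeries.constantCoeff (denAt 0 s μ (coordX : FormalFamily m 𝕜)) ≠ 0 := by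
    rwa [constantCoeff_denAt s constantCoeff_coordX (fun _ => hμ)]
  symm
  rw [normalForm_eq, MvPowerSeries.eq_mul_inv_iff_mul_eq h0, linearForm, denAt, ← ofParam_C,
    pow_zero, mul_one, ← map_add, mul_right_comm, ← map_mul, h1]
  simp [numAt]

/-- For `k = 0` the general normal form is `x / (s + μ)`, already linear. With `s = a⁻¹` no
rescaling is needed, so no root is extracted and the field is arbitrary of characteristic zero. -/
lemma exists_conj_linearForm [CharZero 𝕜] {X : FormalFamily m 𝕜} (h : IsUnfoldingOfOrder 0 X) :
    ∃ c : ParamSeries m 𝕜, FormallyConjugate X (linearForm c) := by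
  obtain ⟨a, ha, hX⟩ := h.lead
  obtain ⟨φ, y, μ, -, -, -, hμ, hc⟩ := exists_conj_normalForm (mul_inv_cancel₀ ha) (hX 2 le_rfl)
  rw [normalForm_zero _ _ _ (inv_ne_zero ha) (hμ rfl)] at hc
  exact ⟨_, φ, hc⟩

end LinearCase

/-! ### Homotheties between normal forms. -/

section Rotations

variable {𝕜 : Type*} [Field 𝕜] {m : ℕ} {k : ℕ}

/-- Conjugacies between normal forms are compositions of homotheties and flows. -/
lemma conj_normalForms [CharZero 𝕜] (hk : 1 ≤ k) {s s' : 𝕜} (hs : s ≠ 0) (hs' : s' ≠ 0)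
    {y y' : Fin k → ParamSeries m 𝕜} {μ μ' : ParamSeries m 𝕜}
    (hy : ∀ j, MvPowerSeries.constantCoeff (y j) = 0)
    (hy' : ∀ j, MvPowerSeries.constantCoeff (y' j) = 0) {φ : FormalFamily m 𝕜}
    (h : Conjugates φ (normalForm k s y μ) (normalForm k s' y' μ')) :
    ∃ α : 𝕜, α ≠ 0 ∧ s' = s * α ^ k ∧ μ' = μ ∧
      (∀ j : Fin k, α ^ (j : ℕ) • y' j = α ^ (k + 1) • y j) ∧
      ∃ t : ParamSeries m 𝕜, ofParam t * normalForm k s y μ ∈ Filt (k + 2) ⊤ 2 ∧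
        φ = α • expDer (k + 2) (flowDer (normalForm k s y μ) t) coordX := by
  have hα := h.1.lead_ne_zero
  have hφ := h.1.sub_mem_filt (M := k + 2) (by omega)
  generalize coeffXZero 1 φ = α at hα hφ
  rw [conjugates_normalForm_iff hs' (by omega)] at h
  have h2 := h.2
  -- Without its linear factor, `ψ` is tangent to the identity and leads to a rescaled normal form.
  -- The identity is another conjugacy of the same family to a normal form, so `conj_unique`
  -- compares the two.
  obtain ⟨ψ, rfl⟩ : ∃ ψ, φ = α • ψ := ⟨α⁻¹ • φ, (smul_inv_smul₀ hα φ).symm⟩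
  rw [conj_smul_iff hα] at h2
  have hψ : ψ - coordX ∈ Filt (k + 2) ⊤ 2 := by
    have := filt_smul α⁻¹ hφ
    rwa [← smul_sub, inv_smul_smul₀ hα] at this
  have hX := normalForm_sub_lead (M := k + 2) hs le_rfl hy (μ := μ) (by omega)
  obtain ⟨e1, e2, e3, t, -, e4⟩ := conj_unique le_rfl hs (inv_ne_zero hs) hX (by simp) hψ hy
    (by omega) (fun j => by rw [MvPowerSeries.constantCoeff_smul, hy', smul_zero]) (by omega)
    (conjugates_id hs y (by omega)) h2
  have hαk := pow_ne_zero k hα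
  refine ⟨α, hα, ?_, e3, fun j => ?_, t, ?_, by rw [e4]⟩
  · rw [← e1]; field_simp
  · rw [← e2]; dsimp only
    rw [smul_smul]; congr 1
    field_simp
  · exact ofParam_mul_filt_two (p := k + 1) (by omega) (filt_of_sub_coordX_pow hX) (by omega)

lemma conj_of_rotation (hk : 1 ≤ k) {s α : 𝕜} (hs : s ≠ 0) (hα : α ≠ 0)
    {y y' : Fin k → ParamSeries m 𝕜} {μ : ParamSeries m 𝕜} {X φ : FormalFamily m 𝕜}
    (hφ : Conjugates φ X (normalForm k s y μ))
    (hyy : ∀ j : Fin k, α ^ (j : ℕ) • y' j = α ^ (k + 1) • y j) :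
    Conjugates (α • φ) X (normalForm k (s * α ^ k) y' μ) := by
  have hαk := pow_ne_zero k hα
  have h1 := hφ.1
  rw [conjugates_normalForm_iff hs (by omega)] at hφ
  rw [conjugates_normalForm_iff (mul_ne_zero hs hαk) (by omega)]
  refine ⟨⟨by rw [MvPowerSeries.constantCoeff_smul, h1.1, smul_zero], ?_⟩, ?_⟩
  · rw [Derivation.map_smul, MvPowerSeries.constantCoeff_smul]
    exact smul_ne_zero hα h1.2
  · rw [conj_smul_iff hα, mul_inv_cancel_right₀ hαk]
    have : (fun j : Fin k => (α ^ (j : ℕ) * (α ^ (k + 1))⁻¹) • y' j) = y := by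
      funext j
      rw [mul_comm, mul_smul, hyy, inv_smul_smul₀ (pow_ne_zero _ hα)]
    rw [this]; exact hφ.2

lemma conjugates_refl_normalForm {s : 𝕜} (hs : s ≠ 0) (hk : 1 ≤ k)
    (y : Fin k → ParamSeries m 𝕜) (μ : ParamSeries m 𝕜) :
    Conjugates coordX (normalForm k s y μ) (normalForm k s y μ) :=
  (conjugates_normalForm_iff hs (by omega)).2
    ⟨isCoordChange_of_sub (M := 1) (one_ne_zero : (1 : 𝕜) ≠ 0) (by simp),
      conjugates_id hs y (by omega)⟩

/-- Existence of the normal form, with a prescribed constant in the denominator. -/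
lemma exists_conj_normalForm_scaled [CharZero 𝕜] (hk : 1 ≤ k) {X : FormalFamily m 𝕜}
    {a s α : 𝕜} (ha : a ≠ 0) (hα : α ≠ 0) (hs : α ^ k = a * s)
    (hX : X - a • coordX ^ (k + 1) ∈ Filt (k + 2) ⊤ (k + 2)) :
    ∃ (φ : FormalFamily m 𝕜) (y : Fin k → ParamSeries m 𝕜) (μ : ParamSeries m 𝕜),
      (∀ j, MvPowerSeries.constantCoeff (y j) = 0) ∧ Conjugates φ X (normalForm k s y μ) := by
  obtain ⟨φ, y, μ, -, -, hy, -, hc⟩ := exists_conj_normalForm (mul_inv_cancel₀ ha) hX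
  have := conj_of_rotation hk (inv_ne_zero ha) hα
    (y' := fun j => ((α ^ (j : ℕ))⁻¹ * α ^ (k + 1)) • y j) hc (fun j => by
      rw [smul_smul, mul_inv_cancel_left₀ (pow_ne_zero _ hα)])
  rw [hs, inv_mul_cancel_left₀ ha] at this
  exact ⟨_, _, μ, fun j => by rw [MvPowerSeries.constantCoeff_smul, hy, smul_zero], this⟩

end Rotations

/-! ### Uniqueness over `ℂ`. -/

section ComplexCase

variable {m k : ℕ}

lemma uniqueness_complex (hk : 1 ≤ k) (y y' : Fin k → ParamSeries m ℂ) (μ μ' : ParamSeries m ℂ)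
    (hy : ∀ j, MvPowerSeries.constantCoeff (y j) = 0)
    (hy' : ∀ j, MvPowerSeries.constantCoeff (y' j) = 0) :
    (FormallyConjugate (normalForm k 1 y μ) (normalForm k 1 y' μ') ↔
        μ' = μ ∧ ∃ l : Fin k, ∀ j : Fin k, y' j =
          Complex.exp (-(2 * Real.pi * Complex.I * (((j : ℕ) : ℂ) - 1) * ((l : ℕ) : ℂ) / k)) •
            y j) ∧
      ∀ φ : FormalFamily m ℂ, Conjugates φ (normalForm k 1 y μ) (normalForm k 1 y' μ') →
        ∃ (l : Fin k) (t : ParamSeries m ℂ) (F : FormalFamily m ℂ),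
          (∀ j : Fin k, y' j =
            Complex.exp (-(2 * Real.pi * Complex.I * (((j : ℕ) : ℂ) - 1) * ((l : ℕ) : ℂ) / k)) •
              y j) ∧
          IsFormalFlow (normalForm k 1 y μ) t F ∧
          φ = Complex.exp (2 * Real.pi * Complex.I * ((l : ℕ) : ℂ) / k) • F := by
  have hk0 : (k : ℂ) ≠ 0 := by exact_mod_cast (by omega : k ≠ 0)
  -- For a `k`-th root of unity `α` one has `α^(k+1) = α`, so the relation `α^j y'_j = α^(k+1) y_j`
  -- becomes multiplication by `α^(1-j)`.
  have hrot : ∀ (l : ℕ) (j : ℕ),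
      Complex.exp (2 * Real.pi * Complex.I * l / k) ^ j *
        Complex.exp (-(2 * Real.pi * Complex.I * ((j : ℂ) - 1) * l / k)) =
      Complex.exp (2 * Real.pi * Complex.I * l / k) ^ (k + 1) := by
    intro l j
    have h1 : Complex.exp (2 * Real.pi * Complex.I * l / k) ^ k = 1 := by
      rw [← Complex.exp_nat_mul, mul_div_cancel₀ _ hk0, mul_comm]
      exact Complex.exp_nat_mul_two_pi_mul_I l
    rw [pow_succ, h1, one_mul, ← Complex.exp_nat_mul, ← Complex.exp_add]
    congr 1; field_simp; ring
  have key : ∀ φ : FormalFamily m ℂ,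
      Conjugates φ (normalForm k 1 y μ) (normalForm k 1 y' μ') → μ' = μ ∧
        ∃ (l : Fin k) (t : ParamSeries m ℂ) (F : FormalFamily m ℂ),
          (∀ j : Fin k, y' j =
            Complex.exp (-(2 * Real.pi * Complex.I * (((j : ℕ) : ℂ) - 1) * ((l : ℕ) : ℂ) / k)) •
              y j) ∧
          IsFormalFlow (normalForm k 1 y μ) t F ∧
          φ = Complex.exp (2 * Real.pi * Complex.I * ((l : ℕ) : ℂ) / k) • F := by
    intro φ hφ
    obtain ⟨α, hα, hαk, e, hyy, t, ht, hφt⟩ := conj_normalForms hk one_ne_zero one_ne_zero hy hy' hφ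
    rw [one_mul] at hαk
    have : NeZero k := ⟨by omega⟩
    obtain ⟨l, hl, rfl⟩ :=
      (Complex.isPrimitiveRoot_exp k (by omega)).eq_pow_of_pow_eq_one hαk.symm
    have hl' : Complex.exp (2 * Real.pi * Complex.I / k) ^ l =
        Complex.exp (2 * Real.pi * Complex.I * l / k) := by
      rw [← Complex.exp_nat_mul]; congr 1; ring
    rw [hl'] at hα hyy hφt
    refine ⟨e, ⟨l, hl⟩, t, _, fun j => ?_, isFormalFlow_expDer ht, hφt⟩
    apply smul_right_injective _ (pow_ne_zero (j : ℕ) hα)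
    dsimp only
    rw [hyy, smul_smul, hrot]
  refine ⟨⟨fun ⟨φ, hφ⟩ => ?_, ?_⟩, fun φ hφ => (key φ hφ).2⟩
  · obtain ⟨e, l, _, _, h, _⟩ := key φ hφ
    exact ⟨e, l, h⟩
  · rintro ⟨rfl, l, h⟩
    have h2 : Complex.exp (2 * Real.pi * Complex.I * ((l : ℕ) : ℂ) / k) ^ k = 1 := by
      rw [← Complex.exp_nat_mul, mul_div_cancel₀ _ hk0, mul_comm]
      exact Complex.exp_nat_mul_two_pi_mul_I l
    have := conj_of_rotation (m := m) hk one_ne_zero (Complex.exp_ne_zero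
      (2 * Real.pi * Complex.I * ((l : ℕ) : ℂ) / k)) (y' := y')
      (conjugates_refl_normalForm one_ne_zero hk y μ') (fun j => by
        rw [h, smul_smul, hrot])
    rw [h2, one_mul] at this
    exact ⟨_, this⟩

lemma linear_uniqueness_complex (c c' : ParamSeries m ℂ)
    (hc : MvPowerSeries.constantCoeff c ≠ 0) (φ : FormalFamily m ℂ)
    (h : Conjugates φ (linearForm c) (linearForm c')) :
    c' = c ∧ ∃ t e : ParamSeries m ℂ, IsFormalExp t e ∧ φ = ofParam e * coordX := by
  obtain ⟨h1, h2, h3⟩ := conjugates_linearForm hc h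
  obtain ⟨t, ht⟩ := exists_isFormalExp (t₀ := Complex.log (MvPowerSeries.constantCoeff
    (coeffX 1 φ))) h3 (by
      have := NormedSpace.expSeries_div_hasSum_exp
        (Complex.log (MvPowerSeries.constantCoeff (coeffX 1 φ)))
      rwa [← Complex.exp_eq_exp_ℂ, Complex.exp_log h3] at this)
  exact ⟨h1, t, _, ht, h2⟩

end ComplexCase

/-! ### Uniqueness over `ℝ`, and real rescaling. -/

section RealCase

variable {m k : ℕ}

lemma linear_uniqueness_real (c c' : ParamSeries m ℝ)
    (hc : MvPowerSeries.constantCoeff c ≠ 0) (φ : FormalFamily m ℝ)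
    (h : Conjugates φ (linearForm c) (linearForm c')) :
    c' = c ∧ ∃ (δ : ℝ) (t e : ParamSeries m ℝ), (δ = 1 ∨ δ = -1) ∧ IsFormalExp t e ∧
      φ = δ • (ofParam e * coordX) := by
  obtain ⟨h1, h2, h3⟩ := conjugates_linearForm hc h
  have key : ∀ δ : ℝ, δ * δ = 1 → 0 < δ * MvPowerSeries.constantCoeff (coeffX 1 φ) →
      ∃ t e : ParamSeries m ℝ, IsFormalExp t e ∧ φ = δ • (ofParam e * coordX) := by
    intro δ hδ hpos
    have e1 : MvPowerSeries.constantCoeff (δ • coeffX 1 φ) =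
        δ * MvPowerSeries.constantCoeff (coeffX 1 φ) := by
      rw [MvPowerSeries.constantCoeff_smul, smul_eq_mul]
    obtain ⟨t, ht⟩ := exists_isFormalExp (u := δ • coeffX 1 φ)
      (t₀ := Real.log (δ * MvPowerSeries.constantCoeff (coeffX 1 φ))) (by rw [e1]; exact hpos.ne')
      (by
        have := NormedSpace.expSeries_div_hasSum_exp
          (Real.log (δ * MvPowerSeries.constantCoeff (coeffX 1 φ)))
        rwa [← Real.exp_eq_exp_ℝ, Real.exp_log hpos, ← e1] at this)
    refine ⟨t, _, ht, ?_⟩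
    rw [map_smul, smul_mul_assoc, smul_smul, hδ, one_smul, ← h2]
  refine ⟨h1, ?_⟩
  rcases lt_or_gt_of_ne h3 with hn | hp
  · obtain ⟨t, e, h4, h5⟩ := key (-1) (by norm_num) (by linarith)
    exact ⟨-1, t, e, Or.inr rfl, h4, h5⟩
  · obtain ⟨t, e, h4, h5⟩ := key 1 (by norm_num) (by linarith)
    exact ⟨1, t, e, Or.inl rfl, h4, h5⟩

lemma sign_pow_ne_zero {ε : ℝ} (h : ε = 1 ∨ ε = -1) (n : ℕ) : ε ^ n ≠ 0 := by
  rcases h with rfl | rfl <;> simp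

lemma uniqueness_real (hk : 1 ≤ k) (ε ε' : ℝ) (y y' : Fin k → ParamSeries m ℝ)
    (μ μ' : ParamSeries m ℝ) (hε : ε = 1 ∨ ε = -1) (hε' : ε' = 1 ∨ ε' = -1)
    (hy : ∀ j, MvPowerSeries.constantCoeff (y j) = 0)
    (hy' : ∀ j, MvPowerSeries.constantCoeff (y' j) = 0) :
    (FormallyConjugate (normalForm k (ε ^ (k + 1)) y μ)
          (normalForm k (ε' ^ (k + 1)) y' μ') ↔
        ε' ^ (k + 1) = ε ^ (k + 1) ∧ μ' = μ ∧
          ∃ ζ : ℝ, (ζ = 1 ∨ (Even k ∧ ζ = -1)) ∧ ∀ j : Fin k, y' j = ζ ^ (1 - ((j : ℕ) : ℤ)) • y j) ∧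
      ∀ φ : FormalFamily m ℝ,
        Conjugates φ (normalForm k (ε ^ (k + 1)) y μ) (normalForm k (ε' ^ (k + 1)) y' μ') →
        ∃ (ζ : ℝ) (t : ParamSeries m ℝ) (F : FormalFamily m ℝ),
          (ζ = 1 ∨ (Even k ∧ ζ = -1)) ∧
          (∀ j : Fin k, y' j = ζ ^ (1 - ((j : ℕ) : ℤ)) • y j) ∧
          IsFormalFlow (normalForm k (ε ^ (k + 1)) y μ) t F ∧
          φ = ζ • F := by
  have hs := sign_pow_ne_zero hε (k + 1)
  have hs' := sign_pow_ne_zero hε' (k + 1)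
  have hrot : ∀ ζ : ℝ, ζ ≠ 0 → ζ ^ k = 1 → ∀ j : ℕ,
      ζ ^ j * ζ ^ (1 - (j : ℤ)) = ζ ^ (k + 1) := fun ζ h0 h1 j => by
    rw [zpow_sub₀ h0, zpow_one, zpow_natCast, pow_succ, h1]
    field_simp
  have hζk : ∀ ζ : ℝ, (ζ = 1 ∨ (Even k ∧ ζ = -1)) → ζ ≠ 0 ∧ ζ ^ k = 1 := by
    rintro ζ (rfl | ⟨h, rfl⟩)
    · simp
    · exact ⟨by norm_num, h.neg_one_pow⟩
  have key : ∀ φ : FormalFamily m ℝ,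
      Conjugates φ (normalForm k (ε ^ (k + 1)) y μ) (normalForm k (ε' ^ (k + 1)) y' μ') →
        ε' ^ (k + 1) = ε ^ (k + 1) ∧ μ' = μ ∧
        ∃ (ζ : ℝ) (t : ParamSeries m ℝ) (F : FormalFamily m ℝ),
          (ζ = 1 ∨ (Even k ∧ ζ = -1)) ∧
          (∀ j : Fin k, y' j = ζ ^ (1 - ((j : ℕ) : ℤ)) • y j) ∧
          IsFormalFlow (normalForm k (ε ^ (k + 1)) y μ) t F ∧
          φ = ζ • F := by
    intro φ hφ
    obtain ⟨α, hα, hαk, e, hyy, t, ht, hφt⟩ := conj_normalForms hk hs hs' hy hy' hφ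
    have hα1 : α = 1 ∨ (Even k ∧ α = -1) := by
      -- For `k` even, `α^k` is positive and of absolute value 1. For `k` odd, both signs `ε^(k+1)`
      -- and `ε'^(k+1)` are 1, and 1 has a single real `k`-th root.
      rcases Nat.even_or_odd k with he | ho
      · have h1 : α ^ k = 1 := by
          have h2 : 0 < α ^ k := he.pow_pos hα
          have h3 : |ε' ^ (k + 1)| = |ε ^ (k + 1)| * |α ^ k| := by rw [hαk, abs_mul]
          have h4 : ∀ δ : ℝ, (δ = 1 ∨ δ = -1) → |δ ^ (k + 1)| = 1 := by
            rintro δ (rfl | rfl) <;> simp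
          rw [h4 _ hε, h4 _ hε', one_mul, abs_of_pos h2] at h3
          exact h3.symm
        rcases (pow_eq_one_iff_cases.1 h1) with h | h | h
        · omega
        · exact Or.inl h
        · exact Or.inr ⟨he, h.1⟩
      · have h4 : ∀ δ : ℝ, (δ = 1 ∨ δ = -1) → δ ^ (k + 1) = 1 := by
          rintro δ (rfl | rfl)
          · simp
          · exact (ho.add_odd odd_one).neg_one_pow
        rw [h4 _ hε, h4 _ hε', one_mul] at hαk
        rcases (pow_eq_one_iff_cases.1 hαk.symm) with h | h | h
        · omega
        · exact Or.inl h
        · exact absurd h.2 (Nat.not_even_iff_odd.2 ho)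
    obtain ⟨-, hk1⟩ := hζk α hα1
    rw [hk1, mul_one] at hαk
    refine ⟨hαk, e, α, t, _, hα1, fun j => ?_, isFormalFlow_expDer ht, hφt⟩
    apply smul_right_injective _ (pow_ne_zero (j : ℕ) hα)
    dsimp only
    rw [hyy, smul_smul, hrot α hα hk1]
  refine ⟨⟨fun ⟨φ, hφ⟩ => ?_, ?_⟩, fun φ hφ => (key φ hφ).2.2⟩
  · obtain ⟨e, e', ζ, _, _, h, h', _⟩ := key φ hφ
    exact ⟨e, e', ζ, h, h'⟩
  · rintro ⟨e, rfl, ζ, hζ, h⟩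
    obtain ⟨h0, h1⟩ := hζk ζ hζ
    have := conj_of_rotation (m := m) hk hs h0 (y' := y')
      (conjugates_refl_normalForm hs hk y μ') (fun j => by rw [h, smul_smul, hrot ζ h0 h1])
    rw [h1, mul_one] at this
    rw [e]
    exact ⟨_, this⟩

/-- A negative `a` is absorbed in a negative `α` when `k` is odd. When `k` is even this is
impossible, but then `ε^(k+1) = ε` carries the sign. -/
lemma exists_scale_real {k : ℕ} (hk : 1 ≤ k) {a : ℝ} (ha : a ≠ 0) :
    ∃ ε α : ℝ, (ε = 1 ∨ ε = -1) ∧ α ≠ 0 ∧ α ^ k = a * ε ^ (k + 1) := by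
  set β := |a| ^ ((k : ℝ)⁻¹) with hβ
  have hβ0 : 0 < β := Real.rpow_pos_of_pos (abs_pos.2 ha) _
  have hβk : β ^ k = |a| := Real.rpow_inv_natCast_pow (abs_nonneg a) (by omega)
  rcases lt_or_gt_of_ne ha with hn | hp
  · rw [abs_of_neg hn] at hβk
    rcases Nat.even_or_odd k with he | ho
    · refine ⟨-1, β, Or.inr rfl, hβ0.ne', ?_⟩
      rw [(he.add_one).neg_one_pow, hβk]; ring
    · refine ⟨1, -β, Or.inl rfl, (neg_ne_zero.2 hβ0.ne'), ?_⟩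
      rw [ho.neg_pow, hβk]; ring
  · rw [abs_of_pos hp] at hβk
    exact ⟨1, β, Or.inl rfl, hβ0.ne', by rw [hβk]; ring⟩

end RealCase

/-! ### The residue at infinity of the dual form. -/

section Infinity

variable {R : Type*} [CommRing R]

/-- The residue at infinity is computed on the expansion in `z = 1/x`. -/
lemma residueAtInfinity_of_expansion {N D : Polynomial R} {k : ℕ} {u v w : PowerSeries R}
    (huv : u * v = 1)
    (hD : expandAtInfinity D = HahnSeries.single (-1 : ℤ) (1 : R) ^ k *
      HahnSeries.ofPowerSeries ℤ R u)
    (hN : expandAtInfinity N = HahnSeries.single (-1 : ℤ) (1 : R) ^ k *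
      HahnSeries.ofPowerSeries ℤ R w) :
    residueAtInfinity N D = -PowerSeries.coeff 1 (w * v) := by
  have h1 : HahnSeries.single (-1 : ℤ) (1 : R) * HahnSeries.single (1 : ℤ) (1 : R) = 1 := by
    rw [HahnSeries.single_mul_single]; simp
  have hDu : IsUnit (expandAtInfinity D) := by
    rw [hD]
    refine IsUnit.mul (IsUnit.pow _ (IsUnit.of_mul_eq_one _ h1)) ?_
    exact IsUnit.of_mul_eq_one (HahnSeries.ofPowerSeries ℤ R v) (by rw [← map_mul, huv, map_one])
  have h2 : expandAtInfinity N * Ring.inverse (expandAtInfinity D) =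
      HahnSeries.ofPowerSeries ℤ R (w * v) := by
    have h3 : expandAtInfinity N = HahnSeries.ofPowerSeries ℤ R (w * v) * expandAtInfinity D := by
      have h4 : HahnSeries.ofPowerSeries ℤ R u * HahnSeries.ofPowerSeries ℤ R v = 1 := by
        rw [← map_mul, huv, map_one]
      rw [hD, hN, map_mul]
      linear_combination (-(HahnSeries.single (-1 : ℤ) (1 : R) ^ k) *
        HahnSeries.ofPowerSeries ℤ R w) * h4
    rw [h3, mul_assoc, Ring.mul_inverse_cancel _ hDu, mul_one]
  rw [residueAtInfinity, h2]
  congr 1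
  exact HahnSeries.ofPowerSeries_apply_coeff (Γ := ℤ) (w * v) 1

end Infinity

section Infinity

variable {𝕜 : Type*} [Field 𝕜] {m k : ℕ}

/-- In `z = 1/x` the two polynomials are `z^(-(k+1)) u` with `u(0) = 1` and `z^(-(k+1)) (s z^(k+1) +
μ z)`. Since `k ≥ 1`, only `μ z` contributes to the coefficient of `z` in the quotient. -/
lemma residueAtInfinity_normalForm (hk : 1 ≤ k) (s : 𝕜) (y : Fin k → ParamSeries m 𝕜)
    (μ : ParamSeries m 𝕜) :
    μ = -residueAtInfinity (denominator k s μ) (numerator k y) := by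
  set ζ : LaurentSeries (ParamSeries m 𝕜) := HahnSeries.single (-1 : ℤ) 1
  set u : PowerSeries (ParamSeries m 𝕜) := 1 + ∑ j : Fin k, PowerSeries.C (y j) *
    PowerSeries.X ^ (k + 1 - (j : ℕ)) with hu
  have hu0 : PowerSeries.constantCoeff u = 1 := by
    rw [hu, map_add, map_one, map_sum, Finset.sum_eq_zero, add_zero]
    intro j _
    rw [map_mul, map_pow, PowerSeries.constantCoeff_X, zero_pow (by omega), mul_zero]
  obtain ⟨v, huv⟩ := (PowerSeries.isUnit_iff_constantCoeff.2 (hu0 ▸ isUnit_one)).exists_right_inv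
  have hX : ζ * HahnSeries.ofPowerSeries ℤ (ParamSeries m 𝕜) PowerSeries.X = 1 := by
    rw [HahnSeries.ofPowerSeries_X, HahnSeries.single_mul_single]; simp
  have hXp : ∀ i j : ℕ, ζ ^ (i + j) *
      HahnSeries.ofPowerSeries ℤ (ParamSeries m 𝕜) PowerSeries.X ^ j = ζ ^ i := fun i j => by
    rw [pow_add, mul_assoc, ← mul_pow, hX, one_pow, mul_one]
  rw [residueAtInfinity_of_expansion (k := k + 1) (w := PowerSeries.C (MvPowerSeries.C s) *
    PowerSeries.X ^ (k + 1) + PowerSeries.C μ * PowerSeries.X) huv, neg_neg]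
  · obtain ⟨k, rfl⟩ := Nat.exists_eq_add_of_le' hk
    have hv : PowerSeries.constantCoeff v = 1 := by
      have := congrArg PowerSeries.constantCoeff huv
      rwa [map_mul, hu0, one_mul, map_one] at this
    have e : (PowerSeries.C (MvPowerSeries.C s) * PowerSeries.X ^ (k + 1 + 1) +
        PowerSeries.C μ * PowerSeries.X) * v = PowerSeries.X *
        ((PowerSeries.C (MvPowerSeries.C s) * PowerSeries.X ^ k * PowerSeries.X +
          PowerSeries.C μ) * v) := by ring
    rw [e, show 1 = 0 + 1 from rfl, PowerSeries.coeff_succ_X_mul,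
      PowerSeries.coeff_zero_eq_constantCoeff_apply]
    simp [hv]
  · rw [expandAtInfinity, numerator, Polynomial.eval₂_add, Polynomial.eval₂_X_pow,
      Polynomial.eval₂_finsetSum, hu, map_add,
      map_one (HahnSeries.ofPowerSeries ℤ (ParamSeries m 𝕜)), mul_add, mul_one, map_sum,
      Finset.mul_sum]
    congr 1
    refine Finset.sum_congr rfl fun j _ => ?_
    have h1 := hXp j (k + 1 - j)
    rw [show (j : ℕ) + (k + 1 - j) = k + 1 by omega] at h1
    rw [Polynomial.eval₂_mul, Polynomial.eval₂_C, Polynomial.eval₂_X_pow, map_mul, map_pow,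
      HahnSeries.ofPowerSeries_C, ← h1]
    ring
  · have h1 := hXp 0 (k + 1)
    have h2 := hXp k 1
    rw [zero_add] at h1
    rw [pow_one] at h2
    rw [expandAtInfinity, denominator, Polynomial.eval₂_add, Polynomial.eval₂_C,
      Polynomial.eval₂_mul, Polynomial.eval₂_C, Polynomial.eval₂_X_pow, map_add, map_mul, map_mul,
      map_pow, HahnSeries.ofPowerSeries_C, HahnSeries.ofPowerSeries_C, mul_add]
    rw [mul_left_comm, h1, mul_left_comm, h2, pow_zero, mul_one]

end Infinity

/-! ### Residues of exact and logarithmic forms. -/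

section Euler

variable {𝕜 : Type*} [Field 𝕜] {σ : Type*}

/-- The derivation `x d/dx` of Laurent series. -/
def euler (f : LaurentSeries 𝕜) : LaurentSeries 𝕜 :=
  ⟨fun n => (n : 𝕜) * f.coeff n, f.isPWO_support.mono fun n hn => by
    simp only [Function.mem_support] at hn
    exact right_ne_zero_of_mul hn⟩

@[simp] lemma coeff_euler (f : LaurentSeries 𝕜) (n : ℤ) : (euler f).coeff n = n * f.coeff n := rfl

lemma euler_support_subset (f : LaurentSeries 𝕜) : (euler f).support ⊆ f.support := fun n hn => by
  rw [HahnSeries.mem_support, coeff_euler] at hn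
  exact right_ne_zero_of_mul hn

lemma euler_mul (f g : LaurentSeries 𝕜) : euler (f * g) = f * euler g + g * euler f := by
  ext n
  rw [HahnSeries.coeff_add, coeff_euler, HahnSeries.coeff_mul, mul_comm g,
    -- The supports are enlarged to those of `f` and `g`, so that the three products are sums over
    -- the same index set.
    HahnSeries.coeff_mul_right' g.isPWO_support (euler_support_subset g),
    HahnSeries.coeff_mul_left' f.isPWO_support (euler_support_subset f), ← Finset.sum_add_distrib,
    Finset.mul_sum]
  refine Finset.sum_congr rfl fun p hp => ?_
  rw [coeff_euler, coeff_euler]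
  have : p.1 + p.2 = n := (Finset.mem_antidiagonal.1 hp).2.2
  rw [← this]; push_cast; ring

lemma euler_add (f g : LaurentSeries 𝕜) : euler (f + g) = euler f + euler g := by
  ext n; simp [mul_add]

/-- The operator `x d/dx` on power series with Laurent series as coefficients. -/
def eulerHom : MvPowerSeries σ (LaurentSeries 𝕜) →+ MvPowerSeries σ (LaurentSeries 𝕜) where
  toFun f := fun n => euler (coeff n f)
  map_zero' := by
    ext n : 1
    change euler (coeff n 0) = coeff n 0
    rw [map_zero]; ext; simp
  map_add' f g := by ext n : 1; exact euler_add _ _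

lemma coeff_eulerHom (f : MvPowerSeries σ (LaurentSeries 𝕜)) (n : σ →₀ ℕ) :
    coeff n (eulerHom f) = euler (coeff n f) := rfl

lemma eulerHom_mul (f g : MvPowerSeries σ (LaurentSeries 𝕜)) :
    eulerHom (f * g) = f * eulerHom g + g * eulerHom f := by
  classical
  ext n : 1
  have hs : ∀ (s : Finset ((σ →₀ ℕ) × (σ →₀ ℕ)))
      (F : (σ →₀ ℕ) × (σ →₀ ℕ) → LaurentSeries 𝕜), euler (∑ p ∈ s, F p) = ∑ p ∈ s, euler (F p) :=
    fun s F => map_sum (AddMonoidHom.mk' euler euler_add) F s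
  rw [coeff_eulerHom, mul_comm g, map_add, MvPowerSeries.coeff_mul,
    MvPowerSeries.coeff_mul, MvPowerSeries.coeff_mul, hs, ← Finset.sum_add_distrib]
  refine Finset.sum_congr rfl fun p _ => ?_
  rw [euler_mul, mul_comm (coeff p.2 g), coeff_eulerHom, coeff_eulerHom, mul_comm (euler _)]

lemma eulerHom_one : eulerHom (1 : MvPowerSeries σ (LaurentSeries 𝕜)) = 0 := by
  have := eulerHom_mul (1 : MvPowerSeries σ (LaurentSeries 𝕜)) 1
  rw [mul_one, one_mul] at this
  exact left_eq_add.1 this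

lemma eulerHom_pow (f : MvPowerSeries σ (LaurentSeries 𝕜)) (i : ℕ) :
    eulerHom (f ^ (i + 1)) = (i + 1) • (eulerHom f * f ^ i) := by
  induction i with
  | zero => simp
  | succ i ih =>
    rw [pow_succ, eulerHom_mul, ih, nsmul_eq_mul, nsmul_eq_mul]
    push_cast; ring

lemma eulerHom_inv {f g : MvPowerSeries σ (LaurentSeries 𝕜)} (h : f * g = 1) :
    eulerHom g = -(g ^ 2 * eulerHom f) := by
  have h1 := eulerHom_mul f g
  rw [h, eulerHom_one] at h1
  linear_combination (-g) * h1 - eulerHom g * h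

/-- The coefficient of `x^0`. -/
def coeffZeroX : MvPowerSeries σ (LaurentSeries 𝕜) →+ MvPowerSeries σ 𝕜 :=
  AddMonoidHom.mk' (fun f => (fun n => (coeff n f).coeff 0 : MvPowerSeries σ 𝕜)) fun f g => by
    ext n; rfl

lemma coeff_coeffZeroX (f : MvPowerSeries σ (LaurentSeries 𝕜)) (n : σ →₀ ℕ) :
    coeff n (coeffZeroX f) = (coeff n f).coeff 0 := rfl

/-- Exact forms have no residue: `x d/dx` multiplies the coefficient of `x^0` by zero. -/
lemma coeffZeroX_eulerHom (f : MvPowerSeries σ (LaurentSeries 𝕜)) :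
    coeffZeroX (eulerHom f) = 0 := by
  ext n
  rw [coeff_coeffZeroX, coeff_eulerHom, coeff_euler]; simp

lemma coeffZeroX_map_mul (b : MvPowerSeries σ 𝕜) (f : MvPowerSeries σ (LaurentSeries 𝕜)) :
    coeffZeroX (MvPowerSeries.map HahnSeries.C b * f) = b * coeffZeroX f := by
  classical
  ext n
  rw [coeff_coeffZeroX, MvPowerSeries.coeff_mul, MvPowerSeries.coeff_mul, HahnSeries.coeff_sum]
  refine Finset.sum_congr rfl fun p _ => ?_
  rw [MvPowerSeries.coeff_map, HahnSeries.C_mul_eq_smul, HahnSeries.coeff_smul, smul_eq_mul,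
    coeff_coeffZeroX]

lemma coeff_mul_pow_of_constantCoeff {R : Type*} [CommRing R] {E : MvPowerSeries σ R}
    (hE : MvPowerSeries.constantCoeff E = 0) (a : MvPowerSeries σ R) {N : ℕ} {n : σ →₀ ℕ}
    (hn : n.degree < N) : coeff n (a * E ^ N) = 0 := by
  apply MvPowerSeries.coeff_of_lt_order
  have h1 := MvPowerSeries.le_order_pow_of_constantCoeff_eq_zero N hE
  have h2 := MvPowerSeries.le_order_mul (f := a) (g := E ^ N)
  calc ((n.degree : ℕ) : ℕ∞) < N := by exact_mod_cast hn
    _ ≤ (E ^ N).order := h1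
    _ ≤ a.order + (E ^ N).order := le_add_self
    _ ≤ _ := h2

/-- As `E` has no constant term, `E^N` does not reach degree below `N`. A coefficient of a multiple
of `1/(1+E)` thus involves only a finite geometric sum. -/
lemma coeff_geometric {R : Type*} [CommRing R] {E F : MvPowerSeries σ R}
    (hE : MvPowerSeries.constantCoeff E = 0) (hF : (1 + E) * F = 1) (a : MvPowerSeries σ R)
    {N : ℕ} {n : σ →₀ ℕ} (hn : n.degree < N) :
    coeff n (a * F) = coeff n (a * ∑ i ∈ Finset.range N, (-E) ^ i) := by
  have h1 : (1 + E) * ∑ i ∈ Finset.range N, (-E) ^ i = 1 - (-E) ^ N := by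
    have := mul_neg_geom_sum (-E) N
    rwa [sub_neg_eq_add] at this
  have h2 : a * F = a * ∑ i ∈ Finset.range N, (-E) ^ i + (a * F) * (-E) ^ N := by
    linear_combination (-a * F) * h1 + (a * ∑ i ∈ Finset.range N, (-E) ^ i) * hF
  rw [h2, map_add, coeff_mul_pow_of_constantCoeff (by rw [map_neg, hE, neg_zero]) _ hn, add_zero]

lemma euler_ofPowerSeries (u : PowerSeries 𝕜) :
    euler (HahnSeries.ofPowerSeries ℤ 𝕜 u) =
      HahnSeries.ofPowerSeries ℤ 𝕜 (PowerSeries.mk fun j => (j : 𝕜) * PowerSeries.coeff j u) := by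
  ext n
  rw [coeff_euler, PowerSeries.coeff_coe, PowerSeries.coeff_coe]
  split_ifs with hn
  · simp
  · rw [PowerSeries.coeff_mk]
    congr 1
    obtain ⟨j, rfl⟩ := Int.eq_ofNat_of_zero_le (not_lt.1 hn)
    simp

variable [CharZero 𝕜]

lemma coeffZeroX_eulerHom_mul_pow (f : MvPowerSeries σ (LaurentSeries 𝕜)) (i : ℕ) :
    coeffZeroX (eulerHom f * f ^ i) = 0 := by
  have h := coeffZeroX_eulerHom (f ^ (i + 1))
  rw [eulerHom_pow, map_nsmul] at h
  ext n
  have h1 := congrArg (coeff n) h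
  rw [map_nsmul, map_zero, nsmul_eq_mul] at h1
  exact (mul_eq_zero.1 h1).resolve_left (by exact_mod_cast i.succ_ne_zero)

/-- The residue of `dφ / φ` is one, if `φ` has a simple zero. -/
lemma coeffZeroX_eulerHom_mul_inv {Φ Z : MvPowerSeries σ (LaurentSeries 𝕜)} (hZ : Φ * Z = 1)
    {u : PowerSeries 𝕜} (hu : PowerSeries.constantCoeff u ≠ 0)
    (hΦ : MvPowerSeries.constantCoeff Φ =
      HahnSeries.ofPowerSeries ℤ 𝕜 (PowerSeries.X * u)) :
    coeffZeroX (eulerHom Φ * Z) = 1 := by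
  set φ₀ := MvPowerSeries.constantCoeff Φ
  set ζ₀ := MvPowerSeries.constantCoeff Z
  have h0 : φ₀ * ζ₀ = 1 := by rw [← map_mul, hZ, map_one]
  have hC : (MvPowerSeries.C φ₀ : MvPowerSeries σ (LaurentSeries 𝕜)) * MvPowerSeries.C ζ₀ = 1 := by
    rw [← map_mul, h0, map_one]
  have hCe : ∀ a : LaurentSeries 𝕜,
      eulerHom (MvPowerSeries.C a : MvPowerSeries σ (LaurentSeries 𝕜)) =
        MvPowerSeries.C (euler a) := fun a => by
    classical
    ext n : 1
    rw [coeff_eulerHom, MvPowerSeries.coeff_C, MvPowerSeries.coeff_C]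
    split_ifs
    · rfl
    · ext; simp
  have hC0 : ∀ a : LaurentSeries 𝕜, coeffZeroX (MvPowerSeries.C a) =
      (MvPowerSeries.C (a.coeff 0) : MvPowerSeries σ 𝕜) := fun a => by
    classical
    ext n
    rw [coeff_coeffZeroX, MvPowerSeries.coeff_C, MvPowerSeries.coeff_C]
    split_ifs <;> simp
  -- Here `Φ = φ₀ (1 + η)` with `η` zero at `λ = 0`, so that `dΦ/Φ = dφ₀/φ₀ + dη/(1+η)`.
  obtain ⟨η, hη⟩ : ∃ η, η = MvPowerSeries.C ζ₀ * Φ - 1 := ⟨_, rfl⟩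
  have hη0 : MvPowerSeries.constantCoeff η = 0 := by
    rw [hη, map_sub, map_mul, map_one, MvPowerSeries.constantCoeff_C]
    change ζ₀ * φ₀ - 1 = 0
    rw [mul_comm, h0, sub_self]
  have hΦη : Φ = MvPowerSeries.C φ₀ * (1 + η) := by
    rw [hη]; linear_combination (-Φ) * hC
  have hF : (1 + η) * (MvPowerSeries.C φ₀ * Z) = 1 := by
    linear_combination hZ - Z * hΦη
  have e : eulerHom Φ * Z = MvPowerSeries.C (euler φ₀ * ζ₀) +
      eulerHom η * (MvPowerSeries.C φ₀ * Z) := by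
    have h1 : eulerHom Φ = MvPowerSeries.C φ₀ * eulerHom η +
        (1 + η) * MvPowerSeries.C (euler φ₀) := by
      conv_lhs => rw [hΦη]
      rw [eulerHom_mul, map_add, eulerHom_one, zero_add, hCe]
    rw [h1, map_mul]
    linear_combination (MvPowerSeries.C (euler φ₀) * MvPowerSeries.C ζ₀) * hF -
      (1 + η) * Z * MvPowerSeries.C (euler φ₀) * hC
  -- The factor `φ₀ Z` is `1/(1+η)`. In its geometric expansion each `η^i dη` is exact, in
  -- characteristic zero, and has no residue.
  have h2 : coeffZeroX (eulerHom η * (MvPowerSeries.C φ₀ * Z)) = 0 := by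
    ext n
    rw [coeff_coeffZeroX, coeff_geometric hη0 hF _ (Nat.lt_succ_self _), ← coeff_coeffZeroX,
      Finset.mul_sum, map_sum, map_sum]
    refine Finset.sum_eq_zero fun i _ => ?_
    rw [neg_pow, mul_left_comm]
    rcases neg_one_pow_eq_or (MvPowerSeries σ (LaurentSeries 𝕜)) i with h | h <;> rw [h] <;>
      simp [coeffZeroX_eulerHom_mul_pow]
  -- At `λ = 0`, `φ₀ = x u` with `u(0) ≠ 0`, so `x φ₀'/φ₀` is a power series with value 1 at the
  -- origin.
  have h3 : (euler φ₀ * ζ₀).coeff 0 = 1 := by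
    have h4 : ζ₀ = HahnSeries.single (-1 : ℤ) 1 * HahnSeries.ofPowerSeries ℤ 𝕜 u⁻¹ := by
      have h5 : φ₀ * (HahnSeries.single (-1 : ℤ) 1 * HahnSeries.ofPowerSeries ℤ 𝕜 u⁻¹) = 1 := by
        rw [hΦ, map_mul, HahnSeries.ofPowerSeries_X]
        have h6 : HahnSeries.ofPowerSeries ℤ 𝕜 u * HahnSeries.ofPowerSeries ℤ 𝕜 u⁻¹ = 1 := by
          rw [← map_mul, PowerSeries.mul_inv_cancel _ hu, map_one]
        have h7 : HahnSeries.single (1 : ℤ) (1 : 𝕜) * HahnSeries.single (-1 : ℤ) 1 = 1 := by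
          rw [HahnSeries.single_mul_single]; simp
        linear_combination h6 + HahnSeries.ofPowerSeries ℤ 𝕜 u *
          HahnSeries.ofPowerSeries ℤ 𝕜 u⁻¹ * h7
      exact mul_left_cancel₀ (left_ne_zero_of_mul_eq_one h0) (h0.trans h5.symm)
    rw [h4, hΦ, euler_ofPowerSeries]
    have h8 : (PowerSeries.mk fun j => (j : 𝕜) * PowerSeries.coeff j (PowerSeries.X * u)) =
        PowerSeries.X * PowerSeries.mk fun j => ((j : 𝕜) + 1) * PowerSeries.coeff j u := by
      ext j
      rcases j with _ | j
      · simp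
      · rw [PowerSeries.coeff_mk, PowerSeries.coeff_succ_X_mul, PowerSeries.coeff_succ_X_mul,
          PowerSeries.coeff_mk]
        push_cast; ring
    rw [h8, map_mul, HahnSeries.ofPowerSeries_X]
    have h7 : HahnSeries.single (1 : ℤ) (1 : 𝕜) * HahnSeries.single (-1 : ℤ) 1 = 1 := by
      rw [HahnSeries.single_mul_single]; simp
    rw [mul_mul_mul_comm, h7, one_mul, ← map_mul]
    have := HahnSeries.ofPowerSeries_apply_coeff (Γ := ℤ) ((PowerSeries.mk fun j => ((j : 𝕜) + 1) *
      PowerSeries.coeff j u) * u⁻¹) 0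
    rw [Nat.cast_zero] at this
    rw [this, PowerSeries.coeff_zero_eq_constantCoeff_apply, map_mul,
      ← PowerSeries.coeff_zero_eq_constantCoeff_apply, PowerSeries.coeff_mk]
    simp [hu]
  rw [e, map_add, h2, add_zero, hC0, h3, map_one]

/-- The residue of `p(1/φ) dφ/φ` for a polynomial `p`. -/
lemma coeffZeroX_eval₂ {Φ Z : MvPowerSeries σ (LaurentSeries 𝕜)} (hZ : Φ * Z = 1)
    (h1 : coeffZeroX (eulerHom Φ * Z) = 1) (p : Polynomial (MvPowerSeries σ 𝕜)) :
    coeffZeroX (eulerHom Φ * Z * p.eval₂ (MvPowerSeries.map HahnSeries.C) Z) = p.coeff 0 := by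
  have hZΦ : eulerHom Z = -(Z ^ 2 * eulerHom Φ) := eulerHom_inv hZ
  induction p using Polynomial.induction_on' with
  | add p q hp hq => rw [Polynomial.eval₂_add, mul_add, map_add, hp, hq, Polynomial.coeff_add]
  | monomial i a =>
    rw [Polynomial.eval₂_monomial, mul_left_comm, coeffZeroX_map_mul, Polynomial.coeff_monomial]
    rcases i with _ | i
    · simp [h1]
    · have := coeffZeroX_eulerHom_mul_pow Z i
      rw [hZΦ, neg_mul, map_neg, neg_eq_zero] at this
      -- With `Z = 1/Φ`, this form is `-Z^i dZ`, hence exact; only the constant term of the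
      -- polynomial survives.
      rw [show eulerHom Φ * Z * Z ^ (i + 1) = Z ^ 2 * eulerHom Φ * Z ^ i by ring, this]
      simp

end Euler

/-! ### The sum of the residues near the origin equals `μ`. -/

section ResidueSum

variable {𝕜 : Type*} [Field 𝕜] {m k : ℕ}

lemma coeff_toLaurent (f : FormalFamily m 𝕜) (n : Fin m →₀ ℕ) :
    coeff n (toLaurent f) = HahnSeries.ofPowerSeries ℤ 𝕜
      (PowerSeries.mk fun j => coeff (n.optionElim j) f) := rfl

lemma coeff_optionElim_mul (f g : FormalFamily m 𝕜) (n : Fin m →₀ ℕ) (j : ℕ) :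
    coeff (n.optionElim j) (f * g) = ∑ p ∈ Finset.HasAntidiagonal.antidiagonal n,
      ∑ q ∈ Finset.HasAntidiagonal.antidiagonal j,
        coeff (p.1.optionElim q.1) f * coeff (p.2.optionElim q.2) g := by
  rw [MvPowerSeries.coeff_mul, ← Finset.sum_product']
  refine Finset.sum_nbij' (fun p => ((p.1.some, p.2.some), (p.1 none, p.2 none)))
    (fun p => (p.1.1.optionElim p.2.1, p.1.2.optionElim p.2.2)) ?_ ?_ ?_ ?_ ?_
  · intro p hp
    have hp := Finset.HasAntidiagonal.mem_antidiagonal.1 hp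
    refine Finset.mem_product.2 ⟨Finset.HasAntidiagonal.mem_antidiagonal.2 ?_,
      Finset.HasAntidiagonal.mem_antidiagonal.2 ?_⟩
    · have := congrArg Finsupp.some hp
      rwa [Finsupp.some_add, Finsupp.some_optionElim] at this
    · have := DFunLike.congr_fun hp none
      rwa [Finsupp.add_apply, Finsupp.optionElim_apply_none] at this
  · intro p hp
    obtain ⟨h1, h2⟩ := Finset.mem_product.1 hp
    have h1 := Finset.HasAntidiagonal.mem_antidiagonal.1 h1
    have h2 := Finset.HasAntidiagonal.mem_antidiagonal.1 h2
    refine Finset.HasAntidiagonal.mem_antidiagonal.2 ?_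
    ext o
    rcases o with _ | i
    · simpa using h2
    · simpa using DFunLike.congr_fun h1 i
  · intro p _; simp
  · intro p _; simp
  · intro p _; simp

/-- `toLaurent` as a ring homomorphism. -/
def toLaurentHom : FormalFamily m 𝕜 →+* MvPowerSeries (Fin m) (LaurentSeries 𝕜) where
  toFun := toLaurent
  map_zero' := by
    ext n : 1
    rw [coeff_toLaurent, map_zero, ← map_zero (HahnSeries.ofPowerSeries ℤ 𝕜)]
    congr 1
  map_one' := by
    classical
    ext n : 1
    rw [coeff_toLaurent, MvPowerSeries.coeff_one]
    split_ifs with h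
    · rw [← map_one (HahnSeries.ofPowerSeries ℤ 𝕜)]
      congr 1
      ext j
      rw [PowerSeries.coeff_mk, MvPowerSeries.coeff_one, PowerSeries.coeff_one, h]
      congr 1
      rw [eq_iff_iff]
      exact ⟨fun h => by simpa using DFunLike.congr_fun h none, fun h => by rw [h]; simp⟩
    · rw [← map_zero (HahnSeries.ofPowerSeries ℤ 𝕜)]
      congr 1
      ext j
      rw [PowerSeries.coeff_mk, MvPowerSeries.coeff_one, if_neg, map_zero]
      intro h'
      exact h (by rw [← Finsupp.some_optionElim j n, h', Finsupp.some_zero])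
  map_add' f g := by
    ext n : 1
    rw [map_add, coeff_toLaurent, coeff_toLaurent, coeff_toLaurent, ← map_add]
    congr 1
  map_mul' f g := by
    ext n : 1
    rw [coeff_toLaurent, MvPowerSeries.coeff_mul]
    simp_rw [coeff_toLaurent, ← map_mul]
    rw [← map_sum]
    congr 1
    ext j
    rw [PowerSeries.coeff_mk, coeff_optionElim_mul, map_sum]
    refine Finset.sum_congr rfl fun p _ => ?_
    rw [PowerSeries.coeff_mul]
    simp_rw [PowerSeries.coeff_mk]

lemma toLaurentHom_apply (f : FormalFamily m 𝕜) : toLaurentHom f = toLaurent f := rfl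

lemma toLaurent_ofParam (b : ParamSeries m 𝕜) :
    toLaurent (ofParam b) = MvPowerSeries.map HahnSeries.C b := by
  ext n : 1
  rw [coeff_toLaurent, MvPowerSeries.coeff_map, ← HahnSeries.ofPowerSeries_C]
  congr 1
  ext j
  rw [PowerSeries.coeff_mk, coeff_ofParam, PowerSeries.coeff_C, Finsupp.optionElim_apply_none,
    Finsupp.some_optionElim]

lemma toLaurent_coordX : toLaurent (coordX : FormalFamily m 𝕜) =
    MvPowerSeries.C (HahnSeries.single (1 : ℤ) (1 : 𝕜)) := by
  classical
  ext n : 1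
  have h : ∀ j, coeff (n.optionElim j) (coordX : FormalFamily m 𝕜) =
      if n = 0 then (if j = 1 then 1 else 0) else 0 := fun j => by
    have := coeff_ofParam_mul_pow (1 : ParamSeries m 𝕜) 1 (n.optionElim j)
    rw [map_one, one_mul, pow_one, Finsupp.optionElim_apply_none, Finsupp.some_optionElim,
      MvPowerSeries.coeff_one] at this
    rw [this]; split_ifs <;> rfl
  rw [coeff_toLaurent, MvPowerSeries.coeff_C]
  simp_rw [h]
  split_ifs with hn
  · rw [← HahnSeries.ofPowerSeries_X]
    congr 1
    ext j; rw [PowerSeries.coeff_mk, PowerSeries.coeff_X]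
  · rw [← map_zero (HahnSeries.ofPowerSeries ℤ 𝕜)]
    congr 1

lemma coeff_optionElim_coordX_mul_pderiv (f : FormalFamily m 𝕜) (n : Fin m →₀ ℕ) (j : ℕ) :
    coeff (n.optionElim j) (coordX * MvPowerSeries.pderiv 𝕜 none f) =
      j * coeff (n.optionElim j) f := by
  have := congrArg (coeff n) (coeffX_coordX_mul_pderiv f j)
  rwa [coeff_coeffX, MvPowerSeries.coeff_smul, coeff_coeffX] at this

lemma toLaurent_coordX_mul_pderiv (f : FormalFamily m 𝕜) :
    toLaurent (coordX * MvPowerSeries.pderiv 𝕜 none f) = eulerHom (toLaurent f) := by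
  ext n : 1
  rw [coeff_eulerHom, coeff_toLaurent, coeff_toLaurent, euler_ofPowerSeries]
  congr 1
  ext j
  rw [PowerSeries.coeff_mk, PowerSeries.coeff_mk, PowerSeries.coeff_mk,
    coeff_optionElim_coordX_mul_pderiv]

/-- Multiplication by `x` moves the residue to the coefficient of `x^0`, matching the use of `x
d/dx` instead of `d/dx`. -/
lemma residueSum_eq (X : FormalFamily m 𝕜) :
    residueSum X = coeffZeroX (MvPowerSeries.C (HahnSeries.single (1 : ℤ) (1 : 𝕜)) *
      (toLaurent X)⁻¹) := by
  ext n
  rw [coeff_coeffZeroX, MvPowerSeries.coeff_C_mul]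
  have := HahnSeries.coeff_single_mul_add (r := (1 : 𝕜)) (x := coeff n (toLaurent X)⁻¹)
    (a := -1) (b := (1 : ℤ))
  rw [neg_add_cancel, one_mul] at this
  rw [this]; rfl

variable [CharZero 𝕜]

/-- The equation of conjugacy reads `dx/X = den(φ)/num(φ) dφ`. In terms of `Z = 1/φ` the right-hand
side is `(dφ/φ) (s Z^k + μ) / (1 + Σ y_j Z^(k+1-j))`, whose residue is the value of the last two
factors at `Z = 0`. -/
lemma residueSum_of_conj (hk : 1 ≤ k) {X φ : FormalFamily m 𝕜} {s : 𝕜} (hs : s ≠ 0)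
    {y : Fin k → ParamSeries m 𝕜} (hy : ∀ j, MvPowerSeries.constantCoeff (y j) = 0)
    {μ : ParamSeries m 𝕜} (h : Conjugates φ X (normalForm k s y μ)) : μ = residueSum X := by
  rw [conjugates_normalForm_iff hs (by omega)] at h
  obtain ⟨hφ, h⟩ := h
  set Φ := toLaurentHom φ with hΦ
  set ι : ParamSeries m 𝕜 →+* MvPowerSeries (Fin m) (LaurentSeries 𝕜) :=
    MvPowerSeries.map HahnSeries.C with hι
  set ξ : MvPowerSeries (Fin m) (LaurentSeries 𝕜) :=
    MvPowerSeries.C (HahnSeries.single (1 : ℤ) (1 : 𝕜)) with hξ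
  obtain ⟨u, hu, hu1⟩ : ∃ u : PowerSeries 𝕜, PowerSeries.constantCoeff u ≠ 0 ∧
      MvPowerSeries.constantCoeff Φ = HahnSeries.ofPowerSeries ℤ 𝕜 (PowerSeries.X * u) := by
    refine ⟨PowerSeries.mk fun j => coeffXZero (j + 1) φ, ?_, ?_⟩
    · rw [← PowerSeries.coeff_zero_eq_constantCoeff_apply, PowerSeries.coeff_mk]
      exact hφ.lead_ne_zero
    · rw [hΦ, toLaurentHom_apply, ← MvPowerSeries.coeff_zero_eq_constantCoeff_apply,
        coeff_toLaurent]
      congr 1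
      ext j
      rw [PowerSeries.coeff_mk, Finsupp.optionElim_zero]
      rcases j with _ | j
      · simpa using hφ.1
      · rw [PowerSeries.coeff_succ_X_mul, PowerSeries.coeff_mk]
  have hΦ0 : MvPowerSeries.constantCoeff Φ ≠ 0 := by
    rw [hu1, map_mul, HahnSeries.ofPowerSeries_X]
    refine mul_ne_zero (by simp) fun h0 => hu ?_
    rw [← map_zero (HahnSeries.ofPowerSeries ℤ 𝕜)] at h0
    rw [HahnSeries.ofPowerSeries_injective h0, map_zero]
  have hZ := MvPowerSeries.mul_inv_cancel Φ hΦ0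
  set Z := Φ⁻¹
  have h1 := coeffZeroX_eulerHom_mul_inv hZ hu hu1
  set E : MvPowerSeries (Fin m) (LaurentSeries 𝕜) := ∑ j : Fin k, ι (y j) * Z ^ (k + 1 - (j : ℕ))
    with hE
  have hE0 : MvPowerSeries.constantCoeff E = 0 := by
    rw [hE, map_sum]
    refine Finset.sum_eq_zero fun j _ => ?_
    rw [map_mul, hι, MvPowerSeries.constantCoeff_map, hy, map_zero, zero_mul]
  have hF := MvPowerSeries.mul_inv_cancel (1 + E) (by rw [map_add, hE0, map_one, add_zero]; simp)
  set F := (1 + E)⁻¹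
  have hpow : ∀ i j : ℕ, Φ ^ (i + j) * Z ^ j = Φ ^ i := fun i j => by
    rw [pow_add, mul_assoc, ← mul_pow, hZ, one_pow, mul_one]
  have hnum : toLaurentHom (numAt k y φ) = Φ ^ (k + 1) * (1 + E) := by
    rw [numAt, map_add, map_pow, map_sum, hE, mul_add, mul_one, Finset.mul_sum]
    congr 1
    refine Finset.sum_congr rfl fun j _ => ?_
    have := hpow j (k + 1 - j)
    rw [show (j : ℕ) + (k + 1 - j) = k + 1 by omega] at this
    rw [map_mul, map_pow, toLaurentHom_apply, toLaurent_ofParam, ← hΦ, ← this]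
    ring
  have hden : toLaurentHom (denAt k s μ φ) = ι (MvPowerSeries.C s) + ι μ * Φ ^ k := by
    rw [denAt, ← ofParam_C, map_add, map_mul, map_pow, toLaurentHom_apply, toLaurentHom_apply,
      toLaurent_ofParam, toLaurent_ofParam]
  have hX := congrArg toLaurentHom (congrArg (coordX * ·) h)
  rw [map_mul, hnum, show coordX * (X * MvPowerSeries.pderiv 𝕜 none φ * denAt k s μ φ) =
    X * (coordX * MvPowerSeries.pderiv 𝕜 none φ) * denAt k s μ φ by ring, map_mul, map_mul, hden,
    toLaurentHom_apply coordX, toLaurent_coordX, toLaurentHom_apply (coordX * _),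
    toLaurent_coordX_mul_pderiv, ← toLaurentHom_apply, ← hΦ, ← hξ] at hX
  have hX0 : MvPowerSeries.constantCoeff (toLaurentHom X) ≠ 0 := by
    intro h0
    have h2 := congrArg MvPowerSeries.constantCoeff hX
    rw [map_mul, map_mul, map_mul, map_mul, h0, zero_mul, zero_mul, map_add, hE0, map_one,
      add_zero, mul_one, map_pow, hξ, MvPowerSeries.constantCoeff_C] at h2
    exact mul_ne_zero (by simp) (pow_ne_zero _ hΦ0) h2
  have hW := MvPowerSeries.mul_inv_cancel _ hX0
  rw [residueSum_eq, ← toLaurentHom_apply]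
  set W := (toLaurentHom X)⁻¹
  have hξW : ξ * W = eulerHom Φ * Z * (ι (MvPowerSeries.C s) * Z ^ k + ι μ) * F := by
    have h2 := hpow 0 k
    have h3 := hpow 0 (k + 1)
    rw [zero_add, pow_zero] at h2 h3
    linear_combination (W * Z ^ (k + 1) * F) * hX - (ξ * W) * hF - (ξ * W * (1 + E) * F) * h3 +
      (eulerHom Φ * (ι (MvPowerSeries.C s) + ι μ * Φ ^ k) * Z ^ (k + 1) * F) * hW +
      (eulerHom Φ * Z * ι μ * F) * h2
  ext n
  obtain ⟨e, he⟩ : ∃ e : Polynomial (ParamSeries m 𝕜), e =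
      ∑ j : Fin k, Polynomial.C (y j) * Polynomial.X ^ (k + 1 - (j : ℕ)) := ⟨_, rfl⟩
  have heE : e.eval₂ ι Z = E := by
    rw [he, hE, Polynomial.eval₂_finsetSum]
    refine Finset.sum_congr rfl fun j _ => ?_
    rw [Polynomial.eval₂_mul, Polynomial.eval₂_C, Polynomial.eval₂_X_pow]
  have he0 : e.eval 0 = 0 := by
    rw [he, Polynomial.eval_finsetSum]
    refine Finset.sum_eq_zero fun j _ => ?_
    rw [Polynomial.eval_mul, Polynomial.eval_X_pow, zero_pow (by omega), mul_zero]
  -- For one coefficient in `λ`, a truncated geometric sum is enough and leaves a polynomial in `Z`.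
  -- Its value at zero is `μ`, since `e(0) = 0` and `k ≥ 1` removes `s`.
  have hp := coeffZeroX_eval₂ hZ h1 ((Polynomial.C (MvPowerSeries.C s) * Polynomial.X ^ k +
    Polynomial.C μ) * ∑ i ∈ Finset.range (n.degree + 1), (-e) ^ i)
  rw [Polynomial.coeff_zero_eq_eval_zero, Polynomial.eval_mul, Polynomial.eval_finsetSum,
    Polynomial.eval₂_mul, Polynomial.eval₂_finsetSum] at hp
  simp only [Polynomial.eval₂_pow, Polynomial.eval₂_neg, Polynomial.eval₂_add,
    Polynomial.eval₂_mul, Polynomial.eval₂_C, Polynomial.eval₂_X] at hp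
  rw [← hι, heE] at hp
  rw [hξW, coeff_coeffZeroX, coeff_geometric hE0 hF _ (Nat.lt_succ_self _), ← coeff_coeffZeroX,
    mul_assoc, hp, Finset.sum_range_succ', Finset.sum_eq_zero]
  · simp [zero_pow (by omega : k ≠ 0)]
  · intro i _
    rw [Polynomial.eval_pow, Polynomial.eval_neg, he0, neg_zero, zero_pow (Nat.succ_ne_zero i)]

end ResidueSum

/-! ### Existence of the normal form over `ℂ` and `ℝ`. -/

section Existence

variable {m k : ℕ}

lemma existence_complex (hk : 1 ≤ k) {X : FormalFamily m ℂ} (hX : IsUnfoldingOfOrder k X) :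
    ∃ (y : Fin k → ParamSeries m ℂ) (μ : ParamSeries m ℂ),
      (∀ j, MvPowerSeries.constantCoeff (y j) = 0) ∧
      FormallyConjugate X (normalForm k 1 y μ) ∧
      μ = -residueAtInfinity (denominator k 1 μ) (numerator k y) ∧ μ = residueSum X := by
  obtain ⟨a, ha, hX⟩ := hX.lead
  obtain ⟨α, hα⟩ := IsAlgClosed.exists_pow_nat_eq a hk
  have hα0 : α ≠ 0 := by
    rintro rfl
    rw [zero_pow (by omega)] at hα
    exact ha hα.symm
  obtain ⟨φ, y, μ, hy, h⟩ := exists_conj_normalForm_scaled hk (s := 1) ha hα0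
    (by rw [hα, mul_one]) (hX (k + 2) le_rfl)
  exact ⟨y, μ, hy, ⟨φ, h⟩, residueAtInfinity_normalForm hk 1 y μ,
    residueSum_of_conj hk one_ne_zero hy h⟩

lemma existence_real (hk : 1 ≤ k) {X : FormalFamily m ℝ} (hX : IsUnfoldingOfOrder k X) :
    ∃ (ε : ℝ) (y : Fin k → ParamSeries m ℝ) (μ : ParamSeries m ℝ),
      (ε = 1 ∨ ε = -1) ∧
      (∀ j, MvPowerSeries.constantCoeff (y j) = 0) ∧
      FormallyConjugate X (normalForm k (ε ^ (k + 1)) y μ) ∧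
      μ = -residueAtInfinity (denominator k (ε ^ (k + 1)) μ) (numerator k y) ∧
      μ = residueSum X := by
  obtain ⟨a, ha, hX⟩ := hX.lead
  obtain ⟨ε, α, hε, hα0, hα⟩ := exists_scale_real hk ha
  obtain ⟨φ, y, μ, hy, h⟩ := exists_conj_normalForm_scaled hk ha hα0 hα (hX (k + 2) le_rfl)
  exact ⟨ε, y, μ, hε, hy, ⟨φ, h⟩, residueAtInfinity_normalForm hk _ y μ,
    residueSum_of_conj hk (sign_pow_ne_zero hε _) hy h⟩

end Existence

/-! ### Composition and flows for an arbitrary target family. -/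

section Comp

variable {𝕜 : Type*} [Field 𝕜] {m : ℕ} {M : ℕ} {n : ℕ∞} {K : ℕ}

lemma compHom_expansion {φ f h : FormalFamily m 𝕜} (hφ : MvPowerSeries.constantCoeff φ = 0) {J : ℕ}
    (hf : f = ∑ i ∈ Finset.range J, ofParam (coeffX i f) * coordX ^ i + h * coordX ^ J) :
    compHom φ hφ f = ∑ i ∈ Finset.range J, ofParam (coeffX i f) * φ ^ i + compHom φ hφ h * φ ^ J := by
  conv_lhs => rw [hf]
  simp only [map_add, map_sum, map_mul, map_pow, compHom_ofParam, compHom_coordX]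

/-- The coefficient of `x^i` in `f` has weight at least `q - i`, and `φ^i` keeps the relative
precision of `φ` at order `i`. The Taylor remainder from degree `q + K` on is negligible. -/
lemma near_compHom {φ φ' f : FormalFamily m 𝕜} {q : ℕ} (hφ : Near M n 1 K φ φ')
    (hf : f ∈ Filt M ⊤ q) : Near M n q K (compHom φ (constantCoeff_of_filt hφ.1) f)
      (compHom φ' (constantCoeff_of_filt hφ.2) f) := by
  obtain ⟨h, hh⟩ := exists_expansion f (q + K)
  rw [compHom_expansion _ hh, compHom_expansion _ hh]
  have hp : ∀ i, Near M n i K (φ ^ i) (φ' ^ i) := fun i => by simpa using hφ.pow i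
  refine (Near.sum fun i _ => ?_).add ?_
  · have h1 : (ofParam (coeffX i f) : FormalFamily m 𝕜) ∈ Filt M ⊤ (q - i) := by
      refine mem_filt_of_mul_pow (j := i) ?_
      rcases le_total i q with hi | hi
      · rw [Nat.sub_add_cancel hi]; exact coeffX_mul_pow_mem_filt hf i
      · rw [Nat.sub_eq_zero_of_le hi, zero_add]
        exact Ideal.mul_mem_left _ _ (coordX_pow_mem_filt i)
    exact ((Near.refl K h1).mul (hp i)).mono (by omega) (by omega)
  · have h1 : ∀ ψ g : FormalFamily m 𝕜, ψ ∈ Filt M ⊤ 1 → g * ψ ^ (q + K) ∈ Filt M ⊤ (q + K) :=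
      fun ψ g hψ => Ideal.mul_mem_left _ _ (by simpa using filt_pow hψ (q + K))
    exact ⟨filt_le (h1 _ _ hφ.1) (by omega), filt_le (h1 _ _ hφ.2) (by omega),
      sub_mem (filt_of_top (h1 _ _ hφ.1)) (filt_of_top (h1 _ _ hφ.2))⟩

lemma compHom_mem_filt {φ f : FormalFamily m 𝕜} {q : ℕ} (hφ : φ ∈ Filt M ⊤ 1)
    (hf : f ∈ Filt M ⊤ q) : compHom φ (constantCoeff_of_filt hφ) f ∈ Filt M ⊤ q :=
  (near_compHom (n := ⊤) (K := 0) (Near.refl 0 hφ) hf).1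

/-- Flows commute with the substitution of a coordinate. -/
lemma expDerHom_compHom [CharZero 𝕜] {X φ : FormalFamily m 𝕜} {t : ParamSeries m 𝕜}
    (h : Raises M (flowDer X t)) (hφ : φ ∈ Filt M ⊤ 1) (hφ' : expDer M (flowDer X t) φ ∈ Filt M ⊤ 1)
    (f : FormalFamily m 𝕜) :
    expDer M (flowDer X t) (compHom φ (constantCoeff_of_filt hφ) f) =
      compHom (expDer M (flowDer X t) φ) (constantCoeff_of_filt hφ') f := by
  refine eq_of_sub_mem_filt (M := M) fun K => ?_
  obtain ⟨g, hg⟩ := exists_expansion f K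
  rw [compHom_expansion (constantCoeff_of_filt hφ) hg,
    compHom_expansion (constantCoeff_of_filt hφ') hg]
  have e : ∀ f, expDer M (flowDer X t) f = expDerHom h f := fun _ => rfl
  have h1 : ∀ ψ g : FormalFamily m 𝕜, ψ ∈ Filt M ⊤ 1 → g * ψ ^ K ∈ Filt M ⊤ K :=
    fun ψ g hψ => Ideal.mul_mem_left _ _ (by simpa using filt_pow hψ K)
  rw [e] at hφ'
  simp only [e, map_add, map_sum, map_mul, map_pow, expDerHom_ofParam]
  rw [add_sub_add_left_eq_sub]
  exact sub_mem (h1 _ _ hφ') (h1 _ _ hφ')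

/-- The exponential commutes with `X ∂/∂x` and with substitution into `X'`, so it can be applied to
both sides of `X'(φ) = X φ'`. This is `conj_expDer` without a normal form as target. -/
lemma Conjugates.flow [CharZero 𝕜] {X X' φ : FormalFamily m 𝕜} {t : ParamSeries m 𝕜} (hM : 2 ≤ M)
    (hX : ofParam t * X ∈ Filt M ⊤ 2) (h : Conjugates φ X X') :
    Conjugates (expDer M (flowDer X t) φ) X X' := by
  have hD := raises_flowDer hX
  have h1 := h.1.sub_mem_filt hM
  have hφ := mem_filt_one_of_sub h1
  have h2 := expDer_sub_self hD hφ
  have h3 : expDer M (flowDer X t) φ - coeffXZero 1 φ • coordX ∈ Filt M ⊤ 2 := by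
    have := add_mem h2 h1
    rwa [sub_add_sub_cancel] at this
  refine ⟨isCoordChange_of_sub h.1.lead_ne_zero h3, ?_⟩
  rw [← compHom_apply _ (constantCoeff_of_filt (mem_filt_one_of_sub h3)),
    ← expDerHom_compHom hD hφ (mem_filt_one_of_sub h3), X_mul_pderiv_expDer hX, ← h.2, compHom_apply]

end Comp

/-! ### The fixed point equation for conjugacies between arbitrary families. -/

section Step

variable {𝕜 : Type*} [Field 𝕜] {m : ℕ} {M : ℕ} {n : ℕ∞} {K p : ℕ}

/-- The solution `v` of `x ^ p v' - p x ^ (p - 1) v = g` without coefficient of `x ^ p`, up to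
obstructions. -/
def linInvAt (p : ℕ) (g : FormalFamily m 𝕜) : FormalFamily m 𝕜 := fun d =>
  coeff (d + Finsupp.single none p) (coordX * g) / ((d none : 𝕜) - p)

lemma coeff_linInvAt (p : ℕ) (g : FormalFamily m 𝕜) (d : Option (Fin m) →₀ ℕ) :
    coeff d (linInvAt p g) = coeff (d + Finsupp.single none p) (coordX * g) / ((d none : 𝕜) - p) :=
  rfl

lemma linInvAt_sub (p : ℕ) (g g' : FormalFamily m 𝕜) :
    linInvAt p (g - g') = linInvAt p g - linInvAt p g' := by
  ext d
  rw [map_sub, coeff_linInvAt, coeff_linInvAt, coeff_linInvAt, mul_sub, map_sub, sub_div]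

lemma linInvAt_mem_filt {g : FormalFamily m 𝕜} (hg : g ∈ Filt M n (K + p)) :
    linInvAt p g ∈ Filt M n (K + 1) := by
  intro d h1 h2
  have h3 : coordX * g ∈ Filt M n (1 + (K + p)) := filt_mul coordX_mem_filt hg
  rw [coeff_linInvAt, h3 _ (by rw [wt_add, wt_single_none]; omega) (by simpa), zero_div]

lemma coeff_coordX_mul_pderiv (f : FormalFamily m 𝕜) (d : Option (Fin m) →₀ ℕ) :
    coeff d (coordX * MvPowerSeries.pderiv 𝕜 none f) = d none * coeff d f := by
  have := coeff_optionElim_coordX_mul_pderiv f d.some (d none)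
  rwa [Finsupp.optionElim_some] at this

/-- The operator sends `x^i` to `(i - p) x^(i+p-1)`, so only `x^p` is lost; there the division by
zero returns zero. The factor `x` in `linInvAt` turns the exponent into `i + p`, which also makes
sense for `p = 0`. -/
lemma linInvAt_linear [CharZero 𝕜] (p : ℕ) (v : FormalFamily m 𝕜) :
    v = linInvAt p (coordX ^ p * MvPowerSeries.pderiv 𝕜 none v -
      (p : 𝕜) • (coordX ^ (p - 1) * v)) + ofParam (coeffX p v) * coordX ^ p := by
  ext d
  have e : coordX * (coordX ^ p * MvPowerSeries.pderiv 𝕜 none v -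
      (p : 𝕜) • (coordX ^ (p - 1) * v)) =
      (coordX * MvPowerSeries.pderiv 𝕜 none v - (p : 𝕜) • v) * coordX ^ p := by
    rcases p with _ | p
    · simp
    · simp only [MvPowerSeries.smul_eq_C_mul, Nat.add_sub_cancel]; ring
  rw [map_add, coeff_linInvAt, e, coeff_add_mul_coordX_pow, map_sub, coeff_coordX_mul_pderiv,
    MvPowerSeries.coeff_smul, coeff_ofParam_mul_pow, ← sub_mul]
  split_ifs with h
  · rw [h, sub_self, div_zero, zero_add, coeff_coeffX, ← h, Finsupp.optionElim_some]
  · rw [add_zero, mul_div_cancel_left₀]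
    exact sub_ne_zero.2 (by exact_mod_cast h)

/-- The second order remainder of `(α x + v) ^ p`. -/
def powRem (α : 𝕜) (p : ℕ) (v : FormalFamily m 𝕜) : FormalFamily m 𝕜 :=
  (α • coordX + v) ^ p - (α • coordX) ^ p - (p : 𝕜) • ((α • coordX) ^ (p - 1) * v)

lemma powRem_zero (α : 𝕜) (v : FormalFamily m 𝕜) : powRem α 0 v = 0 := by simp [powRem]

lemma powRem_succ (α : 𝕜) (p : ℕ) (v : FormalFamily m 𝕜) : powRem α (p + 1) v =
    (α • coordX + v) * powRem α p v + (p : 𝕜) • ((α • coordX) ^ (p - 1) * v ^ 2) := by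
  rcases p with _ | p
  · simp [powRem]
  · simp only [powRem, Nat.add_sub_cancel, MvPowerSeries.smul_eq_C_mul]
    push_cast
    rw [map_add, map_add, map_one]
    ring

/-- The nonlinear part of the equation of conjugacy of `a x ^ p + R` to `a' x ^ p + R'` by
`α x + v`. -/
def conjRem (p : ℕ) (a a' α : 𝕜) (R R' v : FormalFamily m 𝕜) : FormalFamily m 𝕜 :=
  a⁻¹ • (a' • powRem α p v + compCoord R' (α • coordX + v) - α • R -
    R * MvPowerSeries.pderiv 𝕜 none v)

/-- The map whose fixed points contain the conjugacies. -/
def conjStep (p : ℕ) (a a' α : 𝕜) (R R' : FormalFamily m 𝕜) (b : ParamSeries m 𝕜)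
    (v : FormalFamily m 𝕜) : FormalFamily m 𝕜 :=
  linInvAt p (conjRem p a a' α R R' v) + ofParam b * coordX ^ p

/-- The relation `a' α^p = a α` makes the linear part equal to `a (x^p v' - p x^(p-1) v)`. The
converse fails in general, since `linInvAt` ignores the degrees below `p - 1` and the degree `2p -
1`; it is not needed, as a formal conjugacy is given. -/
lemma conjStep_of_conj [CharZero 𝕜] {a a' α : 𝕜} {R R' v : FormalFamily m 𝕜} (ha : a ≠ 0)
    (hα : α ≠ 0) (haα : a' * α ^ p = a * α) (hv : MvPowerSeries.constantCoeff v = 0)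
    (h : compCoord (a' • coordX ^ p + R') (α • coordX + v) = (a • coordX ^ p + R) *
      MvPowerSeries.pderiv 𝕜 none (α • coordX + v)) :
    conjStep p a a' α R R' (coeffX p v) v = v := by
  have hφ : MvPowerSeries.constantCoeff (α • coordX + v : FormalFamily m 𝕜) = 0 := by
    rw [map_add, MvPowerSeries.constantCoeff_smul, constantCoeff_coordX, hv, smul_zero, add_zero]
  rw [← compHom_apply _ hφ, map_add, map_smul, map_pow, compHom_coordX, compHom_apply,
    map_add, Derivation.map_smul, pderiv_coordX] at h
  have e : conjRem p a a' α R R' v = coordX ^ p * MvPowerSeries.pderiv 𝕜 none v -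
      (p : 𝕜) • (coordX ^ (p - 1) * v) := by
    have e1 : a' • ((p : 𝕜) • ((α • coordX) ^ (p - 1) * v)) =
        a • ((p : 𝕜) • (coordX ^ (p - 1) * v)) := by
      rcases p with _ | p
      · simp
      · have h1 : a' * α ^ p = a := mul_right_cancel₀ hα (by rw [← haα]; ring)
        rw [Nat.add_sub_cancel, smul_pow, smul_mul_assoc, smul_comm _ (α ^ p), ← mul_smul, h1]
    have e2 : a' • (α • (coordX : FormalFamily m 𝕜)) ^ p = a • (α • coordX ^ p) := by
      rw [smul_pow, smul_smul, smul_smul, haα]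
    rw [conjRem, inv_smul_eq_iff₀ ha, powRem, smul_sub, smul_sub, e1, e2, smul_sub,
      eq_sub_of_add_eq h]
    simp only [MvPowerSeries.smul_eq_C_mul]
    ring
  rw [conjStep, e, ← linInvAt_linear]

lemma near_coord {α : 𝕜} {v v' : FormalFamily m 𝕜} (hv : Near M n 2 K v v') :
    Near M n 1 (K + 1) (α • coordX + v) (α • coordX + v') :=
  (Near.refl _ (filt_smul α coordX_mem_filt)).add (hv.mono (by omega) (by omega))

lemma Near.smul {q : ℕ} (c : 𝕜) {f f' : FormalFamily m 𝕜} (h : Near M n q K f f') :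
    Near M n q K (c • f) (c • f') :=
  ⟨filt_smul c h.1, filt_smul c h.2, by rw [← smul_sub]; exact filt_smul c h.3⟩

lemma near_powRem {α : 𝕜} {v v' : FormalFamily m 𝕜} (hv : Near M n 2 K v v') (p : ℕ) :
    Near M n (p + 2) K (powRem α p v) (powRem α p v') := by
  induction p with
  | zero => rw [powRem_zero, powRem_zero]; exact Near.refl _ (zero_mem _)
  | succ p ih =>
    rw [powRem_succ, powRem_succ]
    refine Near.add ?_ ?_
    · exact (((near_coord hv).mono le_rfl (Nat.le_succ _)).mul ih).mono (by omega) (by omega)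
    · rcases p with _ | p
      · simpa using Near.refl _ (zero_mem _)
      · have h1 : ((α • coordX) ^ p : FormalFamily m 𝕜) ∈ Filt M ⊤ (p * 1) :=
          filt_pow (filt_smul α coordX_mem_filt) p
        exact (((Near.refl K h1).mul (hv.pow 2)).mono (by omega) (by omega)).smul _

lemma near_conjRem {a a' α : 𝕜} {R R' v v' : FormalFamily m 𝕜} (hR : R ∈ Filt M ⊤ (p + 1))
    (hR' : R' ∈ Filt M ⊤ (p + 1)) (hv : Near M n 2 K v v') :
    Near M n (p + 1) (K + 1) (conjRem p a a' α R R' v) (conjRem p a a' α R R' v') := by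
  have hφ := near_coord (α := α) hv
  have h1 := near_compHom hφ hR'
  rw [compHom_apply, compHom_apply] at h1
  have h2 := (Near.refl K hR).mul hv.pderiv
  exact (((((near_powRem hv p).mono (by omega) (by omega)).smul a').add h1).sub'
    (Near.refl _ (filt_smul α hR))).sub' (h2.mono (by omega) (by omega)) |>.smul _

/-- One weight is gained because `powRem` is quadratic in `v` and `R`, `R'` are heavier than `x^p`;
`linInvAt` only undoes the shift by `p - 1`. -/
lemma near_conjStep {a a' α : 𝕜} {R R' v v' : FormalFamily m 𝕜} {b b' : ParamSeries m 𝕜}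
    (hR : R ∈ Filt M ⊤ (p + 1)) (hR' : R' ∈ Filt M ⊤ (p + 1))
    (hb : Near M n 2 (K + 1) (ofParam b * coordX ^ p) (ofParam b' * coordX ^ p))
    (hv : Near M n 2 K v v') :
    Near M n 2 (K + 1) (conjStep p a a' α R R' b v) (conjStep p a a' α R R' b' v') := by
  have h1 := near_conjRem (a := a) (a' := a') (α := α) hR hR' hv
  refine Near.add ⟨linInvAt_mem_filt (K := 1) (filt_le h1.1 (by omega)),
    linInvAt_mem_filt (K := 1) (filt_le h1.2 (by omega)), ?_⟩ hb
  rw [← linInvAt_sub]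
  exact filt_le (linInvAt_mem_filt (K := K + 2) (filt_le h1.3 (by omega))) (by omega)

/-- A fixed point is determined by `b`, and in parameter degree `< n` it depends only on `b` in
parameter degree `< n`. -/
lemma near_of_fixed {a a' α : 𝕜} {R R' v v' : FormalFamily m 𝕜} {b b' : ParamSeries m 𝕜}
    (hR : R ∈ Filt M ⊤ (p + 1)) (hR' : R' ∈ Filt M ⊤ (p + 1))
    (hb : ∀ K, Near M n 2 K (ofParam b * coordX ^ p) (ofParam b' * coordX ^ p : FormalFamily m 𝕜))
    (hv : v ∈ Filt M ⊤ 2) (hv' : v' ∈ Filt M ⊤ 2)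
    (h : conjStep p a a' α R R' b v = v) (h' : conjStep p a a' α R R' b' v' = v') (K : ℕ) :
    Near M n 2 K v v' := by
  have h0 : ∀ K, Near M n 2 K (conjStep p a a' α R R' b v) (conjStep p a a' α R R' b' v') →
      Near M n 2 K v v' := fun K hK => by rwa [h, h'] at hK
  induction K with
  | zero => exact ⟨hv, hv', sub_mem (filt_of_top hv) (filt_of_top hv')⟩
  | succ K ih => exact h0 _ (near_conjStep hR hR' (hb _) ih)

lemma exists_conjStep_fixed {a a' α : 𝕜} {R R' : FormalFamily m 𝕜} {b : ParamSeries m 𝕜}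
    (hR : R ∈ Filt M ⊤ (p + 1)) (hR' : R' ∈ Filt M ⊤ (p + 1))
    (hb : ofParam b * coordX ^ p ∈ (Filt M ⊤ 2 : Ideal (FormalFamily m 𝕜)))
    (S : Set (FormalFamily m 𝕜)) (h0 : (0 : FormalFamily m 𝕜) ∈ S)
    (hcl : ∀ f : FormalFamily m 𝕜,
      (∀ K, ∃ g ∈ S, ∀ d, wt M d < K → coeff d f = coeff d g) → f ∈ S)
    (hmaps : ∀ v ∈ S, v ∈ Filt M ⊤ 2 → conjStep p a a' α R R' b v ∈ S) :
    ∃ v ∈ S, v ∈ Filt M ⊤ 2 ∧ conjStep p a a' α R R' b v = v := by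
  obtain ⟨v, ⟨hvS, hvF⟩, hv⟩ := exists_fixedPoint_series (wt M)
    {v : FormalFamily m 𝕜 | v ∈ S ∧ v ∈ Filt M ⊤ 2} (conjStep p a a' α R R' b)
    (fun g hg => ⟨hmaps g hg.1 hg.2, (near_conjStep (K := 0) (n := ⊤) hR hR'
      (Near.refl _ hb) (Near.refl _ hg.2)).1⟩) ⟨0, h0, zero_mem _⟩
    (fun f hf => ⟨hcl f fun K => by
        obtain ⟨g, hg, h⟩ := hf K; exact ⟨g, hg.1, h⟩, fun d hd _ => by
        obtain ⟨g, hg, h⟩ := hf 2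
        exact (h d hd).trans (mem_filt_top.1 hg.2 d hd)⟩)
    (fun f hf g hg K hfg d hd => by
      rcases le_or_gt 2 K with hK | hK
      · obtain ⟨L, rfl⟩ := Nat.exists_eq_add_of_le hK
        have h1 : Near M ⊤ 2 L f g := ⟨hf.2, hg.2, mem_filt_top.2 fun d hd => by
          rw [map_sub, hfg d hd, sub_self]⟩
        have h2 := mem_filt_top.1 (near_conjStep (a := a) (a' := a') (α := α) hR hR'
          (Near.refl _ hb) h1).3 d (by omega)
        rw [map_sub] at h2
        exact sub_eq_zero.1 h2
      · have h2 : ∀ f : FormalFamily m 𝕜, f ∈ Filt M ⊤ 2 →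
            coeff d (conjStep p a a' α R R' b f) = 0 :=
          fun f hf => mem_filt_top.1 (near_conjStep (K := 0) (n := ⊤) hR hR'
            (Near.refl _ hb) (Near.refl _ hf)).1 d (by omega)
        rw [h2 f hf.2, h2 g hg.2])
  exact ⟨v, hvS, hvF, hv⟩

end Step

/-! ### Leading terms of conjugate families. -/

section Lead

variable {𝕜 : Type*} [Field 𝕜] {m : ℕ} {M : ℕ}

lemma lead_compCoord {X' φ : FormalFamily m 𝕜} {q : ℕ} (hM : q + 2 ≤ M)
    (hφ : IsCoordChange φ) (hX' : ∀ j < q, coeffXZero j X' = 0) :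
    compCoord X' φ ∈ Filt M ⊤ q ∧
      coeffXZero q (compCoord X' φ) = coeffXZero q X' * coeffXZero 1 φ ^ q := by
  have h1 := hφ.sub_mem_filt (M := M) (by omega)
  have hφ1 := mem_filt_one_of_sub h1
  set α := coeffXZero 1 φ
  have h2 := sub_lead_mem_filt (M := M) (by omega) hX'
  set c := coeffXZero q X'
  have h3 := compHom_mem_filt hφ1 h2
  rw [map_sub, map_smul, map_pow, compHom_coordX, compHom_apply] at h3
  have h4 := (Near.pow (n := ⊤) (K := 1) (p := 1) ⟨hφ1, filt_smul α coordX_mem_filt, h1⟩ q).3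
  rw [mul_one, smul_pow] at h4
  have h5 : compCoord X' φ - (c * α ^ q) • coordX ^ q ∈ Filt M ⊤ (q + 1) := by
    have := add_mem h3 (filt_smul c h4)
    rw [smul_sub, smul_smul] at this
    rwa [sub_add_sub_cancel] at this
  refine ⟨filt_of_sub_coordX_pow h5, ?_⟩
  have h6 := mem_filt_top.1 h5 (Finsupp.single none q) (by simp)
  rw [map_sub, sub_eq_zero] at h6
  rw [coeffXZero, h6]
  exact coeffXZero_smul_pow _ _

lemma lead_of_conj {X X' φ : FormalFamily m 𝕜} {p : ℕ} (h : Conjugates φ X X')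
    (hX : ∀ j < p, coeffXZero j X = 0) :
    (∀ j < p, coeffXZero j X' = 0) ∧
      coeffXZero p X' * coeffXZero 1 φ ^ p = coeffXZero p X * coeffXZero 1 φ := by
  have hα := h.1.lead_ne_zero
  have h1 := h.1.sub_mem_filt (M := p + 2) (by omega)
  have h2 := sub_lead_mem_filt (M := p + 2) (by omega) hX
  have h3 : compCoord X' φ - (coeffXZero p X * coeffXZero 1 φ) • coordX ^ p
      ∈ Filt (p + 2) ⊤ (p + 1) := by
    rw [h.2]
    have h4 := pderiv_mem_filt (K := 1) h1
    rw [map_sub, Derivation.map_smul, pderiv_coordX] at h4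
    have e : X * MvPowerSeries.pderiv 𝕜 none φ - (coeffXZero p X * coeffXZero 1 φ) • coordX ^ p =
        (X - coeffXZero p X • coordX ^ p) * MvPowerSeries.pderiv 𝕜 none φ +
        coeffXZero p X • (coordX ^ p * (MvPowerSeries.pderiv 𝕜 none φ - coeffXZero 1 φ • 1)) := by
      simp only [MvPowerSeries.smul_eq_C_mul, map_mul]; ring
    rw [e]
    exact add_mem (Ideal.mul_mem_right _ _ h2)
      (filt_smul _ (filt_mul (coordX_pow_mem_filt p) h4))
  have h5 := filt_of_sub_coordX_pow h3
  -- Once the lower coefficients of `X'` vanish, the `j`-th coefficient of `X'(φ)` is that of `X'`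
  -- times `α^j`, while the equation of conjugacy makes it zero.
  have h6 : ∀ j < p, coeffXZero j X' = 0 := by
    intro j
    induction j using Nat.strong_induction_on with
    | _ j ih =>
      intro hj
      have h7 := (lead_compCoord (M := p + 2) (by omega) h.1 fun i hi => ih i hi (hi.trans hj)).2
      rw [coeffXZero, mem_filt_top.1 h5 _ (by simpa using hj)] at h7
      exact (mul_eq_zero.1 h7.symm).resolve_right (pow_ne_zero _ hα)
  refine ⟨h6, ?_⟩
  rw [← (lead_compCoord (M := p + 2) le_rfl h.1 h6).2]
  have h7 := mem_filt_top.1 h3 (Finsupp.single none p) (by simp)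
  rw [map_sub, sub_eq_zero] at h7
  rw [coeffXZero, h7]
  exact coeffXZero_smul_pow _ _

end Lead

open scoped ENNReal NNReal

/-! ### Weighted `ℓ¹` norms. -/

section Norm

variable {𝕜 : Type*} [RCLike 𝕜] {m : ℕ} {M : ℕ} {r s : ℝ≥0∞} {p : ℕ}

/-- The weighted `ℓ¹` norm of a series, on a polydisc of radii `r` in `x` and `r ^ M` in `λ`. -/
def nrm (M : ℕ) (r : ℝ≥0∞) (f : FormalFamily m 𝕜) : ℝ≥0∞ := ∑' d, ‖coeff d f‖ₑ * r ^ wt M d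

lemma nrm_zero : nrm M r (0 : FormalFamily m 𝕜) = 0 := by simp [nrm]

lemma nrm_add_le (f g : FormalFamily m 𝕜) : nrm M r (f + g) ≤ nrm M r f + nrm M r g := by
  rw [nrm, nrm, nrm, ← ENNReal.tsum_add]
  refine ENNReal.tsum_le_tsum fun d => ?_
  rw [← add_mul, map_add]
  gcongr
  exact enorm_add_le _ _

lemma nrm_neg (f : FormalFamily m 𝕜) : nrm M r (-f) = nrm M r f := by simp [nrm]

lemma nrm_sub_le (f g : FormalFamily m 𝕜) : nrm M r (f - g) ≤ nrm M r f + nrm M r g := by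
  rw [sub_eq_add_neg, ← nrm_neg g]; exact nrm_add_le _ _

lemma nrm_smul (c : 𝕜) (f : FormalFamily m 𝕜) : nrm M r (c • f) = ‖c‖ₑ * nrm M r f := by
  rw [nrm, nrm, ← ENNReal.tsum_mul_left]
  congr 1; funext d
  rw [MvPowerSeries.coeff_smul, enorm_mul, mul_assoc]

lemma nrm_sum_le {ι : Type*} (t : Finset ι) (f : ι → FormalFamily m 𝕜) :
    nrm M r (∑ i ∈ t, f i) ≤ ∑ i ∈ t, nrm M r (f i) := by
  classical
  induction t using Finset.induction_on with
  | empty => simp [nrm_zero]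
  | insert i t hi ih =>
    rw [Finset.sum_insert hi, Finset.sum_insert hi]
    exact (nrm_add_le _ _).trans (by gcongr)

lemma nrm_mul_le (f g : FormalFamily m 𝕜) : nrm M r (f * g) ≤ nrm M r f * nrm M r g := by
  set F : (Option (Fin m) →₀ ℕ) × (Option (Fin m) →₀ ℕ) → ℝ≥0∞ := fun q =>
    (‖coeff q.1 f‖ₑ * r ^ wt M q.1) * (‖coeff q.2 g‖ₑ * r ^ wt M q.2)
  have h1 : nrm M r f * nrm M r g = ∑' q, F q := by
    rw [ENNReal.tsum_prod', nrm, nrm, ← ENNReal.tsum_mul_right]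
    congr 1; funext d
    rw [← ENNReal.tsum_mul_left]
  have h2 : ∑' q, F q = ∑' d, ∑ q ∈ Finset.HasAntidiagonal.antidiagonal d, F q := by
    rw [← Finset.HasAntidiagonal.sigmaAntidiagonalEquivProd.tsum_eq, ENNReal.tsum_sigma']
    congr 1; funext d
    rw [tsum_fintype]
    exact Finset.sum_coe_sort (Finset.HasAntidiagonal.antidiagonal d) F
  rw [h1, h2, nrm]
  refine ENNReal.tsum_le_tsum fun d => ?_
  rw [MvPowerSeries.coeff_mul]
  calc _ ≤ (∑ q ∈ Finset.HasAntidiagonal.antidiagonal d, ‖coeff q.1 f * coeff q.2 g‖ₑ) *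
        r ^ wt M d := by gcongr; exact enorm_sum_le _ _
    _ = _ := by
      rw [Finset.sum_mul]
      refine Finset.sum_congr rfl fun q hq => ?_
      rw [← Finset.HasAntidiagonal.mem_antidiagonal.1 hq, wt_add, pow_add, enorm_mul]
      ring

lemma nrm_coordX_pow (j : ℕ) : nrm M r (coordX ^ j : FormalFamily m 𝕜) = r ^ j := by
  classical
  rw [nrm, coordX_pow, tsum_eq_single (Finsupp.single none j)]
  · rw [MvPowerSeries.coeff_monomial, if_pos rfl, enorm_one, one_mul, wt_single_none]
  · intro d hd
    rw [MvPowerSeries.coeff_monomial, if_neg hd, enorm_zero, zero_mul]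

lemma nrm_coordX : nrm M r (coordX : FormalFamily m 𝕜) = r := by
  simpa using nrm_coordX_pow (𝕜 := 𝕜) (m := m) (M := M) (r := r) 1

lemma nrm_pow_le (f : FormalFamily m 𝕜) (j : ℕ) : nrm M r (f ^ j) ≤ nrm M r f ^ j := by
  induction j with
  | zero => simpa using (nrm_coordX_pow (𝕜 := 𝕜) (m := m) (M := M) (r := r) 0).le
  | succ j ih =>
    rw [pow_succ, pow_succ]
    exact (nrm_mul_le _ _).trans (by gcongr)

lemma nrm_mono (h : r ≤ s) (f : FormalFamily m 𝕜) : nrm M r f ≤ nrm M s f :=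
  ENNReal.tsum_le_tsum fun d => by gcongr

/-- A Schwarz lemma: shrinking the polydisc by `t` gains `t^q` on series of weight at least `q`. It
supplies the small factors of the estimates. -/
lemma nrm_mul_le_of_filt {t : ℝ≥0∞} (ht : t ≤ 1) {f : FormalFamily m 𝕜} {q : ℕ}
    (hf : f ∈ Filt M ⊤ q) : nrm M (t * r) f ≤ t ^ q * nrm M r f := by
  rw [nrm, nrm, ← ENNReal.tsum_mul_left]
  refine ENNReal.tsum_le_tsum fun d => ?_
  rcases lt_or_ge (wt M d) q with h | h
  · rw [mem_filt_top.1 hf d h]; simp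
  · rw [mul_pow, mul_left_comm]
    gcongr ?_ * _
    exact pow_le_pow_right_of_le_one' ht h

/-- A finite partial sum sees only finitely many weights. Hence balls are closed for agreement of
coefficients, as the fixed point theorem requires. -/
lemma nrm_le_of_agree {f : FormalFamily m 𝕜} {C : ℝ≥0∞}
    (h : ∀ K, ∃ g : FormalFamily m 𝕜, nrm M r g ≤ C ∧ ∀ d, wt M d < K → coeff d f = coeff d g) :
    nrm M r f ≤ C := by
  rw [nrm, ENNReal.tsum_eq_iSup_sum]
  refine iSup_le fun D => ?_
  obtain ⟨g, hg, hfg⟩ := h (D.sup (wt M) + 1)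
  refine le_trans (le_of_eq ?_) ((ENNReal.sum_le_tsum D).trans hg)
  refine Finset.sum_congr rfl fun d hd => ?_
  rw [hfg d (Nat.lt_succ_of_le (Finset.le_sup hd))]

lemma nrm_ofParam (b : ParamSeries m 𝕜) :
    nrm M r (ofParam b : FormalFamily m 𝕜) = ∑' a, ‖coeff a b‖ₑ * r ^ (M * a.degree) := by
  have hinj : Function.Injective (fun a : Fin m →₀ ℕ => a.optionElim 0) := fun a a' h => by
    have := congrArg Finsupp.some h
    simpa using this
  rw [nrm, ← hinj.tsum_eq]
  · congr 1; funext a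
    rw [coeff_ofParam, Finsupp.optionElim_apply_none, if_pos rfl, Finsupp.some_optionElim,
      wt_optionElim, zero_add]
  · intro d hd
    refine ⟨d.some, ?_⟩
    have h0 : d none = 0 := by
      by_contra h
      apply hd
      dsimp only
      rw [coeff_ofParam, if_neg h, enorm_zero, zero_mul]
    dsimp only
    rw [← h0, Finsupp.optionElim_some]

lemma optionElim_injective : Function.Injective
    (fun q : ℕ × (Fin m →₀ ℕ) => q.2.optionElim q.1) := fun q q' h => by
  have h1 := congrArg Finsupp.some h
  have h2 := DFunLike.congr_fun h none
  simp only [Finsupp.some_optionElim, Finsupp.optionElim_apply_none] at h1 h2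
  exact Prod.ext h2 h1

/-- The norm of a composition. -/
lemma nrm_compHom_le {φ : FormalFamily m 𝕜} (hφ : φ ∈ Filt M ⊤ 1) (f : FormalFamily m 𝕜)
    (hs : nrm M r φ ≤ s) (hrs : r ≤ s) :
    nrm M r (compHom φ (constantCoeff_of_filt hφ) f) ≤ nrm M s f := by
  refine nrm_le_of_agree fun K => ?_
  obtain ⟨h, hh⟩ := exists_expansion f K
  refine ⟨∑ i ∈ Finset.range K, ofParam (coeffX i f) * φ ^ i, ?_, fun d hd => ?_⟩
  · refine (nrm_sum_le _ _).trans ?_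
    calc ∑ i ∈ Finset.range K, nrm M r (ofParam (coeffX i f) * φ ^ i)
        ≤ ∑ i ∈ Finset.range K, ∑' a : Fin m →₀ ℕ,
          ‖coeff (a.optionElim i) f‖ₑ * s ^ wt M (a.optionElim i) := by
          refine Finset.sum_le_sum fun i _ => ?_
          calc nrm M r (ofParam (coeffX i f) * φ ^ i)
              ≤ nrm M s (ofParam (coeffX i f) : FormalFamily m 𝕜) * s ^ i := by
                refine (nrm_mul_le _ _).trans ?_
                gcongr
                · exact nrm_mono hrs _
                · exact (nrm_pow_le _ _).trans (by gcongr)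
            _ = _ := by
                rw [nrm_ofParam, ← ENNReal.tsum_mul_right]
                congr 1; funext a
                rw [coeff_coeffX, wt_optionElim, pow_add]; ring
      _ ≤ ∑' i, ∑' a : Fin m →₀ ℕ,
          ‖coeff (a.optionElim i) f‖ₑ * s ^ wt M (a.optionElim i) := ENNReal.sum_le_tsum _
      _ ≤ nrm M s f := by
        rw [← ENNReal.tsum_prod]
        exact ENNReal.tsum_comp_le_tsum_of_injective optionElim_injective
          (fun d => ‖coeff d f‖ₑ * s ^ wt M d)
  · rw [compHom_expansion _ hh, map_add]
    have h1 : compHom φ (constantCoeff_of_filt hφ) h * φ ^ K ∈ Filt M ⊤ K :=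
      Ideal.mul_mem_left _ _ (by simpa using filt_pow hφ K)
    rw [mem_filt_top.1 h1 d hd, add_zero]

lemma nrm_le_of_shift {f g : FormalFamily m 𝕜} {C : ℝ≥0∞}
    (h : ∀ d, ‖coeff d f‖ₑ ≤ C * ‖coeff (d + Finsupp.single none p) g‖ₑ) :
    nrm M r f * r ^ p ≤ C * nrm M r g := by
  rw [nrm, nrm, ← ENNReal.tsum_mul_right, ← ENNReal.tsum_mul_left]
  have hinj : Function.Injective (fun d : Option (Fin m) →₀ ℕ => d + Finsupp.single none p) :=
    add_left_injective _
  refine le_trans (ENNReal.tsum_le_tsum fun d => ?_) (ENNReal.tsum_comp_le_tsum_of_injective hinj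
    fun d => C * (‖coeff d g‖ₑ * r ^ wt M d))
  rw [wt_add, wt_single_none, pow_add, ← mul_assoc, ← mul_assoc]
  gcongr
  exact h d

/-- The divisors are integers, so there are no small divisors; for `d = p` the inverse is zero by
convention. -/
lemma norm_natCast_sub_inv_le (d p : ℕ) : ‖((d : 𝕜) - p)⁻¹‖ ≤ 1 := by
  rcases eq_or_ne d p with rfl | h
  · simp
  · rw [norm_inv]
    apply inv_le_one_of_one_le₀
    have h1 : ((d : 𝕜) - p) = (((d : ℤ) - p : ℤ) : 𝕜) := by push_cast; rfl
    have h2 : (1 : ℤ) ≤ |(d : ℤ) - p| := Int.one_le_abs (sub_ne_zero.2 (by exact_mod_cast h))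
    have h3 : (((d : ℤ) - p : ℤ) : 𝕜) = ((((d : ℤ) - p : ℤ) : ℝ) : 𝕜) := by push_cast; rfl
    rw [h1, h3, RCLike.norm_ofReal]
    exact_mod_cast h2

lemma norm_natCast_div_le (d p : ℕ) : ‖(d : 𝕜) * ((d : 𝕜) - p)⁻¹‖ ≤ p + 1 := by
  rcases eq_or_ne d p with rfl | h
  · simp; positivity
  · have h1 : (d : 𝕜) - p ≠ 0 := sub_ne_zero.2 (by exact_mod_cast h)
    have e : (d : 𝕜) * ((d : 𝕜) - p)⁻¹ = 1 + p * ((d : 𝕜) - p)⁻¹ := by field_simp; ring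
    rw [e]
    refine (norm_add_le _ _).trans ?_
    rw [norm_one, norm_mul, RCLike.norm_natCast, add_comm]
    have := mul_le_mul_of_nonneg_left (norm_natCast_sub_inv_le (𝕜 := 𝕜) d p) (Nat.cast_nonneg (α := ℝ) p)
    linarith

lemma nrm_linInvAt_le (g : FormalFamily m 𝕜) :
    nrm M r (linInvAt p g) * r ^ p ≤ nrm M r (coordX * g) := by
  rw [← one_mul (nrm M r (coordX * g))]
  refine nrm_le_of_shift fun d => ?_
  rw [coeff_linInvAt, div_eq_mul_inv, enorm_mul, mul_comm]
  gcongr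
  have := norm_natCast_sub_inv_le (𝕜 := 𝕜) (d none) p
  rw [← ofReal_norm]
  exact ENNReal.ofReal_le_one.2 this

/-- The divisor `d - p` grows like the factor `d` created by `x ∂/∂x`. No derivative is lost, so one
fixed radius suffices for the whole iteration. -/
lemma nrm_pderiv_linInvAt_le (g : FormalFamily m 𝕜) :
    nrm M r (coordX * MvPowerSeries.pderiv 𝕜 none (linInvAt p g)) * r ^ p ≤
      (p + 1) * nrm M r (coordX * g) := by
  refine nrm_le_of_shift fun d => ?_
  rw [coeff_coordX_mul_pderiv, coeff_linInvAt, div_eq_mul_inv, mul_left_comm, enorm_mul, mul_comm]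
  gcongr
  have := norm_natCast_div_le (𝕜 := 𝕜) (d none) p
  rw [← ofReal_norm]
  refine (ENNReal.ofReal_le_ofReal this).trans (le_of_eq ?_)
  rw [ENNReal.ofReal_add (by positivity) zero_le_one, ENNReal.ofReal_natCast, ENNReal.ofReal_one]

/-- `δ` is the size of `v` relative to `x`, and the bound is quadratic in it. The constant is
uniform in the radius, which can therefore be shrunk afterwards. -/
lemma exists_nrm_powRem_le (α : 𝕜) (p : ℕ) : ∃ C : ℝ≥0, ∀ (δ r : ℝ≥0∞) (v : FormalFamily m 𝕜),
    δ ≤ 1 → nrm M r v ≤ δ * r → nrm M r (powRem α p v) ≤ C * δ ^ 2 * r ^ p := by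
  induction p with
  | zero => exact ⟨0, fun δ r v _ _ => by rw [powRem_zero, nrm_zero]; exact zero_le⟩
  | succ p ih =>
    obtain ⟨C, hC⟩ := ih
    refine ⟨(‖α‖₊ + 1) * C + p * ‖α‖₊ ^ (p - 1), fun δ r v hδ hv => ?_⟩
    have hα : nrm M r (α • coordX : FormalFamily m 𝕜) = ‖α‖₊ * r := by
      rw [nrm_smul, nrm_coordX]; rfl
    rw [powRem_succ]
    refine (nrm_add_le _ _).trans ?_
    have h1 : nrm M r ((α • coordX + v) * powRem α p v) ≤
        ((‖α‖₊ + 1) * r) * (C * δ ^ 2 * r ^ p) := by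
      refine (nrm_mul_le _ _).trans ?_
      gcongr
      · refine (nrm_add_le _ _).trans ?_
        rw [hα, add_mul]
        gcongr
        exact hv.trans (by gcongr)
      · exact hC δ r v hδ hv
    have h2 : nrm M r ((p : 𝕜) • ((α • coordX) ^ (p - 1) * v ^ 2)) ≤
        p * ((‖α‖₊ * r) ^ (p - 1) * (δ * r) ^ 2) := by
      rw [nrm_smul]
      have : ‖(p : 𝕜)‖ₑ = p := by rw [← ofReal_norm, RCLike.norm_natCast, ENNReal.ofReal_natCast]
      rw [this]
      gcongr
      refine (nrm_mul_le _ _).trans ?_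
      gcongr
      · exact (nrm_pow_le _ _).trans (by rw [hα])
      · exact (nrm_pow_le _ _).trans (by gcongr)
    refine (add_le_add h1 h2).trans (le_of_eq ?_)
    push_cast
    rcases p with _ | p
    · simp; ring
    · rw [Nat.add_sub_cancel]; ring

end Norm

/-! ### Convergence in terms of the norms. -/

section Convergence

variable {𝕜 : Type*} [RCLike 𝕜] {m : ℕ} {M : ℕ}

lemma IsConvergent.exists_nrm (hM : 1 ≤ M) {f : FormalFamily m 𝕜} (h : IsConvergent f) :
    ∃ r : ℝ≥0, 0 < r ∧ r ≤ 1 ∧ nrm M r f ≠ ∞ := by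
  obtain ⟨r, hr, hs⟩ := h
  lift r to ℝ≥0 using hr.le
  set ρ : ℝ≥0 := min r 1
  refine ⟨ρ, lt_min (by exact_mod_cast hr) one_pos, min_le_right _ _, ?_⟩
  refine ne_top_of_le_ne_top hs.tsum_ofReal_ne_top (ENNReal.tsum_le_tsum fun d => ?_)
  rw [ENNReal.ofReal_mul (norm_nonneg _), ofReal_norm]
  gcongr
  have h1 : wt M d ≥ d.degree := by
    rw [wt, degree_eq]; nlinarith
  have h2 : ρ ^ wt M d ≤ r ^ d.degree :=
    (pow_le_pow_right_of_le_one' (min_le_right _ _) h1).trans (by gcongr; exact min_le_left _ _)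
  rw [← NNReal.coe_pow, ENNReal.ofReal_coe_nnreal]
  exact_mod_cast h2

lemma isConvergent_of_nrm (hM : 1 ≤ M) {f : FormalFamily m 𝕜} {r : ℝ≥0} (hr : 0 < r) (hr1 : r ≤ 1)
    (h : nrm M r f ≠ ∞) : IsConvergent f := by
  refine ⟨(r : ℝ) ^ M, by positivity, ?_⟩
  have h1 := ENNReal.summable_toReal h
  refine Summable.of_nonneg_of_le (fun d => by positivity) (fun d => ?_) h1
  rw [ENNReal.toReal_mul, toReal_enorm, ENNReal.toReal_pow, ENNReal.coe_toReal, ← pow_mul]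
  gcongr ?_ * ?_
  refine pow_le_pow_of_le_one r.2 (by exact_mod_cast hr1) ?_
  rw [wt, degree_eq]; nlinarith

end Convergence

/-! ### Convergent fixed points. -/

section Convergence

variable {𝕜 : Type*} [RCLike 𝕜] {m : ℕ} {M p : ℕ}

lemma exists_eq_coe {x : ℝ≥0∞} (h : x ≠ ∞) : ∃ c : ℝ≥0, x = c :=
  ⟨x.toNNReal, (ENNReal.coe_toNNReal h).symm⟩

lemma exists_small (c : ℝ≥0) {e : ℝ≥0} (he : 0 < e) : ∃ x : ℝ≥0, 0 < x ∧ x ≤ 1 ∧ c * x ≤ e := by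
  refine ⟨min 1 (e / (c + 1)), lt_min one_pos (by positivity), min_le_left _ _, ?_⟩
  calc c * min 1 (e / (c + 1)) ≤ (c + 1) * (e / (c + 1)) := by
        gcongr
        · exact le_self_add
        · exact min_le_right _ _
    _ = e := mul_div_cancel₀ _ (by positivity)

/-- `η` is chosen first, to absorb the quadratic term into half of `c₃ η`; then `t` is chosen, small
compared with `η`. -/
lemma exists_small_pair (A c₁ c₂ c₄ : ℝ≥0) {c₃ c₅ : ℝ≥0} (h₃ : 0 < c₃) (h₅ : 0 < c₅) :
    ∃ η t : ℝ≥0, 0 < η ∧ 2 * η ≤ 1 ∧ 0 < t ∧ t ≤ 1 ∧ A * t ≤ 1 ∧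
      c₁ * η ^ 2 + c₂ * t ≤ c₃ * η ∧ c₄ * t ≤ c₅ * η := by
  obtain ⟨η, hη, -, h1⟩ := exists_small (2 + c₁) (e := min 1 (c₃ / 2)) (lt_min one_pos (by positivity))
  obtain ⟨t, ht, ht1, h2⟩ := exists_small (A + c₂ + c₄) (e := min 1 (min (c₃ / 2 * η) (c₅ * η)))
    (lt_min one_pos (lt_min (by positivity) (by positivity)))
  rw [le_min_iff] at h1
  rw [le_min_iff, le_min_iff] at h2
  refine ⟨η, t, hη, le_trans ?_ h1.1, ht, ht1, le_trans ?_ h2.1, ?_, le_trans ?_ h2.2.2⟩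
  · gcongr; exact le_self_add
  · gcongr; rw [add_assoc]; exact le_self_add
  · have h3 : c₁ * η ≤ c₃ / 2 := le_trans (by gcongr; exact le_add_self) h1.2
    have h4 : c₂ * t ≤ c₃ / 2 * η := le_trans (by
      gcongr; rw [add_right_comm]; exact le_add_self) h2.2.1
    calc c₁ * η ^ 2 + c₂ * t = (c₁ * η) * η + c₂ * t := by ring
      _ ≤ c₃ / 2 * η + c₃ / 2 * η := by gcongr
      _ = c₃ * η := by rw [← add_mul, add_halves]
  · gcongr; exact le_add_self

lemma coordX_mul_pderiv_ofParam_mul (b : ParamSeries m 𝕜) :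
    coordX * MvPowerSeries.pderiv 𝕜 none (ofParam b * coordX ^ p) =
      (p : 𝕜) • (ofParam b * coordX ^ p : FormalFamily m 𝕜) := by
  ext d
  rw [coeff_coordX_mul_pderiv, MvPowerSeries.coeff_smul, coeff_ofParam_mul_pow]
  split_ifs with h
  · rw [h]
  · rw [mul_zero, mul_zero]

lemma enorm_natCast (p : ℕ) : ‖(p : 𝕜)‖ₑ = p := by
  rw [← ofReal_norm, RCLike.norm_natCast, ENNReal.ofReal_natCast]

/-- A ball which is stable under the map whose fixed points are the conjugacies. -/
lemma exists_stable_ball {a a' α : 𝕜} {R R' : FormalFamily m 𝕜} {b : ParamSeries m 𝕜} (hM : 1 ≤ M)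
    (hR : R ∈ Filt M ⊤ (p + 1)) (hR' : R' ∈ Filt M ⊤ (p + 1))
    (hb : ofParam b * coordX ^ p ∈ (Filt M ⊤ 2 : Ideal (FormalFamily m 𝕜)))
    (hRc : IsConvergent R) (hR'c : IsConvergent R')
    (hbc : IsConvergent (ofParam b * coordX ^ p : FormalFamily m 𝕜)) :
    ∃ (r : ℝ≥0) (δ : ℝ≥0∞), 0 < r ∧ r ≤ 1 ∧ δ ≠ ∞ ∧ ∀ v : FormalFamily m 𝕜, v ∈ Filt M ⊤ 2 →
      nrm M r v ≤ δ → nrm M r (coordX * MvPowerSeries.pderiv 𝕜 none v) ≤ (p + 1) * δ →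
      nrm M r (conjStep p a a' α R R' b v) ≤ δ ∧
      nrm M r (coordX * MvPowerSeries.pderiv 𝕜 none (conjStep p a a' α R R' b v)) ≤
        (p + 1) * δ := by
  obtain ⟨r₁, h₁, h₁1, hn₁⟩ := hRc.exists_nrm hM
  obtain ⟨r₂, h₂, -, hn₂⟩ := hR'c.exists_nrm hM
  obtain ⟨r₃, h₃, -, hn₃⟩ := hbc.exists_nrm hM
  obtain ⟨ρ, hρ, e₁, e₂, e₃⟩ : ∃ ρ : ℝ≥0, 0 < ρ ∧ ρ ≤ r₁ ∧ ρ ≤ r₂ ∧ ρ ≤ r₃ :=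
    ⟨min r₁ (min r₂ r₃), lt_min h₁ (lt_min h₂ h₃), min_le_left _ _,
      (min_le_right _ _).trans (min_le_left _ _), (min_le_right _ _).trans (min_le_right _ _)⟩
  obtain ⟨C, hC⟩ := exists_eq_coe (ne_top_of_le_ne_top hn₁
    (nrm_mono (r := (ρ : ℝ≥0∞)) (by exact_mod_cast e₁) R))
  obtain ⟨C', hC'⟩ := exists_eq_coe (ne_top_of_le_ne_top hn₂
    (nrm_mono (r := (ρ : ℝ≥0∞)) (by exact_mod_cast e₂) R'))
  obtain ⟨B, hB⟩ := exists_eq_coe (ne_top_of_le_ne_top hn₃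
    (nrm_mono (r := (ρ : ℝ≥0∞)) (by exact_mod_cast e₃) _))
  obtain ⟨E, hE⟩ := exists_nrm_powRem_le (m := m) (M := M) α p
  set A : ℝ≥0 := ‖α‖₊ + 1
  -- The working radius is `σ = tρ`. After division by `t^(p+1)`, the quadratic remainder
  -- contributes `c₁ η²` to the norm of `x` times the remainder, and the terms in `R` and `R'`
  -- contribute at most `c₂ t`; the target is `c₃ η`.
  obtain ⟨η, t, hη, hη1, ht, ht1, hAt, H1, H2⟩ := exists_small_pair A
    (‖a⁻¹‖₊ * ‖a'‖₊ * E * 4 * ρ ^ (p + 1))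
    (‖a⁻¹‖₊ * ρ * (A ^ (p + 1) * C' + ‖α‖₊ * C + (p + 1) * C)) B (c₃ := ρ ^ (p + 1)) (c₅ := ρ)
    (by positivity) hρ
  obtain ⟨σ, hσ⟩ : ∃ σ : ℝ≥0, σ = t * ρ := ⟨_, rfl⟩
  have hr : 0 < σ := by rw [hσ]; positivity
  have hcast : ((σ : ℝ≥0) : ℝ≥0∞) = (t : ℝ≥0∞) * ρ := by rw [hσ]; exact ENNReal.coe_mul _ _
  -- Half of the radius `2ησ` is for the image of `linInvAt`, the other half for `b x^p`.
  refine ⟨σ, (2 * η * σ : ℝ≥0), hr, ?_, ENNReal.coe_ne_top, fun v hv hv1 hv2 => ?_⟩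
  · rw [hσ]; exact mul_le_one₀ ht1 (by positivity) (e₁.trans h₁1)
  have hδ : ((2 * η * σ : ℝ≥0) : ℝ≥0∞) = ((2 * η : ℝ≥0) : ℝ≥0∞) * ((σ : ℝ≥0) : ℝ≥0∞) :=
    ENNReal.coe_mul _ _
  have hφ : α • coordX + v ∈ Filt M ⊤ 1 := add_mem (filt_smul α coordX_mem_filt)
    (filt_le hv (by omega))
  have n1 : nrm M (σ : ℝ≥0) (powRem α p v) ≤
      E * ((2 * η : ℝ≥0) : ℝ≥0∞) ^ 2 * ((σ : ℝ≥0) : ℝ≥0∞) ^ p :=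
    hE _ _ v (by exact_mod_cast hη1) (by rw [← hδ]; exact hv1)
  have n2 : nrm M (σ : ℝ≥0) (compCoord R' (α • coordX + v)) ≤ (A * t : ℝ≥0) ^ (p + 1) * C' := by
    rw [← compHom_apply _ (constantCoeff_of_filt hφ)]
    refine (nrm_compHom_le (s := ((A * t : ℝ≥0) : ℝ≥0∞) * ρ) hφ R' ?_ ?_).trans ?_
    · refine (nrm_add_le _ _).trans ?_
      rw [nrm_smul, nrm_coordX]
      refine (add_le_add le_rfl hv1).trans ?_
      have : ‖α‖₊ * σ + 2 * η * σ ≤ A * t * ρ := by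
        rw [← add_mul, hσ, mul_assoc A]; gcongr; exact add_le_add le_rfl hη1
      rw [enorm_eq_nnnorm]; exact_mod_cast this
    · have : σ ≤ A * t * ρ := by
        rw [hσ]; gcongr; exact le_mul_of_one_le_left' le_add_self
      exact_mod_cast this
    · rw [← hC']; exact nrm_mul_le_of_filt (by exact_mod_cast hAt) hR'
  have n3 : nrm M (σ : ℝ≥0) R ≤ t ^ (p + 1) * C := by
    rw [← hC, hcast]; exact nrm_mul_le_of_filt (by exact_mod_cast ht1) hR
  have n4 : nrm M (σ : ℝ≥0) (ofParam b * coordX ^ p : FormalFamily m 𝕜) ≤ (η * σ : ℝ≥0) := by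
    have h1 : nrm M (σ : ℝ≥0) (ofParam b * coordX ^ p : FormalFamily m 𝕜) ≤ (t ^ 2 * B : ℝ≥0) := by
      push_cast
      rw [← hB, hcast]; exact nrm_mul_le_of_filt (by exact_mod_cast ht1) hb
    refine h1.trans ?_
    have : t ^ 2 * B ≤ η * σ := by
      calc t ^ 2 * B = t * (B * t) := by ring
        _ ≤ t * (ρ * η) := by gcongr
        _ = η * σ := by rw [hσ]; ring
    exact_mod_cast this
  -- The extra factor `x` turns `v'` into `x v'`, the quantity controlled by the second bound that
  -- defines the stable set.
  have n5 : nrm M (σ : ℝ≥0) (coordX * conjRem p a a' α R R' v) ≤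
      (η * σ ^ (p + 1) : ℝ≥0) := by
    have e : coordX * conjRem p a a' α R R' v = a⁻¹ • (a' • (coordX * powRem α p v) +
        coordX * compCoord R' (α • coordX + v) - α • (coordX * R) -
        R * (coordX * MvPowerSeries.pderiv 𝕜 none v)) := by
      rw [conjRem]; simp only [MvPowerSeries.smul_eq_C_mul]; ring
    have h1 : nrm M (σ : ℝ≥0) (coordX * conjRem p a a' α R R' v) ≤
        ((‖a⁻¹‖₊ * (‖a'‖₊ * (σ * (E * (2 * η) ^ 2 * σ ^ p)) +
          σ * ((A * t) ^ (p + 1) * C') + ‖α‖₊ * (σ * (t ^ (p + 1) * C)) +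
          t ^ (p + 1) * C * ((p + 1) * (2 * η * σ))) : ℝ≥0) : ℝ≥0∞) := by
      rw [e, nrm_smul, ENNReal.coe_mul]
      refine mul_le_mul' le_rfl ?_
      refine (nrm_sub_le _ _).trans ?_
      rw [ENNReal.coe_add]
      refine add_le_add ((nrm_sub_le _ _).trans ?_) ?_
      · rw [ENNReal.coe_add]
        refine add_le_add ((nrm_add_le _ _).trans ?_) ?_
        · rw [ENNReal.coe_add]
          refine add_le_add ?_ ?_
          · rw [nrm_smul, ENNReal.coe_mul, ENNReal.coe_mul σ]
            refine mul_le_mul' le_rfl ((nrm_mul_le _ _).trans (mul_le_mul' nrm_coordX.le ?_))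
            exact_mod_cast n1
          · rw [ENNReal.coe_mul σ]
            refine (nrm_mul_le _ _).trans (mul_le_mul' nrm_coordX.le ?_)
            exact_mod_cast n2
        · rw [nrm_smul, ENNReal.coe_mul, ENNReal.coe_mul σ]
          refine mul_le_mul' le_rfl ((nrm_mul_le _ _).trans (mul_le_mul' nrm_coordX.le ?_))
          exact_mod_cast n3
      · rw [ENNReal.coe_mul]
        refine (nrm_mul_le _ _).trans (mul_le_mul' (by exact_mod_cast n3) ?_)
        exact_mod_cast hv2
    refine h1.trans (ENNReal.coe_le_coe.2 ?_)
    calc _ = t ^ (p + 1) * (‖a⁻¹‖₊ * ‖a'‖₊ * E * 4 * ρ ^ (p + 1) * η ^ 2 +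
          ‖a⁻¹‖₊ * ρ * (A ^ (p + 1) * C' + ‖α‖₊ * C + (p + 1) * C * (2 * η)) * t) := by rw [hσ]; ring_nf
      _ ≤ t ^ (p + 1) * (‖a⁻¹‖₊ * ‖a'‖₊ * E * 4 * ρ ^ (p + 1) * η ^ 2 +
          ‖a⁻¹‖₊ * ρ * (A ^ (p + 1) * C' + ‖α‖₊ * C + (p + 1) * C) * t) := by
        have h5 : ((p : ℝ≥0) + 1) * C * (2 * η) ≤ (p + 1) * C := mul_le_of_le_one_right' hη1
        gcongr
      _ ≤ t ^ (p + 1) * (ρ ^ (p + 1) * η) := by gcongr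
      _ = η * σ ^ (p + 1) := by rw [hσ]; ring
  have hcancel : ∀ x y : ℝ≥0∞, x * ((σ : ℝ≥0) : ℝ≥0∞) ^ p ≤ y * ((σ : ℝ≥0) : ℝ≥0∞) ^ p →
      x ≤ y := fun x y h =>
    (ENNReal.mul_le_mul_iff_right (pow_ne_zero _ (by exact_mod_cast hr.ne'))
      (ENNReal.pow_ne_top ENNReal.coe_ne_top)).1 (by rwa [mul_comm x, mul_comm y] at h)
  have n6 : nrm M (σ : ℝ≥0) (linInvAt p (conjRem p a a' α R R' v)) ≤ (η * σ : ℝ≥0) := by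
    refine hcancel _ _ ((nrm_linInvAt_le _).trans (n5.trans (le_of_eq ?_)))
    rw [pow_succ]; push_cast; ring
  have n7 : nrm M (σ : ℝ≥0) (coordX * MvPowerSeries.pderiv 𝕜 none
      (linInvAt p (conjRem p a a' α R R' v))) ≤ (p + 1) * (η * σ : ℝ≥0) := by
    refine hcancel _ _ ((nrm_pderiv_linInvAt_le _).trans
      ((mul_le_mul' le_rfl n5).trans (le_of_eq ?_)))
    rw [pow_succ]; push_cast; ring
  have e2 : ((2 * η * σ : ℝ≥0) : ℝ≥0∞) = (η * σ : ℝ≥0) + (η * σ : ℝ≥0) := by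
    rw [← ENNReal.coe_add]; congr 1; ring
  refine ⟨?_, ?_⟩
  · rw [conjStep, e2]
    exact (nrm_add_le _ _).trans (add_le_add n6 n4)
  · rw [conjStep, map_add, mul_add, coordX_mul_pderiv_ofParam_mul, e2, mul_add]
    refine (nrm_add_le _ _).trans (add_le_add n7 ?_)
    rw [nrm_smul, enorm_natCast]
    exact mul_le_mul' le_self_add n4

lemma exists_convergent_fixed {a a' α : 𝕜} {R R' : FormalFamily m 𝕜} {b : ParamSeries m 𝕜}
    (hM : 1 ≤ M)
    (hR : R ∈ Filt M ⊤ (p + 1)) (hR' : R' ∈ Filt M ⊤ (p + 1))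
    (hb : ofParam b * coordX ^ p ∈ (Filt M ⊤ 2 : Ideal (FormalFamily m 𝕜)))
    (hRc : IsConvergent R) (hR'c : IsConvergent R')
    (hbc : IsConvergent (ofParam b * coordX ^ p : FormalFamily m 𝕜)) :
    ∃ v : FormalFamily m 𝕜, IsConvergent v ∧ v ∈ Filt M ⊤ 2 ∧ conjStep p a a' α R R' b v = v := by
  obtain ⟨r, δ, hr, hr1, hδ, h⟩ := exists_stable_ball (a := a) (a' := a') (α := α) hM hR hR' hb
    hRc hR'c hbc
  obtain ⟨v, ⟨hv1, -⟩, hv, hf⟩ := exists_conjStep_fixed (a := a) (a' := a') (α := α) hR hR' hb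
    {v : FormalFamily m 𝕜 | nrm M r v ≤ δ ∧
      nrm M r (coordX * MvPowerSeries.pderiv 𝕜 none v) ≤ (p + 1) * δ}
    (by simp [nrm_zero])
    (fun f hf => ⟨nrm_le_of_agree fun K => by
        obtain ⟨g, hg, hfg⟩ := hf K; exact ⟨g, hg.1, hfg⟩, nrm_le_of_agree fun K => by
        obtain ⟨g, hg, hfg⟩ := hf K
        exact ⟨_, hg.2, fun d hd => by
          rw [coeff_coordX_mul_pderiv, coeff_coordX_mul_pderiv, hfg d hd]⟩⟩)
    (fun v hv hv2 => h v hv2 hv.1 hv.2)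
  exact ⟨v, isConvergent_of_nrm hM hr hr1 (ne_top_of_le_ne_top hδ hv1), hv, hf⟩

lemma IsConvergent.add {f g : FormalFamily m 𝕜} (hf : IsConvergent f) (hg : IsConvergent g) :
    IsConvergent (f + g) := by
  obtain ⟨r, hr, hr1, h⟩ := hf.exists_nrm le_rfl
  obtain ⟨s, hs, -, h'⟩ := hg.exists_nrm le_rfl
  refine isConvergent_of_nrm le_rfl (lt_min hr hs) ((min_le_left _ _).trans hr1)
    (ne_top_of_le_ne_top (ENNReal.add_ne_top.2 ⟨h, h'⟩) ((nrm_add_le _ _).trans (add_le_add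
      (nrm_mono ?_ _) (nrm_mono ?_ _))))
  · exact_mod_cast min_le_left _ _
  · exact_mod_cast min_le_right _ _

lemma isConvergent_smul_coordX_pow (c : 𝕜) (j : ℕ) :
    IsConvergent (c • coordX ^ j : FormalFamily m 𝕜) := by
  refine isConvergent_of_nrm (M := 1) le_rfl one_pos le_rfl ?_
  rw [nrm_smul, nrm_coordX_pow]
  simp

/-- The truncation of a series in the parameters. -/
def truncParam (n : ℕ) (b : ParamSeries m 𝕜) : ParamSeries m 𝕜 := fun a =>
  if a.degree < n then coeff a b else 0

lemma coeff_truncParam (n : ℕ) (b : ParamSeries m 𝕜) (a : Fin m →₀ ℕ) :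
    coeff a (truncParam n b) = if a.degree < n then coeff a b else 0 := rfl

lemma isConvergent_truncParam (n : ℕ) (b : ParamSeries m 𝕜) (j : ℕ) :
    IsConvergent (ofParam (truncParam n b) * coordX ^ j : FormalFamily m 𝕜) := by
  refine isConvergent_of_nrm (M := 1) le_rfl one_pos le_rfl
    (ne_top_of_le_ne_top (ENNReal.mul_ne_top ?_ ?_) (nrm_mul_le _ _))
  · have hfin : {a : Fin m →₀ ℕ | a.degree ≤ n}.Finite := Finsupp.finite_of_degree_le n
    rw [nrm_ofParam, tsum_eq_sum (s := hfin.toFinset)]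
    · exact ENNReal.sum_ne_top.2 fun a _ => by simp
    · intro a ha
      have : ¬ a.degree < n := fun h => ha (hfin.mem_toFinset.2 h.le)
      rw [coeff_truncParam, if_neg this]; simp
  · rw [nrm_coordX_pow]; simp

end Convergence

/-! ### Powers of the ideal of the parameters. -/

section Ideal

variable {𝕜 : Type*} [Field 𝕜] {m : ℕ}

lemma X_some_mem_lambdaIdeal (i : Fin m) :
    (MvPowerSeries.X (some i) : FormalFamily m 𝕜) ∈ lambdaIdeal m 𝕜 := by
  classical
  rw [lambdaIdeal, RingHom.mem_ker]
  ext j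
  rw [coeff_atZero, map_zero, coeffXZero, MvPowerSeries.coeff_X, if_neg]
  intro h
  have := DFunLike.congr_fun h (some i)
  simp at this

/-- Each monomial with a parameter is divided by the first parameter occurring in it. This writes `f
= Σ λ_i g_i` with `g_i` vanishing in one parameter degree less, and induction applies. -/
lemma mem_lambdaIdeal_pow {n : ℕ} {f : FormalFamily m 𝕜}
    (hf : ∀ d, pdeg d < n → coeff d f = 0) : f ∈ lambdaIdeal m 𝕜 ^ n := by
  classical
  induction n generalizing f with
  | zero => simp
  | succ n ih =>
    obtain ⟨g, hg⟩ : ∃ g : Fin m → FormalFamily m 𝕜, ∀ i d, coeff d (g i) =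
        if ∀ j < i, d (some j) = 0 then coeff (d + Finsupp.single (some i) 1) f else 0 :=
      ⟨fun i d => if ∀ j < i, d (some j) = 0 then coeff (d + Finsupp.single (some i) 1) f else 0,
        fun i d => rfl⟩
    have h1 : f = ∑ i, MvPowerSeries.X (some i) * g i := by
      ext d
      rw [map_sum]
      have h2 : ∀ i, coeff d (MvPowerSeries.X (some i) * g i) =
          if d (some i) ≠ 0 ∧ ∀ j < i, d (some j) = 0 then coeff d f else 0 := fun i => by
        rw [MvPowerSeries.X, MvPowerSeries.coeff_monomial_mul, one_mul]
        by_cases hi : Finsupp.single (some i) 1 ≤ d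
        · rw [if_pos hi, hg, tsub_add_cancel_of_le hi]
          have h3 := Nat.one_le_iff_ne_zero.1 (Finsupp.single_le_iff.1 hi)
          refine if_congr ?_ rfl rfl
          refine ⟨fun h => ⟨h3, fun j hj => ?_⟩, fun h j hj => ?_⟩
          · simpa [Finsupp.single_apply, hj.ne'] using h j hj
          · simp [h.2 j hj]
        · rw [if_neg hi, if_neg]
          exact fun h => hi (Finsupp.single_le_iff.2 (Nat.one_le_iff_ne_zero.2 h.1))
      simp_rw [h2]
      by_cases hd : pdeg d = 0
      · rw [hf d (by omega)]; simp
      · obtain ⟨i, hi, hmin⟩ := WellFounded.has_min (wellFounded_lt (α := Fin m))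
          {i | d (some i) ≠ 0} (by
            by_contra h
            rw [Set.not_nonempty_iff_eq_empty, Set.eq_empty_iff_forall_notMem] at h
            apply hd
            rw [pdeg, Finsupp.degree_eq_zero_iff]
            ext i
            simpa using h i)
        have hmin' : ∀ j < i, d (some j) = 0 := fun j hj => by
          by_contra h
          exact hmin j h hj
        rw [Finset.sum_eq_single i, if_pos ⟨hi, hmin'⟩]
        · intro j _ hj
          refine if_neg fun h => ?_
          rcases lt_or_gt_of_ne hj with h' | h'
          · exact h.1 (hmin' j h')
          · exact hi (h.2 i h')
        · intro h; exact absurd (Finset.mem_univ i) h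
    rw [h1, pow_succ']
    refine sum_mem fun i _ => Ideal.mul_mem_mul (X_some_mem_lambdaIdeal i) (ih fun d hd => ?_)
    rw [hg]
    split_ifs
    · refine hf _ ?_
      rw [pdeg_add]
      have : pdeg (Finsupp.single (some i) 1 : Option (Fin m) →₀ ℕ) = 1 := by
        rw [pdeg, Finsupp.some_single_some, Finsupp.degree_single]
      omega
    · rfl

end Ideal

/-! ### Approximation of formal conjugacies by convergent ones. -/

section Approximation

variable {𝕜 : Type*} [RCLike 𝕜] {m : ℕ}

/-- A formal conjugacy of convergent families is approximated by convergent ones. -/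
lemma exists_convergent_conj {X X' φ : FormalFamily m 𝕜} (hX : IsConvergent X)
    (hX' : IsConvergent X') (h0 : atZero X ≠ 0) (h : Conjugates φ X X') (n : ℕ) :
    ∃ ψ : FormalFamily m 𝕜, IsConvergent ψ ∧ Conjugates ψ X X' ∧
      ψ - φ ∈ lambdaIdeal m 𝕜 ^ n := by
  classical
  have hex : ∃ p, coeffXZero p X ≠ 0 := by
    by_contra hne
    push Not at hne
    exact h0 (by ext j; rw [coeff_atZero, hne, map_zero])
  obtain ⟨p, ha, hp⟩ : ∃ p, coeffXZero p X ≠ 0 ∧ ∀ j < p, coeffXZero j X = 0 :=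
    ⟨Nat.find hex, Nat.find_spec hex, fun j hj => not_not.1 (Nat.find_min hex hj)⟩
  obtain ⟨hp', haα⟩ := lead_of_conj h hp
  have hα := h.1.lead_ne_zero
  have hv := h.1.sub_mem_filt (M := p + 2) (by omega)
  have hφ1 := mem_filt_one_of_sub hv
  have hR := sub_lead_mem_filt (M := p + 2) (by omega) hp
  have hR' := sub_lead_mem_filt (M := p + 2) (by omega) hp'
  generalize coeffXZero 1 φ = α at *
  generalize coeffXZero p X = a at *
  generalize coeffXZero p X' = a' at *
  have hRc : IsConvergent (X - a • coordX ^ p) := by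
    rw [sub_eq_add_neg, ← neg_smul]; exact hX.add (isConvergent_smul_coordX_pow _ _)
  have hR'c : IsConvergent (X' - a' • coordX ^ p) := by
    rw [sub_eq_add_neg, ← neg_smul]; exact hX'.add (isConvergent_smul_coordX_pow _ _)
  have hfix : ∀ ψ : FormalFamily m 𝕜, Conjugates ψ X X' → ψ - α • coordX ∈ Filt (p + 2) ⊤ 2 →
      conjStep p a a' α (X - a • coordX ^ p) (X' - a' • coordX ^ p)
        (coeffX p (ψ - α • coordX)) (ψ - α • coordX) = ψ - α • coordX := fun ψ hψ hψ2 =>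
    conjStep_of_conj ha hα haα (constantCoeff_of_filt (filt_le hψ2 (by omega))) (by
      rw [add_sub_cancel, add_sub_cancel, add_sub_cancel]; exact hψ.2)
  set b := coeffX p (φ - α • coordX) with hb
  have hbF : ofParam b * coordX ^ p ∈ (Filt (p + 2) ⊤ 2 : Ideal (FormalFamily m 𝕜)) :=
    coeffX_mul_pow_mem_filt hv p
  have hbnF : ofParam (truncParam n b) * coordX ^ p ∈
      (Filt (p + 2) ⊤ 2 : Ideal (FormalFamily m 𝕜)) :=
    ofParam_mul_pow_mem_filt.2 fun d h1 h2 => by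
      rw [coeff_truncParam]
      split_ifs
      · exact ofParam_mul_pow_mem_filt.1 hbF d h1 h2
      · rfl
  have hbb : ∀ K, Near (p + 2) n 2 K (ofParam (truncParam n b) * coordX ^ p : FormalFamily m 𝕜)
      (ofParam b * coordX ^ p) := fun K => ⟨hbnF, hbF, by
    rw [← sub_mul, ← map_sub]
    refine ofParam_mul_pow_mem_filt.2 fun d _ h2 => ?_
    rw [map_sub, coeff_truncParam, if_pos (by exact_mod_cast h2), sub_self]⟩
  have hX1 := filt_of_sub_coordX_pow hR
  -- The coefficient of `x^p` is the only possible source of divergence. A formal flow of `X`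
  -- replaces it by its polynomial truncation, and the result is still a formal conjugacy.
  obtain ⟨t, ht, htφ⟩ := exists_flow_time (M := p + 2) ha hα (by omega) hR hv
    (φ' := φ + (ofParam (truncParam n b) * coordX ^ p - ofParam b * coordX ^ p)) (by
      rw [sub_add_cancel_left]; exact neg_mem (sub_mem hbnF hbF))
  have htX := ofParam_mul_filt_two (by omega) hX1 ht
  have hψ := h.flow (M := p + 2) (by omega) htX
  have hψ2 : expDer (p + 2) (flowDer X t) φ - α • coordX ∈ Filt (p + 2) ⊤ 2 := by
    have := add_mem (expDer_sub_self (raises_flowDer htX) hφ1) hv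
    rwa [sub_add_sub_cancel] at this
  set ψ := expDer (p + 2) (flowDer X t) φ
  have hψb : coeffX p (ψ - α • coordX) = truncParam n b := by
    rw [map_sub, htφ, map_add, map_sub, coeffX_ofParam_mul_pow, coeffX_ofParam_mul_pow, if_pos rfl,
      if_pos rfl, hb, map_sub]
    ring
  have f1 := hfix ψ hψ hψ2
  rw [hψb] at f1
  have f2 := hfix φ h hv
  -- The convergent fixed point is not known to give a conjugacy, but by uniqueness it equals `ψ -
  -- αx`, which does.
  obtain ⟨w, hwc, hw, f3⟩ := exists_convergent_fixed (a := a) (a' := a') (α := α) (M := p + 2)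
    (by omega) hR hR' hbnF hRc hR'c (isConvergent_truncParam n b p)
  have hwψ : ψ - α • coordX = w := eq_of_sub_mem_filt (M := p + 2) fun K =>
    filt_le (near_of_fixed (n := ⊤) hR hR' (fun K => Near.refl K hbnF) hψ2 hw f1 f3 K).3 (by omega)
  refine ⟨ψ, ?_, hψ, mem_lambdaIdeal_pow fun d hd => ?_⟩
  · rw [← sub_add_cancel ψ (α • coordX), hwψ]
    have := isConvergent_smul_coordX_pow (m := m) α 1
    rw [pow_one] at this
    exact hwc.add this
  -- The free coefficients of `ψ` and `φ` agree in parameter degree `< n`, hence so do the two fixed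
  -- points.
  · have := (near_of_fixed hR hR' hbb hψ2 hv f1 f2 (wt (p + 2) d)).3
    rw [sub_sub_sub_cancel_right] at this
    exact this d (by omega) (by exact_mod_cast hd)

end Approximation

end

end KostovFormal

theorem mainTheorem5 :
    -- (1) Formal theory over `ℂ`: existence of the normal form, `k = 0`
    (∀ (m : ℕ) (X : FormalFamily m ℂ), IsUnfoldingOfOrder 0 X →
      ∃ c : ParamSeries m ℂ, FormallyConjugate X (linearForm c)) ∧
    -- existence of the normal form, `k ≥ 1`
    (∀ (m k : ℕ), 1 ≤ k → ∀ X : FormalFamily m ℂ, IsUnfoldingOfOrder k X →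
      ∃ (y : Fin k → ParamSeries m ℂ) (μ : ParamSeries m ℂ),
        (∀ j, MvPowerSeries.constantCoeff (y j) = 0) ∧
        FormallyConjugate X (normalForm k 1 y μ) ∧
        μ = -residueAtInfinity (denominator k 1 μ) (numerator k y) ∧
        μ = residueSum X) ∧
    -- uniqueness of the normal form, `k = 0`
    (∀ (m : ℕ) (c c' : ParamSeries m ℂ), MvPowerSeries.constantCoeff c ≠ 0 →
      MvPowerSeries.constantCoeff c' ≠ 0 →
      ∀ φ : FormalFamily m ℂ, Conjugates φ (linearForm c) (linearForm c') →
        c' = c ∧ ∃ t e : ParamSeries m ℂ, IsFormalExp t e ∧ φ = ofParam e * coordX) ∧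
    -- uniqueness of the normal form up to rotations, `k ≥ 1`
    (∀ (m k : ℕ), 1 ≤ k → ∀ (y y' : Fin k → ParamSeries m ℂ) (μ μ' : ParamSeries m ℂ),
      (∀ j, MvPowerSeries.constantCoeff (y j) = 0) →
      (∀ j, MvPowerSeries.constantCoeff (y' j) = 0) →
      (FormallyConjugate (normalForm k 1 y μ) (normalForm k 1 y' μ') ↔
        μ' = μ ∧ ∃ l : Fin k, ∀ j : Fin k, y' j =
          Complex.exp (-(2 * Real.pi * Complex.I * (((j : ℕ) : ℂ) - 1) * ((l : ℕ) : ℂ) / k)) •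
            y j) ∧
      ∀ φ : FormalFamily m ℂ, Conjugates φ (normalForm k 1 y μ) (normalForm k 1 y' μ') →
        ∃ (l : Fin k) (t : ParamSeries m ℂ) (F : FormalFamily m ℂ),
          (∀ j : Fin k, y' j =
            Complex.exp (-(2 * Real.pi * Complex.I * (((j : ℕ) : ℂ) - 1) * ((l : ℕ) : ℂ) / k)) •
              y j) ∧
          IsFormalFlow (normalForm k 1 y μ) t F ∧
          φ = Complex.exp (2 * Real.pi * Complex.I * ((l : ℕ) : ℂ) / k) • F) ∧
    -- universality, `k ≥ 1`
    (∀ k : ℕ, 1 ≤ k → ∀ μ : ℂ, IsUniversal (standardDeformation k 1 μ)) ∧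
    -- Formal theory over `ℝ`: existence of the normal form, `k = 0`
    (∀ (m : ℕ) (X : FormalFamily m ℝ), IsUnfoldingOfOrder 0 X →
      ∃ c : ParamSeries m ℝ, FormallyConjugate X (linearForm c)) ∧
    -- existence of the normal form, `k ≥ 1`
    (∀ (m k : ℕ), 1 ≤ k → ∀ X : FormalFamily m ℝ, IsUnfoldingOfOrder k X →
      ∃ (ε : ℝ) (y : Fin k → ParamSeries m ℝ) (μ : ParamSeries m ℝ),
        (ε = 1 ∨ ε = -1) ∧
        (∀ j, MvPowerSeries.constantCoeff (y j) = 0) ∧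
        FormallyConjugate X (normalForm k (ε ^ (k + 1)) y μ) ∧
        μ = -residueAtInfinity (denominator k (ε ^ (k + 1)) μ) (numerator k y) ∧
        μ = residueSum X) ∧
    -- uniqueness of the normal form, `k = 0`
    (∀ (m : ℕ) (c c' : ParamSeries m ℝ), MvPowerSeries.constantCoeff c ≠ 0 →
      MvPowerSeries.constantCoeff c' ≠ 0 →
      ∀ φ : FormalFamily m ℝ, Conjugates φ (linearForm c) (linearForm c') →
        c' = c ∧ ∃ (δ : ℝ) (t e : ParamSeries m ℝ), (δ = 1 ∨ δ = -1) ∧ IsFormalExp t e ∧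
          φ = δ • (ofParam e * coordX)) ∧
    -- uniqueness of the normal form up to the real rotations, `k ≥ 1`
    (∀ (m k : ℕ), 1 ≤ k → ∀ (ε ε' : ℝ) (y y' : Fin k → ParamSeries m ℝ) (μ μ' : ParamSeries m ℝ),
      (ε = 1 ∨ ε = -1) → (ε' = 1 ∨ ε' = -1) →
      (∀ j, MvPowerSeries.constantCoeff (y j) = 0) →
      (∀ j, MvPowerSeries.constantCoeff (y' j) = 0) →
      (FormallyConjugate (normalForm k (ε ^ (k + 1)) y μ)
          (normalForm k (ε' ^ (k + 1)) y' μ') ↔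
        ε' ^ (k + 1) = ε ^ (k + 1) ∧ μ' = μ ∧
          ∃ ζ : ℝ, (ζ = 1 ∨ (Even k ∧ ζ = -1)) ∧ ∀ j : Fin k, y' j = ζ ^ (1 - ((j : ℕ) : ℤ)) • y j) ∧
      ∀ φ : FormalFamily m ℝ,
        Conjugates φ (normalForm k (ε ^ (k + 1)) y μ) (normalForm k (ε' ^ (k + 1)) y' μ') →
        ∃ (ζ : ℝ) (t : ParamSeries m ℝ) (F : FormalFamily m ℝ),
          (ζ = 1 ∨ (Even k ∧ ζ = -1)) ∧
          (∀ j : Fin k, y' j = ζ ^ (1 - ((j : ℕ) : ℤ)) • y j) ∧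
          IsFormalFlow (normalForm k (ε ^ (k + 1)) y μ) t F ∧
          φ = ζ • F) ∧
    -- universality, `k ≥ 1`
    (∀ k : ℕ, 1 ≤ k → ∀ ε μ : ℝ, (ε = 1 ∨ ε = -1) →
      IsUniversal (standardDeformation k (ε ^ (k + 1)) μ)) ∧
    -- (2) Formal and analytic conjugacy of analytic families
    (∀ (m : ℕ) (X X' : FormalFamily m ℂ), IsConvergent X → IsConvergent X' → atZero X ≠ 0 →
      (FormallyConjugate X X' ↔ AnalyticallyConjugate X X') ∧
      ∀ φ : FormalFamily m ℂ, Conjugates φ X X' → ∀ n : ℕ, 0 < n →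
        ∃ φₙ : FormalFamily m ℂ, IsConvergent φₙ ∧ Conjugates φₙ X X' ∧
          φₙ - φ ∈ lambdaIdeal m ℂ ^ n) := by
  refine ⟨fun m X hX => exists_conj_linearForm hX, fun m k hk X hX => existence_complex hk hX,
    fun m c c' hc _ φ h => linear_uniqueness_complex c c' hc φ h,
    fun m k hk y y' μ μ' hy hy' => uniqueness_complex hk y y' μ μ' hy hy',
    fun k hk μ => isUniversal_standardDeformation hk one_ne_zero μ,
    fun m X hX => exists_conj_linearForm hX, fun m k hk X hX => existence_real hk hX,
    fun m c c' hc _ φ h => linear_uniqueness_real c c' hc φ h,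
    fun m k hk ε ε' y y' μ μ' hε hε' hy hy' => uniqueness_real hk ε ε' y y' μ μ' hε hε' hy hy',
    fun k hk ε μ hε => isUniversal_standardDeformation hk (sign_pow_ne_zero hε _) μ, ?_⟩
  exact fun m X X' hX hX' h0 => ⟨⟨fun ⟨φ, h⟩ => by
      obtain ⟨ψ, hc, hψ, -⟩ := exists_convergent_conj hX hX' h0 h 1
      exact ⟨ψ, hc, hψ⟩, fun ⟨φ, _, h⟩ => ⟨φ, h⟩⟩,
    fun φ h n _ => exists_convergent_conj hX hX' h0 h n⟩
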